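/- Requests for documents are described on the time axis $[0,\infty)$, on a probability space, as follows. Environment. Let $T_0\le 0<T_1<T_2<\cdots\to\infty$ (a.s.) be jump times and $X_0,X_1,\dots$ random states in $\{1,\dots,M\}$, $M<\infty$, with the semi-Markov property: for $n\ge 1$ and given $X_0,T_0,\dots,X_n,T_n$, the pair $(X_{n+1},T_{n+1}-T_n)$ has a law $Q(X_n,\cdot)$ that depends only on $X_n$; the embedded chain with transition matrix $p_{ij}=Q(i,\{j\}\times\mathbb R)$ is irreducible. Put $J_t=X_n$ for $T_n\le t<T_{n+1}$. The semi-Markov process is stationary, together with its jump times: the law of $(J_{t+s},\,A_{t+s})_{t\ge 0}$ does not depend on $s\ge 0$, where $A_t$ is the time elapsed at time $t$ since the last jump. (As the embedded chain is irreducible, it is then ergodic.) Let $\pi_r=\mathbb P[J_0=r]>0$, $1\le r\le M$. Requests. Requests arrive at the points $0<\tau_1<\tau_2<\cdots$ of a unit-rate Poisson process which is independent of the environment $(X_n,T_n)_{n\ge 0}$. For each state $r$ let $(q^{(r)}_i)_{i\ge 1}$ be a probability mass function on the infinite set of documents $i=1,2,\dots$, all of unit size. Let $R_n$ be the document requested at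 time $\tau_n$. Given the environment and the arrival times, the requests are independent and $R_n$ has the mass function $q^{(J_{\tau_n})}$; that is, for all $n$ and $i_1,\dots,i_n$, $$\mathbb P\big[R_l=i_l,\ 1\le l\le n\,\big|\,(X_k,T_k)_{k\ge0},(\tau_k)_{k\ge1}\big]=\prod_{l=1}^n q^{(J_{\tau_l})}_{i_l}.$$ Let $q_i=\sum_{r=1}^M\pi_r q^{(r)}_i$ be the marginal popularity of document $i$, and assume that $q_i>0$ for all $i$ and $q_1\ge q_2\ge\cdots$. Policies. A policy $\pi\in\mathcal P_c(x)$ for a cache of size $x\in\mathbb N$ consists of an initial content (a set of at most $x$ documents) and of decision rules. Let $C^\pi_{\tau_n}$ be the content met by the $n$-th request. If $R_n\in C^\pi_{\tau_n}$ (a hit), the content is left unchanged. Otherwise (a fault) the next content is a subset of $C^\pi_{\tau_n}\cup\{R_n\}$ with at most $x$ elements, chosen as a function of $R_1,\dots,R_n$ and $C^\pi_{\tau_1},\dots,C^\pi_{\tau_n}$ only. The long-run fault probability is $$P(\pi,x)=\limsup_{t\to\infty}\frac1t\,\mathbb E\Big[\sum_{\tau_n\in[0,t]}1[R_n\notin C^\pi_{\tau_n}]\Big].$$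 Let $P_s(x)$ be the long-run fault probability of the static policy, which keeps the content $\{1,\dots,x\}$ for ever. Theorem. For every $x$, $P_s(x)=\sum_{i>x}q_i$. Moreover, $$\lim_{x\to\infty}\frac{\inf_{\pi\in\mathcal P_c(x)}P(\pi,x)}{P_s(x)}=1,$$ that is, the static policy that keeps the $x$ most popular documents is asymptotically optimal. -/

import Mathlib

open MeasureTheory ProbabilityTheory Filter Topology
open scoped ENNReal NNReal

noncomputable section

/-! ### Requests arrive at the points of a Poisson process

All processes are described on the time axis `[0, ∞)`. -/

/-- The number of points `τ 0, τ 1, …` that lie in `(-∞, t]`. -/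
def countingProcess {Ω : Type*} (τ : ℕ → Ω → ℝ) (t : ℝ≥0) (ω : Ω) : ℕ :=
  {n : ℕ | τ n ω ≤ t}.ncard

/-- `0 < τ 0 < τ 1 < …` are the points in `(0, ∞)` of a Poisson process of unit rate. -/
structure IsUnitPoisson {Ω : Type*} [MeasurableSpace Ω] (τ : ℕ → Ω → ℝ) (μ : Measure Ω) :
    Prop where
  measurable : ∀ n, Measurable (τ n)
  first_pos : ∀ᵐ ω ∂μ, 0 < τ 0 ω
  strictMono : ∀ᵐ ω ∂μ, StrictMono fun n => τ n ω
  locally_finite : ∀ᵐ ω ∂μ, Tendsto (fun n => τ n ω) atTop atTop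
  indep_increments : HasIndepIncrements (countingProcess τ) μ
  increment_law : ∀ s t : ℝ≥0, s ≤ t →
    HasLaw (fun ω => countingProcess τ t ω - countingProcess τ s ω) (poissonMeasure (t - s)) μ

/-! ### The stationary semi-Markov environment -/

/-- The index `n` with `T n ≤ t < T (n + 1)`. -/
def lastJump {Ω : Type*} (T : ℕ → Ω → ℝ) (t : ℝ) (ω : Ω) : ℕ :=
  sSup {n : ℕ | T n ω ≤ t}

/-- The piecewise constant right-continuous modulating process:
`J t = X n` for `T n ≤ t < T (n + 1)`. -/
def modulatingState {Ω : Type*} {M : ℕ} (T : ℕ → Ω → ℝ) (X : ℕ → Ω → Fin M) (t : ℝ) (ω : Ω) :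
    Fin M :=
  X (lastJump T t ω) ω

/-- The time that has passed at time `t` since the last jump. -/
def jumpAge {Ω : Type*} (T : ℕ → Ω → ℝ) (t : ℝ) (ω : Ω) : ℝ :=
  t - T (lastJump T t ω) ω

/-- The transition matrix `p i j` of the embedded Markov chain of a semi-Markov kernel, where
`Q i` is the joint law of the next state and of the sojourn time in the present state `i`. -/
def embeddedMatrix {M : ℕ} (Q : Kernel (Fin M) (Fin M × ℝ)) : Matrix (Fin M) (Fin M) ℝ :=
  fun i j => (Q i).real ({j} ×ˢ Set.univ)

/-- The σ-algebra generated by the states and jump times of index at most `n`. -/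
abbrev jumpHistory {Ω : Type*} {M : ℕ} (T : ℕ → Ω → ℝ) (X : ℕ → Ω → Fin M) (n : ℕ) :
    MeasurableSpace Ω :=
  MeasurableSpace.comap (fun ω => fun k : Fin (n + 1) => (X k ω, T k ω)) inferInstance

/-- A stationary semi-Markov process with states in `Fin M`, observed on `[0, ∞)`, with jumps at
`T 0 ≤ 0 < T 1 < T 2 < …`, where `X n` is the state entered at `T n`.
The semi-Markov property is required at the jumps `T n` with `n ≥ 1`; the interval `[T 0, T 1)`
covers the origin, hence is size-biased, and its law is governed by stationarity.
Stationarity is that of the process together with its jump times, and so of the pair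
`(state at t, age at t)`. -/
structure IsStationarySemiMarkov {Ω : Type*} [MeasurableSpace Ω] {M : ℕ}
    (Q : Kernel (Fin M) (Fin M × ℝ)) (T : ℕ → Ω → ℝ) (X : ℕ → Ω → Fin M) (μ : Measure Ω) :
    Prop where
  measurable_time : ∀ n, Measurable (T n)
  measurable_state : ∀ n, Measurable (X n)
  origin : ∀ᵐ ω ∂μ, T 0 ω ≤ 0 ∧ 0 < T 1 ω
  strictMono : ∀ᵐ ω ∂μ, StrictMono fun n => T n ω
  locally_finite : ∀ᵐ ω ∂μ, Tendsto (fun n => T n ω) atTop atTop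
  semiMarkov : ∀ n, 1 ≤ n → ∀ B : Set (Fin M × ℝ), MeasurableSet B →
    μ⟦(fun ω => (X (n + 1) ω, T (n + 1) ω - T n ω)) ⁻¹' B | jumpHistory T X n⟧
      =ᵐ[μ] fun ω => (Q (X n ω)).real B
  irreducible : (embeddedMatrix Q).IsIrreducible
  stationary : ∀ s : ℝ≥0, IdentDistrib
    (fun ω => fun t : ℝ≥0 => (modulatingState T X (t + s) ω, jumpAge T (t + s) ω))
    (fun ω => fun t : ℝ≥0 => (modulatingState T X t ω, jumpAge T t ω)) μ μ

/-! ### The modulated requests -/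

/-- The σ-algebra generated by the environment and the arrival times. -/
abbrev environmentSigma {Ω : Type*} {M : ℕ} (T : ℕ → Ω → ℝ) (X : ℕ → Ω → Fin M)
    (τ : ℕ → Ω → ℝ) : MeasurableSpace Ω :=
  MeasurableSpace.comap
    (fun ω => ((fun n => (X n ω, T n ω), fun n => τ n ω) : (ℕ → Fin M × ℝ) × (ℕ → ℝ)))
    inferInstance

/-- `R n` is the document requested at time `τ n`. Given the environment and the arrival times,
the requests are independent and `R n` has the law `q r`, where `r` is the state of the
environment at time `τ n`. -/
structure IsModulatedRequests {Ω : Type*} [MeasurableSpace Ω] {M : ℕ}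
    (q : Fin M → PMF ℕ) (T : ℕ → Ω → ℝ) (X : ℕ → Ω → Fin M) (τ : ℕ → Ω → ℝ) (R : ℕ → Ω → ℕ)
    (μ : Measure Ω) : Prop where
  measurable : ∀ n, Measurable (R n)
  conditional_law : ∀ (n : ℕ) (i : ℕ → ℕ),
    μ⟦{ω | ∀ l < n, R l ω = i l} | environmentSigma T X τ⟧
      =ᵐ[μ] fun ω => ∏ l ∈ Finset.range n, (q (modulatingState T X (τ l ω) ω) (i l)).toReal

/-- The stationary distribution `π r = P[J = r]` of the environment. -/
def stationaryProb {Ω : Type*} [MeasurableSpace Ω] {M : ℕ}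
    (T : ℕ → Ω → ℝ) (X : ℕ → Ω → Fin M) (μ : Measure Ω) (r : Fin M) : ℝ≥0∞ :=
  μ {ω | modulatingState T X 0 ω = r}

/-- The marginal popularity `∑ r, π r * q r i` of document `i`. Documents are numbered from `0`. -/
def popularity {Ω : Type*} [MeasurableSpace Ω] {M : ℕ} (q : Fin M → PMF ℕ)
    (T : ℕ → Ω → ℝ) (X : ℕ → Ω → Fin M) (μ : Measure Ω) (i : ℕ) : ℝ≥0∞ :=
  ∑ r, stationaryProb T X μ r * q r i

/-! ### Caching policies -/

/-- A non-anticipating policy for a cache that can store `x` documents.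
`update n r c` is the content chosen in case of a fault at the request number `n`, as a function of
the requests `r 0, …, r n` and of the contents `c 0, …, c n` that these requests have met.
It consists of documents of the present content and possibly the missing document. -/
structure CachePolicy (x : ℕ) where
  init : Finset ℕ
  init_card : init.card ≤ x
  update : (n : ℕ) → (Fin (n + 1) → ℕ) → (Fin (n + 1) → Finset ℕ) → Finset ℕ
  update_subset : ∀ n r c, update n r c ⊆ insert (r (Fin.last n)) (c (Fin.last n))
  update_card : ∀ n r c, (c (Fin.last n)).card ≤ x → (update n r c).card ≤ x

namespace CachePolicy

/-- The contents met by the requests number `0, …, n` if the requested documents are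
`r 0, r 1, …`. The content is left unchanged in case of a hit. -/
def history {x : ℕ} (π : CachePolicy x) (r : ℕ → ℕ) : (n : ℕ) → Fin (n + 1) → Finset ℕ
  | 0 => fun _ => π.init
  | n + 1 => Fin.snoc (α := fun _ => Finset ℕ) (π.history r n)
      (if r n ∈ π.history r n (Fin.last n) then π.history r n (Fin.last n)
        else π.update n (fun k => r k) (π.history r n))

/-- The content met by the request number `n`. -/
def content {x : ℕ} (π : CachePolicy x) (r : ℕ → ℕ) (n : ℕ) : Finset ℕ :=
  π.history r n (Fin.last n)

/-- The static policy, which keeps the `x` most popular documents for ever. -/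
def static (x : ℕ) : CachePolicy x where
  init := Finset.range x
  init_card := (Finset.card_range x).le
  update n _ c := c (Fin.last n)
  update_subset _ _ _ := Finset.subset_insert _ _
  update_card _ _ _ h := h

end CachePolicy

/-- The number of faults in the time interval `[0, t]`. -/
def faultCount {Ω : Type*} (τ : ℕ → Ω → ℝ) (R : ℕ → Ω → ℕ) {x : ℕ} (π : CachePolicy x) (t : ℝ)
    (ω : Ω) : ℝ≥0∞ :=
  ∑' n : ℕ, Set.indicator
    {n | τ n ω ∈ Set.Icc 0 t ∧ R n ω ∉ π.content (fun k => R k ω) n} (fun _ => 1) n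

/-- The long-run fault probability of a policy: the upper limit of the expected number of faults
per unit of time. -/
def faultProb {Ω : Type*} [MeasurableSpace Ω] (τ : ℕ → Ω → ℝ) (R : ℕ → Ω → ℕ) (μ : Measure Ω)
    {x : ℕ} (π : CachePolicy x) : ℝ≥0∞ :=
  limsup (fun t : ℝ => (∫⁻ ω, faultCount τ R π t ω ∂μ) / ENNReal.ofReal t) atTop

end

/-!
Why no policy can beat the static one asymptotically: cut time into blocks of a large but fixed
length `B`. A policy knows only the past requests, but the lower bound grants it even more, the
whole environment and all arrival times. Given these, the requests are independent
(`IsModulatedRequests.map_restrict_eq`), so the content at the start of a block is independent of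
the requests in it, and every document that is requested in the block and absent at its start
causes at least one fault there (`CachePolicy.card_image_sdiff_content_le`).

Suppose that in the block each state `r` meets at least `(1 - ε) π r B` requests. Then the document
`i` is requested in the block with a probability of at least `1 - exp (-(1 - ε) B q i)`. This bound
decreases in `i`, so that among all contents of at most `x` documents, the first `x` leave the
least sum of these bounds over the absent documents (`CachePolicy.tsum_add_le_lintegral_faults`).
For `x` large, `q i` is small for `i ≥ x`, and the bound is nearly its linearization
`(1 - ε) B q i` (`ofReal_mul_le_requestProbLower`). Hence the fault probability is at least
`(1 - ε) ^ 2 ∑_{i ≥ x} q i`, up to the probability that some state meets too few requests. As `B`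
does not depend on `x`, `ε` can be taken to zero after `x` has been taken to infinity
(`eventually_mul_le_faultProb`).

That all states meet enough requests is likely, uniformly over the position of the block, by a
second moment estimate (`exists_measure_stateCount_lt_le`). The second moment measure of the Poisson
process (`IsUnitPoisson.sum_map_prodMk`) reduces it to the mean ergodic theorem for the environment
(`IsStationarySemiMarkov.integral_sq_occupationTime_le`): the fraction of time spent in the state
`r` tends to `π r` in mean square. Sojourn times need no moments for the following proof. Truncate
each sojourn at a level `K`. By the Poisson equation of the embedded chain
(`Matrix.IsIrreducible.exists_poissonEquation`), the truncated time spent in `r` during `n` sojourns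
is a constant times `n` up to a martingale with bounded increments
(`IsStationarySemiMarkov.exists_truncatedOccupation_rate`). By stationarity, the age exceeds `K`
with a small probability that does not depend on time, so that truncation loses only a small
fraction of time. This bounds the fractions of time from below
(`IsStationarySemiMarkov.exists_occupationTime_lower`), and as they sum to one, it bounds them from
above too.

The static policy faults exactly on the requests for the documents `i ≥ x`, so that its fault
probability is given by stationarity and Campbell's formula (`faultProb_static`).
-/


/-! ### The Poisson equation of an irreducible stochastic matrix -/

section PoissonEquation

variable {n : Type*} [Fintype n]

/-- Minimum principle: a superharmonic function of an irreducible stochastic matrix is constant. -/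
theorem Matrix.IsIrreducible.eq_of_mulVec_le [Nonempty n] {P : Matrix n n ℝ}
    (hP : P.IsIrreducible) (hsum : ∀ i, ∑ j, P i j = 1) {h : n → ℝ} (hh : ∀ i, (P.mulVec h) i ≤ h i)
    (i j : n) : h i = h j := by
  obtain ⟨i₀, hi₀⟩ := Finite.exists_min h
  have step : ∀ i j, h i = h i₀ → 0 < P i j → h j = h i₀ := by
    intro i j hi hij
    have h0 : ∑ l, P i l * (h l - h i) ≤ 0 := by
      have : ∑ l, P i l * (h l - h i) = (P.mulVec h) i - h i := by
        simp only [mul_sub, Finset.sum_sub_distrib, ← Finset.sum_mul, hsum, one_mul]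
        rfl
      rw [this]; linarith [hh i]
    have hnn : ∀ l ∈ Finset.univ, 0 ≤ P i l * (h l - h i) := fun l _ =>
      mul_nonneg (hP.nonneg i l) (by rw [hi]; linarith [hi₀ l])
    have := (Finset.sum_eq_zero_iff_of_nonneg hnn).1 (le_antisymm h0 (Finset.sum_nonneg hnn)) j
      (Finset.mem_univ j)
    rcases mul_eq_zero.1 this with h1 | h1
    · exact absurd h1 hij.ne'
    · linarith
  have all : ∀ j, h j = h i₀ := by
    intro j
    let := P.toQuiver
    obtain ⟨p, -⟩ := hP.connected i₀ j
    induction p with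
    | nil => rfl
    | cons p e ih => exact step _ _ ih e.down
  rw [all i, all j]

/-- Solvability of the Poisson equation `g = c + h - P h`. -/
theorem Matrix.IsIrreducible.exists_poissonEquation [Nonempty n] {P : Matrix n n ℝ}
    (hP : P.IsIrreducible) (hsum : ∀ i, ∑ j, P i j = 1) (g : n → ℝ) :
    ∃ (c : ℝ) (h : n → ℝ), ∀ i, g i = c + h i - (P.mulVec h) i := by
  classical
  let one : n → ℝ := fun _ => 1
  let D : (n → ℝ) →ₗ[ℝ] (n → ℝ) := LinearMap.id - P.mulVecLin
  have hD : ∀ h i, D h i = h i - (P.mulVec h) i := fun h i => rfl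
  have hker : LinearMap.ker D ≤ Submodule.span ℝ {one} := by
    intro h hh
    obtain ⟨i₀⟩ := ‹Nonempty n›
    rw [Submodule.mem_span_singleton]
    refine ⟨h i₀, ?_⟩
    ext i
    have := hP.eq_of_mulVec_le hsum (h := h) (fun i => by
      have := congrFun (LinearMap.mem_ker.1 hh) i
      rw [hD] at this
      simp only [Pi.zero_apply] at this
      linarith) i i₀
    simp [one, this]
  -- if `h - P h = 1`, then `h` is superharmonic, hence constant, hence harmonic
  have hone : one ∉ LinearMap.range D := by
    rintro ⟨h, hh⟩
    have key : ∀ i, h i - (P.mulVec h) i = 1 := fun i => by rw [← hD, hh]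
    obtain ⟨i₀⟩ := ‹Nonempty n›
    have hc : ∀ i j, h i = h j := hP.eq_of_mulVec_le hsum (fun i => by linarith [key i])
    have : (P.mulVec h) i₀ = h i₀ := by
      simp only [Matrix.mulVec, dotProduct]
      rw [Finset.sum_congr rfl fun j _ => by rw [hc j i₀], ← Finset.sum_mul, hsum, one_mul]
    linarith [key i₀]
  have hone0 : one ≠ 0 := fun h0 => hone (h0 ▸ Submodule.zero_mem _)
  have hdisj : Disjoint (Submodule.span ℝ {one}) (LinearMap.range D) := by
    rw [disjoint_comm, Submodule.disjoint_span_singleton' hone0]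
    exact hone
  -- the range has codimension at most one and does not contain the constants
  have hsup : Submodule.span ℝ {one} ⊔ LinearMap.range D = ⊤ := by
    apply Submodule.eq_top_of_disjoint _ _ _ hdisj
    have h1 := LinearMap.finrank_range_add_finrank_ker D
    have h2 := Submodule.finrank_mono hker
    lia
  obtain ⟨u, hu, v, ⟨h, rfl⟩, huv⟩ := Submodule.mem_sup.1 (hsup ▸ Submodule.mem_top (x := g))
  obtain ⟨c, rfl⟩ := Submodule.mem_span_singleton.1 hu
  refine ⟨c, h, fun i => ?_⟩
  rw [← huv, Pi.add_apply, hD]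
  simp [one]
  ring

theorem Matrix.IsIrreducible.poissonEquation_const_nonneg [Nonempty n] {P : Matrix n n ℝ}
    (hP : P.IsIrreducible) (hsum : ∀ i, ∑ j, P i j = 1) {g h : n → ℝ} {c : ℝ}
    (hg : ∀ i, 0 ≤ g i) (hgh : ∀ i, g i = c + h i - (P.mulVec h) i) :
    0 ≤ c := by
  by_contra! hc
  have key : ∀ i j, h i = h j := hP.eq_of_mulVec_le hsum fun i => by linarith [hg i, hgh i]
  obtain ⟨i₀⟩ := ‹Nonempty n›
  have : (P.mulVec h) i₀ = h i₀ := by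
    simp only [Matrix.mulVec, dotProduct]
    rw [Finset.sum_congr rfl fun j _ => by rw [key j i₀], ← Finset.sum_mul, hsum, one_mul]
  linarith [hg i₀, hgh i₀]

/-- If `g` were nonnegative with `c ≤ 0`, then `h` would be superharmonic, hence constant, and
`g = c ≤ 0`. -/
theorem Matrix.IsIrreducible.poissonEquation_const_pos [Nonempty n] {P : Matrix n n ℝ}
    (hP : P.IsIrreducible) (hsum : ∀ i, ∑ j, P i j = 1) {g h : n → ℝ} {c : ℝ}
    (hg : ∀ i, 0 ≤ g i) (hgh : ∀ i, g i = c + h i - (P.mulVec h) i) {i₀ : n} (hi₀ : 0 < g i₀) :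
    0 < c := by
  by_contra! hc
  have key : ∀ i j, h i = h j := hP.eq_of_mulVec_le hsum fun i => by linarith [hg i, hgh i]
  have : (P.mulVec h) i₀ = h i₀ := by
    simp only [Matrix.mulVec, dotProduct]
    rw [Finset.sum_congr rfl fun j _ => by rw [key j i₀], ← Finset.sum_mul, hsum, one_mul]
  linarith [hgh i₀]

end PoissonEquation


/-! ### Occupation of the states in the first sojourns -/

section Sojourns

variable {Ω : Type*} [MeasurableSpace Ω] {μ : Measure Ω} {M : ℕ}
  {Q : Kernel (Fin M) (Fin M × ℝ)} {T : ℕ → Ω → ℝ} {X : ℕ → Ω → Fin M}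

theorem measurable_jumpHistory {Ω : Type*} {T : ℕ → Ω → ℝ} {X : ℕ → Ω → Fin M} {j n : ℕ}
    (hj : j ≤ n) :
    Measurable[jumpHistory T X n] fun ω => (X j ω, T j ω) :=
  (measurable_pi_apply (⟨j, Nat.lt_succ_of_le hj⟩ : Fin (n + 1))).comp
    (comap_measurable (fun ω => fun k : Fin (n + 1) => (X k ω, T k ω)))

theorem IsStationarySemiMarkov.jumpHistory_le (hJ : IsStationarySemiMarkov Q T X μ) (n : ℕ) :
    jumpHistory T X n ≤ ‹MeasurableSpace Ω› :=
  Measurable.comap_le (measurable_pi_lambda _ fun k : Fin (n + 1) =>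
    (hJ.measurable_state k).prodMk (hJ.measurable_time k))

/-- Conditionally on an event of the past on which the present state is `i`, the next state and
the present sojourn time have the law `Q i`. -/
theorem IsStationarySemiMarkov.map_restrict_eq [IsProbabilityMeasure μ] [IsMarkovKernel Q]
    (hJ : IsStationarySemiMarkov Q T X μ) {n : ℕ} (hn : 1 ≤ n) {A : Set Ω}
    (hA : MeasurableSet[jumpHistory T X n] A) {i : Fin M} (hAi : ∀ ω ∈ A, X n ω = i) :
    (μ.restrict A).map (fun ω => (X (n + 1) ω, T (n + 1) ω - T n ω)) = μ A • Q i := by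
  have hm := hJ.jumpHistory_le n
  have hY : Measurable fun ω => (X (n + 1) ω, T (n + 1) ω - T n ω) :=
    (hJ.measurable_state _).prodMk ((hJ.measurable_time _).sub (hJ.measurable_time _))
  ext B hB
  rw [Measure.map_apply hY hB, Measure.restrict_apply (hY hB), Measure.smul_apply, smul_eq_mul]
  have h1 : ∫ ω in A, (μ⟦(fun ω => (X (n + 1) ω, T (n + 1) ω - T n ω)) ⁻¹' B |
      jumpHistory T X n⟧) ω ∂μ = ∫ ω in A, (Q i).real B ∂μ := by
    rw [setIntegral_congr_ae (hm _ hA) ((hJ.semiMarkov n hn B hB).mono fun ω hω _ => hω)]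
    exact setIntegral_congr_fun (hm _ hA) fun ω hω => by simp only [hAi ω hω]
  rw [setIntegral_condExp hm ((integrable_const 1).indicator (hY hB)) hA,
    setIntegral_indicator (hY hB)] at h1
  simp only [integral_const, smul_eq_mul, mul_one, measureReal_restrict_apply_univ] at h1
  rw [← ENNReal.toReal_eq_toReal_iff' (by finiteness) (by finiteness), ENNReal.toReal_mul,
    Set.inter_comm]
  exact h1

/-- A bounded function of the present state, the next state and the present sojourn time, which is
centred given the present state, is centred given the past. -/
theorem IsStationarySemiMarkov.condExp_eq_zero [IsProbabilityMeasure μ] [IsMarkovKernel Q]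
    (hJ : IsStationarySemiMarkov Q T X μ) {n : ℕ} (hn : 1 ≤ n) {f : Fin M → Fin M × ℝ → ℝ}
    (hf : ∀ i, Measurable (f i)) {C : ℝ} (hC : ∀ i y, |f i y| ≤ C)
    (hf0 : ∀ i, ∫ y, f i y ∂Q i = 0) :
    μ[fun ω => f (X n ω) (X (n + 1) ω, T (n + 1) ω - T n ω) | jumpHistory T X n] =ᵐ[μ] 0 := by
  have hm := hJ.jumpHistory_le n
  have hY : Measurable fun ω => (X (n + 1) ω, T (n + 1) ω - T n ω) :=
    (hJ.measurable_state _).prodMk ((hJ.measurable_time _).sub (hJ.measurable_time _))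
  have hf' : Measurable (Function.uncurry f) := measurable_from_prod_countable_right hf
  have hD : Measurable fun ω => f (X n ω) (X (n + 1) ω, T (n + 1) ω - T n ω) :=
    hf'.comp ((hJ.measurable_state n).prodMk hY)
  have hint : Integrable (fun ω => f (X n ω) (X (n + 1) ω, T (n + 1) ω - T n ω)) μ :=
    Integrable.of_bound hD.aestronglyMeasurable C (ae_of_all _ fun ω => hC _ _)
  have hXn : Measurable[jumpHistory T X n] (X n) :=
    measurable_fst.comp (measurable_jumpHistory le_rfl)
  refine (ae_eq_condExp_of_forall_setIntegral_eq hm hint (fun _ _ _ => integrableOn_zero)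
    (fun A hA _ => ?_) aestronglyMeasurable_zero).symm
  have hcov : A = ⋃ i, A ∩ X n ⁻¹' {i} := by
    ext ω; simp
  have hAi : ∀ i, MeasurableSet[jumpHistory T X n] (A ∩ X n ⁻¹' {i}) := fun i =>
    hA.inter (hXn (measurableSet_singleton i))
  rw [hcov, integral_iUnion_fintype (fun i => hm _ (hAi i)) (fun i j hij => ?_)
    (fun i => hint.integrableOn)]
  · simp only [integral_zero]
    refine (Finset.sum_eq_zero fun i _ => ?_).symm
    have h1 := hJ.map_restrict_eq hn (hAi i) (i := i) fun ω hω => hω.2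
    rw [setIntegral_congr_fun (g := fun ω => f i (X (n + 1) ω, T (n + 1) ω - T n ω)) (hm _ (hAi i))
      (fun ω hω => by rw [show X n ω = i from hω.2]), ← integral_map hY.aemeasurable
      (f := f i) (hf i).aestronglyMeasurable, h1, integral_smul_measure, hf0, smul_zero]
  · rw [Function.onFun, Set.disjoint_left]
    rintro ω ⟨-, h1⟩ ⟨-, h2⟩
    exact hij (h1.symm.trans h2)

/-- The variance of a sum of bounded martingale differences grows at most linearly. -/
theorem integral_sq_sum_le_of_condExp_eq_zero [IsProbabilityMeasure μ]
    {F : ℕ → MeasurableSpace Ω} (hF : ∀ n, F n ≤ ‹MeasurableSpace Ω›) {D : ℕ → Ω → ℝ}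
    (hD : ∀ j n, j < n → Measurable[F n] (D j)) {C : ℝ} (hC : ∀ n ω, |D n ω| ≤ C)
    (h0 : ∀ n, μ[D n | F n] =ᵐ[μ] 0) (n : ℕ) :
    ∫ ω, (∑ j ∈ Finset.range n, D j ω) ^ 2 ∂μ ≤ n * C ^ 2 := by
  have hDm : ∀ n, Measurable (D n) := fun n => (hD n (n + 1) n.lt_succ_self).mono (hF _) le_rfl
  have hint : ∀ n, Integrable (D n) μ := fun n =>
    Integrable.of_bound (hDm n).aestronglyMeasurable C (ae_of_all _ (hC n))
  induction n with
  | zero => simp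
  | succ n ih =>
    set S : Ω → ℝ := fun ω => ∑ j ∈ Finset.range n, D j ω with hS
    have hSm : Measurable[F n] S := by
      let := F n
      exact Finset.measurable_sum _ fun j hj => hD j n (Finset.mem_range.1 hj)
    have hSm' : Measurable S := hSm.mono (hF n) le_rfl
    have hSb : ∀ ω, |S ω| ≤ n * C := fun ω => by
      refine (Finset.abs_sum_le_sum_abs _ _).trans ((Finset.sum_le_sum fun j _ => hC j ω).trans ?_)
      simp
    have hSD : ∫ ω, S ω * D n ω ∂μ = 0 := by
      have h1 := condExp_stronglyMeasurable_mul_of_bound (hF n) (μ := μ) hSm.stronglyMeasurable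
        (hint n) (n * C) (ae_of_all _ hSb)
      rw [← integral_condExp (hF n)]
      rw [show (fun ω => S ω * D n ω) = S * D n from rfl, integral_congr_ae h1,
        integral_congr_ae (g := 0) ((h0 n).mono fun ω hω => by simp [hω])]
      simp
    have i1 : Integrable (fun ω => S ω ^ 2) μ :=
      Integrable.of_bound (hSm'.pow_const 2).aestronglyMeasurable ((n * C) ^ 2)
        (ae_of_all _ fun ω => by
          rw [Real.norm_eq_abs, abs_pow]; exact pow_le_pow_left₀ (abs_nonneg _) (hSb ω) 2)
    have i2 : Integrable (fun ω => S ω * D n ω) μ :=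
      (hint n).bdd_mul hSm'.aestronglyMeasurable (ae_of_all _ hSb)
    have hD2 : ∀ ω, D n ω ^ 2 ≤ C ^ 2 := fun ω => by
      rw [← sq_abs]; exact pow_le_pow_left₀ (abs_nonneg _) (hC n ω) 2
    have i3 : Integrable (fun ω => D n ω ^ 2) μ :=
      Integrable.of_bound ((hDm n).pow_const 2).aestronglyMeasurable (C ^ 2)
        (ae_of_all _ fun ω => by rw [Real.norm_eq_abs, abs_of_nonneg (sq_nonneg _)]; exact hD2 ω)
    have e : ∀ ω, (∑ j ∈ Finset.range (n + 1), D j ω) ^ 2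
        = S ω ^ 2 + 2 * (S ω * D n ω) + D n ω ^ 2 := fun ω => by
      rw [Finset.sum_range_succ]; ring
    simp_rw [e]
    have i12 : Integrable (fun ω => S ω ^ 2 + 2 * (S ω * D n ω)) μ := i1.add (i2.const_mul 2)
    rw [integral_add i12 i3, integral_add i1 (i2.const_mul 2),
      integral_const_mul, hSD]
    have : ∫ ω, D n ω ^ 2 ∂μ ≤ C ^ 2 := by
      refine (integral_mono i3 (integrable_const (C ^ 2)) hD2).trans ?_
      simp
    push_cast
    linarith

/-- The time spent in the state `r` during the sojourns number `1, …, n`, each sojourn being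
counted for at most `K` units of time. The sojourn number `0`, which contains the time `0`, is left
out, as its law is not given by the kernel. -/
noncomputable def truncatedOccupation (T : ℕ → Ω → ℝ) (X : ℕ → Ω → Fin M) (K : ℝ) (r : Fin M)
    (n : ℕ) (ω : Ω) : ℝ :=
  ∑ j ∈ Finset.range n, if X (j + 1) ω = r then max 0 (min (T (j + 2) ω - T (j + 1) ω) K) else 0

theorem integral_comp_fst_eq_mulVec [IsMarkovKernel Q] (h : Fin M → ℝ) (i : Fin M) :
    ∫ y, h y.1 ∂Q i = ((embeddedMatrix Q).mulVec h) i := by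
  rw [← integral_map (φ := Prod.fst) (f := h) measurable_fst.aemeasurable
    (measurable_of_countable h).aestronglyMeasurable,
    integral_fintype (Integrable.of_finite)]
  simp only [Matrix.mulVec, dotProduct, smul_eq_mul, embeddedMatrix]
  refine Finset.sum_congr rfl fun j _ => ?_
  rw [map_measureReal_apply measurable_fst (measurableSet_singleton j)]
  congr 2
  ext y; simp

theorem sum_embeddedMatrix [IsMarkovKernel Q] (i : Fin M) : ∑ j, embeddedMatrix Q i j = 1 := by
  have := integral_comp_fst_eq_mulVec (Q := Q) (fun _ => 1) i
  simp only [Matrix.mulVec, dotProduct, mul_one] at this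
  rw [← this]; simp

/-- The truncated occupation time of a state in the first `n` sojourns grows linearly in mean
square: the Poisson equation of the embedded chain turns it into a martingale. -/
theorem IsStationarySemiMarkov.exists_truncatedOccupation_rate [IsProbabilityMeasure μ]
    [IsMarkovKernel Q] (hJ : IsStationarySemiMarkov Q T X μ) {K : ℝ} (hK : 0 < K) :
    ∃ (c : Fin M → ℝ) (C : ℝ), (∀ r, 0 ≤ c r) ∧ 0 < ∑ r, c r ∧
      ∀ r (n : ℕ), ∫ ω, (truncatedOccupation T X K r n ω - n * c r) ^ 2 ∂μ ≤ C * (n + 1) := by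
  have hne : Nonempty Ω := nonempty_of_isProbabilityMeasure μ
  have hM : Nonempty (Fin M) := hne.map (X 0)
  set φ : ℝ → ℝ := fun s => max 0 (min s K) with hφ
  have hφm : Measurable φ := by fun_prop
  have hφ0 : ∀ s, 0 ≤ φ s := fun s => le_max_left _ _
  have hφK : ∀ s, φ s ≤ K := fun s => max_le hK.le (min_le_right _ _)
  set m : Fin M → ℝ := fun i => ∫ y, φ y.2 ∂Q i with hm
  have hm0 : ∀ i, 0 ≤ m i := fun i => integral_nonneg fun y => hφ0 _
  have hirr := hJ.irreducible
  have hsum := sum_embeddedMatrix (Q := Q)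
  -- `m r` is the mean truncated sojourn time in `r`, the Poisson equation gives the rate `c r`
  choose c h hch using fun r : Fin M =>
    hirr.exists_poissonEquation hsum fun i => if i = r then m r else 0
  have hc0 : ∀ r, 0 ≤ c r := fun r =>
    hirr.poissonEquation_const_nonneg hsum (fun i => by split_ifs <;> simp [hm0]) (hch r)
  obtain ⟨b, hb⟩ : ∃ b : ℝ, ∀ r i, |h r i| ≤ b := by
    refine ⟨∑ r, ∑ i, |h r i|, fun r i => ?_⟩
    exact (Finset.single_le_sum (f := fun i => |h r i|) (fun i _ => abs_nonneg _)
      (Finset.mem_univ i)).trans (Finset.single_le_sum (f := fun r => ∑ i, |h r i|)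
      (fun r _ => Finset.sum_nonneg fun i _ => abs_nonneg _) (Finset.mem_univ r))
  have hφint : ∀ i, Integrable (fun y : Fin M × ℝ => φ y.2) (Q i) := fun i =>
    Integrable.of_bound (hφm.comp measurable_snd).aestronglyMeasurable K
      (ae_of_all _ fun y => by rw [Real.norm_eq_abs, abs_of_nonneg (hφ0 _)]; exact hφK _)
  -- if all rates vanished, then so would the mean truncated sojourn times, but jumps are distinct
  have hpos : 0 < ∑ r, c r := by
    by_contra hcon
    have hcz : ∀ r, c r = 0 := fun r =>
      (Finset.sum_eq_zero_iff_of_nonneg fun r _ => hc0 r).1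
        (le_antisymm (not_lt.1 hcon) (Finset.sum_nonneg fun r _ => hc0 r)) r (Finset.mem_univ r)
    have hmz : ∀ r, m r = 0 := by
      intro r
      by_contra hr
      have := hirr.poissonEquation_const_pos hsum (i₀ := r)
        (fun i => by split_ifs <;> simp [hm0]) (hch r)
        (by simpa using lt_of_le_of_ne (hm0 r) (Ne.symm hr))
      exact this.ne' (hcz r)
    have hz : ∀ᵐ ω ∂μ, φ (T 2 ω - T 1 ω) = 0 := by
      have hi : ∀ i, ∀ᵐ y ∂Q i, φ y.2 = 0 := fun i =>
        (integral_eq_zero_iff_of_nonneg (fun y => hφ0 _) (hφint i)).1 (hmz i)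
      have hX1 : ∀ i, MeasurableSet[jumpHistory T X 1] (X 1 ⁻¹' {i}) := fun i =>
        measurable_fst.comp (measurable_jumpHistory le_rfl) (measurableSet_singleton i)
      have hall : ∀ i, ∀ᵐ ω ∂μ, X 1 ω = i → φ (T 2 ω - T 1 ω) = 0 := by
        intro i
        have h1 := hJ.map_restrict_eq le_rfl (hX1 i) (i := i) fun ω hω => hω
        have hY : Measurable fun ω => (X (1 + 1) ω, T (1 + 1) ω - T 1 ω) :=
          (hJ.measurable_state _).prodMk ((hJ.measurable_time _).sub (hJ.measurable_time _))
        have h2 : ∀ᵐ y ∂(μ.restrict (X 1 ⁻¹' {i})).map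
            (fun ω => (X (1 + 1) ω, T (1 + 1) ω - T 1 ω)), φ y.2 = 0 := by
          rw [h1]; exact Measure.ae_smul_measure (hi i) _
        have h3 := ae_of_ae_map hY.aemeasurable h2
        exact (ae_restrict_iff' (hJ.jumpHistory_le 1 _ (hX1 i))).1 h3
      filter_upwards [ae_all_iff.2 hall] with ω hω using hω _ rfl
    obtain ⟨ω, h1, h2⟩ := (hz.and hJ.strictMono).exists
    have : 0 < φ (T 2 ω - T 1 ω) :=
      lt_max_of_lt_right (lt_min (sub_pos.2 (h2 (by norm_num))) hK)
    exact this.ne' h1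
  set B : ℝ := K + 2 * b + ∑ r, c r with hB
  have hcB : ∀ r, c r ≤ ∑ r, c r := fun r =>
    Finset.single_le_sum (fun r _ => hc0 r) (Finset.mem_univ r)
  refine ⟨c, 2 * B ^ 2 + 2 * (2 * b) ^ 2, hc0, hpos, fun r n => ?_⟩
  -- the martingale increment as a function of the present state and of the next jump
  set f : Fin M → Fin M × ℝ → ℝ := fun i y =>
    (if i = r then φ y.2 else 0) + h r y.1 - c r - h r i with hf
  have hfm : ∀ i, Measurable (f i) := by
    intro i
    have : Measurable (h r) := measurable_of_countable _
    by_cases hir : i = r <;> simp only [hf, hir, if_true, if_false] <;> fun_prop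
  have hfB : ∀ i y, |f i y| ≤ B := by
    intro i y
    have h1 := abs_le.1 (hb r y.1)
    have h2 := abs_le.1 (hb r i)
    have h3 := hφ0 y.2
    have h4 := hφK y.2
    have h5 := hc0 r
    have h6 := hcB r
    rw [abs_le]
    simp only [hf, hB]
    constructor <;> split_ifs <;> linarith
  have hf0 : ∀ i, ∫ y, f i y ∂Q i = 0 := by
    intro i
    have e1 : Integrable (fun y : Fin M × ℝ => h r y.1) (Q i) :=
      Integrable.of_bound ((measurable_of_countable (h r)).comp measurable_fst).aestronglyMeasurable
        b (ae_of_all _ fun y => hb r _)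
    have e2 : Integrable (fun y : Fin M × ℝ => if i = r then φ y.2 else 0) (Q i) := by
      split_ifs
      · exact hφint i
      · exact integrable_zero _ _ _
    have e3 : Integrable (fun y : Fin M × ℝ => (if i = r then φ y.2 else 0) + h r y.1) (Q i) :=
      e2.add e1
    have e4 : Integrable (fun y : Fin M × ℝ => (if i = r then φ y.2 else 0) + h r y.1 - c r)
      (Q i) := e3.sub (integrable_const _)
    simp only [hf]
    rw [integral_sub e4 (integrable_const _), integral_sub e3 (integrable_const _),
      integral_add e2 e1,
      integral_comp_fst_eq_mulVec]
    have h1 := hch r i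
    have h2 : ∫ y : Fin M × ℝ, (if i = r then φ y.2 else 0) ∂Q i = if i = r then m r else 0 := by
      split_ifs with hir
      · rw [hir]
      · simp
    rw [h2, h1]; simp
  set D : ℕ → Ω → ℝ := fun j ω => f (X (j + 1) ω) (X (j + 2) ω, T (j + 2) ω - T (j + 1) ω) with hD
  have hDm : ∀ j k, j < k → Measurable[jumpHistory T X (k + 1)] (D j) := by
    intro j k hjk
    have hf' : Measurable (Function.uncurry f) := measurable_from_prod_countable_right hfm
    have a1 := measurable_jumpHistory (T := T) (X := X) (show j + 1 ≤ k + 1 by omega)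
    have a2 := measurable_jumpHistory (T := T) (X := X) (show j + 2 ≤ k + 1 by omega)
    let := jumpHistory T X (k + 1)
    exact hf'.comp (a1.fst.prodMk (a2.fst.prodMk (a2.snd.sub a1.snd)))
  have key := integral_sq_sum_le_of_condExp_eq_zero (μ := μ) (F := fun k => jumpHistory T X (k + 1))
    (fun k => hJ.jumpHistory_le _) hDm (fun j ω => hfB _ _)
    (fun j => hJ.condExp_eq_zero (n := j + 1) (by omega) hfm hfB hf0) n
  -- the boundary terms `h r (X (n + 1))` and `h r (X 1)` are bounded by `b`
  have tel : ∀ ω, truncatedOccupation T X K r n ω - n * c r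
      = ∑ j ∈ Finset.range n, D j ω - (h r (X (n + 1) ω) - h r (X 1 ω)) := by
    intro ω
    have := Finset.sum_range_sub (fun j => h r (X (j + 1) ω)) n
    simp only [zero_add] at this
    rw [← this, truncatedOccupation, ← Finset.sum_sub_distrib]
    have hnc : (n : ℝ) * c r = ∑ j ∈ Finset.range n, c r := by simp
    rw [hnc, ← Finset.sum_sub_distrib]
    refine Finset.sum_congr rfl fun j _ => ?_
    simp only [hD, hf, hφ]
    ring
  have hDm' : ∀ j, Measurable (D j) := fun j =>
    (hDm j (j + 1) j.lt_succ_self).mono (hJ.jumpHistory_le _) le_rfl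
  have hSm : Measurable fun ω => ∑ j ∈ Finset.range n, D j ω :=
    Finset.measurable_sum _ fun j _ => hDm' j
  have hSi : Integrable (fun ω => (∑ j ∈ Finset.range n, D j ω) ^ 2) μ := by
    refine Integrable.of_bound (hSm.pow_const 2).aestronglyMeasurable ((n * B) ^ 2)
      (ae_of_all _ fun ω => ?_)
    rw [Real.norm_eq_abs, abs_pow]
    refine pow_le_pow_left₀ (abs_nonneg _) ((Finset.abs_sum_le_sum_abs _ _).trans
      ((Finset.sum_le_sum fun j _ => hfB _ _).trans ?_)) 2
    simp
  calc ∫ ω, (truncatedOccupation T X K r n ω - n * c r) ^ 2 ∂μ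
      ≤ ∫ ω, (2 * (∑ j ∈ Finset.range n, D j ω) ^ 2 + 2 * (2 * b) ^ 2) ∂μ := by
        refine integral_mono_of_nonneg (ae_of_all _ fun ω => sq_nonneg _)
          ((hSi.const_mul 2).add (integrable_const _)) (ae_of_all _ fun ω => ?_)
        simp only
        rw [tel ω]
        have h1 := abs_le.1 (hb r (X (n + 1) ω))
        have h2 := abs_le.1 (hb r (X 1 ω))
        have h3 : (h r (X (n + 1) ω) - h r (X 1 ω)) ^ 2 ≤ (2 * b) ^ 2 :=
          sq_le_sq' (by linarith) (by linarith)
        nlinarith [sq_nonneg (∑ j ∈ Finset.range n, D j ω + (h r (X (n + 1) ω) - h r (X 1 ω)))]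
    _ = 2 * ∫ ω, (∑ j ∈ Finset.range n, D j ω) ^ 2 ∂μ + 2 * (2 * b) ^ 2 := by
        rw [integral_add (hSi.const_mul 2) (integrable_const _), integral_const_mul]; simp
    _ ≤ (2 * B ^ 2 + 2 * (2 * b) ^ 2) * (n + 1) := by
        nlinarith [sq_nonneg B, sq_nonneg (2 * b), (Nat.cast_nonneg n : (0 : ℝ) ≤ n),
          mul_nonneg (Nat.cast_nonneg n : (0 : ℝ) ≤ n) (sq_nonneg (2 * b))]

end Sojourns


/-! ### The environment in continuous time -/

section Environment

theorem lastJump_eq_of_mem {Ω : Type*} {T : ℕ → Ω → ℝ} {ω : Ω} (hT : StrictMono fun n => T n ω)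
    {n : ℕ} {t : ℝ} (ht : t ∈ Set.Ico (T n ω) (T (n + 1) ω)) : lastJump T t ω = n := by
  have h : IsGreatest {k : ℕ | T k ω ≤ t} n := by
    refine ⟨ht.1, fun k hk => ?_⟩
    by_contra! hnk
    exact absurd (hT.monotone (Nat.succ_le_of_lt hnk)) (not_le.2 (lt_of_le_of_lt hk ht.2))
  exact h.csSup_eq

theorem exists_mem_Ico_jumps {Ω : Type*} {T : ℕ → Ω → ℝ} {ω : Ω} (h0 : T 0 ω ≤ 0)
    (hT : Tendsto (fun n => T n ω) atTop atTop) {t : ℝ} (ht : 0 ≤ t) :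
    ∃ n, t ∈ Set.Ico (T n ω) (T (n + 1) ω) := by
  classical
  have hex : ∃ n, t < T n ω := (hT.eventually_gt_atTop t).exists
  have hpos : Nat.find hex ≠ 0 := fun h => by
    have := Nat.find_spec hex
    rw [h] at this
    linarith
  obtain ⟨m, hm⟩ := Nat.exists_eq_succ_of_ne_zero hpos
  refine ⟨m, not_lt.1 (Nat.find_min hex (by omega)), ?_⟩
  have := Nat.find_spec hex
  rwa [hm] at this

theorem measurable_lastJump {Ω : Type*} [MeasurableSpace Ω] {T : ℕ → Ω → ℝ}
    (hT : ∀ n, Measurable (T n)) : Measurable fun p : ℝ × Ω => lastJump T p.1 p.2 := by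
  have hpos : ∀ n, n ≠ 0 → MeasurableSet ((fun p : ℝ × Ω => lastJump T p.1 p.2) ⁻¹' {n}) := by
    intro n hn
    have : (fun p : ℝ × Ω => lastJump T p.1 p.2) ⁻¹' {n} =
        {p | T n p.2 ≤ p.1} ∩ ⋂ k, ⋂ (_ : n < k), {p | p.1 < T k p.2} := by
      ext p
      simp only [Set.mem_preimage, Set.mem_singleton_iff, Set.mem_inter_iff, Set.mem_ofPred_eq,
        Set.mem_iInter]
      constructor
      · intro h
        -- the supremum is zero by convention for an empty or an unbounded set
        rw [lastJump] at h
        have hne : {k : ℕ | T k p.2 ≤ p.1}.Nonempty := by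
          by_contra hcon
          rw [Set.not_nonempty_iff_eq_empty.1 hcon, csSup_empty] at h
          exact hn h.symm
        have hb : BddAbove {k : ℕ | T k p.2 ≤ p.1} := by
          by_contra hcon
          rw [Nat.sSup_of_not_bddAbove hcon] at h
          exact hn h.symm
        refine ⟨h ▸ Nat.sSup_mem hne hb, fun k hk => ?_⟩
        by_contra! hcon
        have := le_csSup hb (show k ∈ {k : ℕ | T k p.2 ≤ p.1} from hcon)
        omega
      · rintro ⟨h1, h2⟩
        have : IsGreatest {k : ℕ | T k p.2 ≤ p.1} n := ⟨h1, fun k hk => by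
          by_contra! hcon
          exact absurd (h2 k hcon) (not_lt.2 hk)⟩
        exact this.csSup_eq
    rw [this]
    refine (measurableSet_le ((hT n).comp measurable_snd) measurable_fst).inter
      (MeasurableSet.iInter fun k => MeasurableSet.iInter fun _ =>
        measurableSet_lt measurable_fst ((hT k).comp measurable_snd))
  refine measurable_to_countable' fun n => ?_
  rcases eq_or_ne n 0 with rfl | hn
  · have : (fun p : ℝ × Ω => lastJump T p.1 p.2) ⁻¹' {0} =
        (⋃ n, ⋃ (_ : n ≠ 0), (fun p : ℝ × Ω => lastJump T p.1 p.2) ⁻¹' {n})ᶜ := by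
      ext p
      simp only [Set.mem_preimage, Set.mem_singleton_iff, Set.mem_compl_iff, Set.mem_iUnion]
      grind
    rw [this]
    exact (MeasurableSet.iUnion fun n => MeasurableSet.iUnion fun h => hpos n h).compl
  · exact hpos n hn

theorem measurable_modulatingState {Ω : Type*} [MeasurableSpace Ω] {M : ℕ} {T : ℕ → Ω → ℝ}
    {X : ℕ → Ω → Fin M} (hT : ∀ n, Measurable (T n)) (hX : ∀ n, Measurable (X n)) :
    Measurable fun p : ℝ × Ω => modulatingState T X p.1 p.2 := by
  have : Measurable (Function.uncurry X) := measurable_from_prod_countable_right hX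
  exact this.comp ((measurable_lastJump hT).prodMk measurable_snd)

theorem measurable_jumpAge {Ω : Type*} [MeasurableSpace Ω] {T : ℕ → Ω → ℝ}
    (hT : ∀ n, Measurable (T n)) : Measurable fun p : ℝ × Ω => jumpAge T p.1 p.2 := by
  have : Measurable (Function.uncurry T) := measurable_from_prod_countable_right hT
  exact measurable_fst.sub (this.comp ((measurable_lastJump hT).prodMk measurable_snd))

/-- The time spent in the state `r` up to the time `t`. -/
noncomputable def occupationTime {Ω : Type*} {M : ℕ} (T : ℕ → Ω → ℝ) (X : ℕ → Ω → Fin M)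
    (r : Fin M) (t : ℝ) (ω : Ω) : ℝ≥0∞ :=
  volume (Set.Ioc 0 t ∩ {u | modulatingState T X u ω = r})

/-- The time up to `t` during which the age is at least `K`. -/
noncomputable def overageTime {Ω : Type*} (T : ℕ → Ω → ℝ) (K t : ℝ) (ω : Ω) : ℝ≥0∞ :=
  volume (Set.Ioc 0 t ∩ {u | K ≤ jumpAge T u ω})

variable {Ω : Type*} {M : ℕ} {T : ℕ → Ω → ℝ} {X : ℕ → Ω → Fin M}

theorem ofReal_truncatedOccupation_le {ω : Ω} (hT : StrictMono fun n => T n ω) (h1 : 0 < T 1 ω)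
    {n : ℕ} {t : ℝ} (ht : T (n + 1) ω ≤ t) (K : ℝ) (r : Fin M) :
    ENNReal.ofReal (truncatedOccupation T X K r n ω) ≤ occupationTime T X r t ω := by
  classical
  set I : ℕ → Set ℝ := fun j => Set.Ico (T (j + 1) ω) (T (j + 2) ω) with hI
  set F := (Finset.range n).filter fun j => X (j + 1) ω = r with hF
  have hdisj : (F : Set ℕ).PairwiseDisjoint I := by
    intro j _ k _ hjk
    rw [Function.onFun, Set.disjoint_left]
    intro u hu hu'
    have := lastJump_eq_of_mem hT hu
    have := lastJump_eq_of_mem hT hu'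
    omega
  have hsub : (⋃ j ∈ F, I j) ⊆ Set.Icc 0 t ∩ {u | modulatingState T X u ω = r} := by
    intro u hu
    simp only [Set.mem_iUnion, hF, Finset.mem_filter, Finset.mem_range] at hu
    obtain ⟨j, ⟨hj, hjr⟩, hu⟩ := hu
    refine ⟨⟨h1.le.trans ((hT.monotone (show 1 ≤ j + 1 by omega)).trans hu.1),
      hu.2.le.trans ((hT.monotone (show j + 2 ≤ n + 1 by omega)).trans ht)⟩, ?_⟩
    simp only [Set.mem_ofPred_eq, modulatingState, lastJump_eq_of_mem hT hu, hjr]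
  have hae : volume (Set.Icc 0 t ∩ {u | modulatingState T X u ω = r})
      = occupationTime T X r t ω :=
    measure_congr (Ioc_ae_eq_Icc.symm.inter (ae_eq_refl _))
  rw [← hae]
  refine le_trans ?_ (measure_mono hsub)
  rw [measure_biUnion_finset hdisj fun j _ => measurableSet_Ico, truncatedOccupation,
    ← Finset.sum_filter, ENNReal.ofReal_sum_of_nonneg fun j _ => le_max_left _ _]
  refine Finset.sum_le_sum fun j _ => ?_
  rw [hI, Real.volume_Ico]
  refine ENNReal.ofReal_le_ofReal (max_le (sub_nonneg.2 (hT.monotone (by omega))) (min_le_left _ _))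

/-- Each time up to `t` either belongs to the initial sojourn, or is counted in a truncated sojourn,
or has an age of at least `K`. -/
theorem ofReal_le_add_overageTime {ω : Ω} (hT : StrictMono fun n => T n ω) (h0 : T 0 ω ≤ 0)
    (hlim : Tendsto (fun n => T n ω) atTop atTop)
    {n : ℕ} {t : ℝ} (ht : t < T (n + 1) ω) (K : ℝ) :
    ENNReal.ofReal t ≤ ENNReal.ofReal (T 1 ω) +
      ENNReal.ofReal (∑ r, truncatedOccupation T X K r n ω) + overageTime T K t ω := by
  classical
  set I : ℕ → Set ℝ := fun j =>
    Set.Ico (T (j + 1) ω) (T (j + 1) ω + max 0 (min (T (j + 2) ω - T (j + 1) ω) K)) with hI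
  have hsub : Set.Ioc 0 t ⊆ Set.Ico 0 (T 1 ω) ∪ (⋃ j ∈ Finset.range n, I j) ∪
      (Set.Ioc 0 t ∩ {u | K ≤ jumpAge T u ω}) := by
    intro u hu
    by_cases hK : K ≤ jumpAge T u ω
    · exact Or.inr ⟨hu, hK⟩
    left
    obtain ⟨m, hm⟩ := exists_mem_Ico_jumps h0 hlim hu.1.le
    rw [jumpAge, lastJump_eq_of_mem hT hm, not_le] at hK
    rcases Nat.eq_zero_or_pos m with rfl | hpos
    · exact Or.inl ⟨hu.1.le, hm.2⟩
    · obtain ⟨j, rfl⟩ := Nat.exists_eq_succ_of_ne_zero hpos.ne'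
      right
      have hjn : j < n := by
        by_contra! hcon
        have := hT.monotone (show n + 1 ≤ j + 1 by omega)
        exact absurd (hm.1.trans hu.2) (not_le.2 (ht.trans_le this))
      simp only [Set.mem_iUnion, Finset.mem_range]
      refine ⟨j, hjn, hm.1, ?_⟩
      have h1 : u - T (j + 1) ω < min (T (j + 2) ω - T (j + 1) ω) K :=
        lt_min (sub_lt_sub_right hm.2 _) hK
      have := lt_max_of_lt_right (b := (0 : ℝ)) h1
      linarith
  have hsum : ∑ r, truncatedOccupation T X K r n ω =
      ∑ j ∈ Finset.range n, max 0 (min (T (j + 2) ω - T (j + 1) ω) K) := by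
    simp only [truncatedOccupation]
    rw [Finset.sum_comm]
    simp
  calc ENNReal.ofReal t = volume (Set.Ioc 0 t) := by rw [Real.volume_Ioc, sub_zero]
    _ ≤ volume (Set.Ico 0 (T 1 ω)) + volume (⋃ j ∈ Finset.range n, I j) + overageTime T K t ω :=
        (measure_mono hsub).trans ((measure_union_le _ _).trans
          (add_le_add (measure_union_le _ _) le_rfl))
    _ ≤ _ := by
        refine add_le_add (add_le_add ?_ ?_) le_rfl
        · rw [Real.volume_Ico, sub_zero]
        · refine (measure_biUnion_finset_le _ _).trans ?_
          rw [hsum, ENNReal.ofReal_sum_of_nonneg fun j _ => le_max_left _ _]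
          exact Finset.sum_le_sum fun j _ => by rw [hI, Real.volume_Ico, add_sub_cancel_left]

variable [MeasurableSpace Ω] {μ : Measure Ω} {Q : Kernel (Fin M) (Fin M × ℝ)}

theorem IsStationarySemiMarkov.measurable_modulatingState_fst
    (hJ : IsStationarySemiMarkov Q T X μ) :
    Measurable fun p : ℝ × Ω => modulatingState T X p.1 p.2 :=
  measurable_modulatingState hJ.measurable_time hJ.measurable_state

/-- The law of the state at a pair of times is invariant under shifts. -/
theorem IsStationarySemiMarkov.measure_pair (hJ : IsStationarySemiMarkov Q T X μ) (r : Fin M)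
    {s u v : ℝ} (hs : 0 ≤ s) (hu : 0 ≤ u) (hv : 0 ≤ v) :
    μ {ω | modulatingState T X (u + s) ω = r ∧ modulatingState T X (v + s) ω = r} =
      μ {ω | modulatingState T X u ω = r ∧ modulatingState T X v ω = r} := by
  lift s to ℝ≥0 using hs
  lift u to ℝ≥0 using hu
  lift v to ℝ≥0 using hv
  have h := (hJ.stationary s).measure_mem_eq (s := {f | (f u).1 = r ∧ (f v).1 = r})
    (((measurable_pi_apply u).fst (measurableSet_singleton r)).inter
      ((measurable_pi_apply v).fst (measurableSet_singleton r)))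
  exact h

theorem IsStationarySemiMarkov.measure_state (hJ : IsStationarySemiMarkov Q T X μ) (r : Fin M)
    {u : ℝ} (hu : 0 ≤ u) :
    μ {ω | modulatingState T X u ω = r} = stationaryProb T X μ r := by
  have := hJ.measure_pair r hu le_rfl le_rfl
  simpa [stationaryProb] using this

theorem IsStationarySemiMarkov.measure_age (hJ : IsStationarySemiMarkov Q T X μ) (K : ℝ)
    {u : ℝ} (hu : 0 ≤ u) :
    μ {ω | K ≤ jumpAge T u ω} = μ {ω | K ≤ jumpAge T 0 ω} := by
  lift u to ℝ≥0 using hu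
  have h := (hJ.stationary u).measure_mem_eq (s := {f | K ≤ (f 0).2})
    ((measurable_pi_apply (0 : ℝ≥0)).snd measurableSet_Ici)
  simpa using h

/-- The mean time up to `t` that a time-dependent event of constant probability takes place. -/
theorem lintegral_volume_Ioc_inter [SFinite μ] {S : ℝ → Set Ω}
    (hS : MeasurableSet {p : Ω × ℝ | p.1 ∈ S p.2}) {c : ℝ≥0∞} (hc : ∀ u, 0 ≤ u → μ (S u) = c)
    (t : ℝ) :
    ∫⁻ ω, volume (Set.Ioc 0 t ∩ {u | ω ∈ S u}) ∂μ = ENNReal.ofReal t * c := by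
  have hS' : MeasurableSet {p : Ω × ℝ | p.2 ∈ Set.Ioc 0 t ∧ p.1 ∈ S p.2} :=
    (measurable_snd measurableSet_Ioc).inter hS
  have h1 := Measure.prod_apply (μ := μ) (ν := volume) hS'
  have h2 := Measure.prod_apply_symm (μ := μ) (ν := volume) hS'
  refine h1.symm.trans (h2.trans ?_)
  have : ∀ u : ℝ, μ ((fun ω => (ω, u)) ⁻¹' {p : Ω × ℝ | p.2 ∈ Set.Ioc 0 t ∧ p.1 ∈ S p.2})
      = (Set.Ioc 0 t).indicator (fun _ => c) u := by
    intro u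
    by_cases hu : u ∈ Set.Ioc 0 t
    · rw [Set.indicator_of_mem hu, ← hc u hu.1.le]
      congr 1
      ext ω
      exact and_iff_right hu
    · rw [Set.indicator_of_notMem hu]
      convert measure_empty (μ := μ)
      ext ω
      exact iff_of_false (fun h => hu h.1) (Set.notMem_empty _)
  simp_rw [this]
  rw [lintegral_indicator measurableSet_Ioc, setLIntegral_const, Real.volume_Ioc, sub_zero,
    mul_comm]

theorem measurable_volume_Ioc_inter {S : ℝ → Set Ω}
    (hS : MeasurableSet {p : Ω × ℝ | p.1 ∈ S p.2}) (t : ℝ) :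
    Measurable fun ω => volume (Set.Ioc 0 t ∩ {u | ω ∈ S u}) := by
  have hS' : MeasurableSet {p : Ω × ℝ | p.2 ∈ Set.Ioc 0 t ∧ p.1 ∈ S p.2} :=
    (measurable_snd measurableSet_Ioc).inter hS
  exact measurable_measure_prodMk_left hS'

theorem IsStationarySemiMarkov.measurableSet_state (hJ : IsStationarySemiMarkov Q T X μ)
    (r : Fin M) :
    MeasurableSet {p : Ω × ℝ | p.1 ∈ {ω | modulatingState T X p.2 ω = r}} :=
  (hJ.measurable_modulatingState_fst.comp measurable_swap) (measurableSet_singleton r)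

theorem IsStationarySemiMarkov.measurableSet_age (hJ : IsStationarySemiMarkov Q T X μ) (K : ℝ) :
    MeasurableSet {p : Ω × ℝ | p.1 ∈ {ω | K ≤ jumpAge T p.2 ω}} :=
  ((measurable_jumpAge hJ.measurable_time).comp measurable_swap) measurableSet_Ici

theorem IsStationarySemiMarkov.measurable_occupationTime (hJ : IsStationarySemiMarkov Q T X μ)
    (r : Fin M) (t : ℝ) : Measurable (occupationTime T X r t) :=
  measurable_volume_Ioc_inter (hJ.measurableSet_state r) t

theorem IsStationarySemiMarkov.measurable_overageTime (hJ : IsStationarySemiMarkov Q T X μ)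
    (K t : ℝ) : Measurable (overageTime T K t) :=
  measurable_volume_Ioc_inter (hJ.measurableSet_age K) t

theorem IsStationarySemiMarkov.lintegral_overageTime [SFinite μ]
    (hJ : IsStationarySemiMarkov Q T X μ) (K t : ℝ) :
    ∫⁻ ω, overageTime T K t ω ∂μ = ENNReal.ofReal t * μ {ω | K ≤ jumpAge T 0 ω} :=
  lintegral_volume_Ioc_inter (hJ.measurableSet_age K) (fun _ hu => hJ.measure_age K hu) t

theorem IsStationarySemiMarkov.lintegral_occupationTime [SFinite μ]
    (hJ : IsStationarySemiMarkov Q T X μ) (r : Fin M) (t : ℝ) :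
    ∫⁻ ω, occupationTime T X r t ω ∂μ = ENNReal.ofReal t * stationaryProb T X μ r :=
  lintegral_volume_Ioc_inter (hJ.measurableSet_state r) (fun _ hu => hJ.measure_state r hu) t

end Environment


/-! ### Ergodicity of the environment -/

section Ergodicity

variable {Ω : Type*} {M : ℕ} {T : ℕ → Ω → ℝ} {X : ℕ → Ω → Fin M}

theorem occupationTime_le (r : Fin M) (t : ℝ) (ω : Ω) :
    occupationTime T X r t ω ≤ ENNReal.ofReal t := by
  refine (measure_mono Set.inter_subset_left).trans ?_
  rw [Real.volume_Ioc, sub_zero]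

theorem truncatedOccupation_nonneg (K : ℝ) (r : Fin M) (n : ℕ) (ω : Ω) :
    0 ≤ truncatedOccupation T X K r n ω :=
  Finset.sum_nonneg fun j _ => by split_ifs <;> simp

theorem truncatedOccupation_le {K : ℝ} (hK : 0 ≤ K) (r : Fin M) (n : ℕ) (ω : Ω) :
    truncatedOccupation T X K r n ω ≤ n * K := by
  refine (Finset.sum_le_sum (g := fun _ => K) fun j _ => ?_).trans (by simp)
  split_ifs
  · exact max_le hK (min_le_right _ _)
  · exact hK

variable [MeasurableSpace Ω] {μ : Measure Ω} {Q : Kernel (Fin M) (Fin M × ℝ)}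

theorem tendsto_measure_le_atTop [IsFiniteMeasure μ] {f : Ω → ℝ} (hf : Measurable f) :
    Tendsto (fun K : ℝ => μ.real {ω | K ≤ f ω}) atTop (𝓝 0) := by
  have h := tendsto_measure_iInter_atTop (μ := μ) (s := fun K : ℝ => {ω | K ≤ f ω})
    (fun K => (measurableSet_le measurable_const hf).nullMeasurableSet)
    (fun K L hKL ω (hω : L ≤ f ω) => hKL.trans hω) ⟨0, measure_ne_top _ _⟩
  have h0 : (⋂ K : ℝ, {ω | K ≤ f ω}) = ∅ := by
    ext ω
    simp only [Set.mem_iInter, Set.mem_ofPred_eq, Set.mem_empty_iff_false, iff_false, not_forall,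
      not_le]
    exact exists_gt (f ω)
  rw [h0, measure_empty] at h
  exact (ENNReal.tendsto_toReal ENNReal.zero_ne_top).comp h

theorem measureReal_sq_le [IsProbabilityMeasure μ] {f : Ω → ℝ}
    (hf : Integrable (fun ω => f ω ^ 2) μ) {a b : ℝ} (ha : 0 < a) (hb : ∫ ω, f ω ^ 2 ∂μ ≤ b) :
    μ.real {ω | a ≤ |f ω|} ≤ b / a ^ 2 := by
  have h := mul_meas_ge_le_integral_of_nonneg (ae_of_all μ fun ω => sq_nonneg (f ω)) hf (a ^ 2)
  rw [le_div_iff₀ (by positivity), mul_comm]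
  refine le_trans ?_ (h.trans hb)
  refine mul_le_mul_of_nonneg_left (measureReal_mono fun ω (hω : a ≤ |f ω|) => ?_) (by positivity)
  change a ^ 2 ≤ f ω ^ 2
  rw [← sq_abs (f ω)]
  exact pow_le_pow_left₀ ha.le hω 2

theorem measurable_truncatedOccupation (hJ : IsStationarySemiMarkov Q T X μ) (K : ℝ) (r : Fin M)
    (n : ℕ) : Measurable (truncatedOccupation T X K r n) := by
  refine Finset.measurable_sum _ fun j _ => Measurable.ite
    (hJ.measurable_state _ (measurableSet_singleton r)) ?_ measurable_const
  have := hJ.measurable_time (j + 2)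
  have := hJ.measurable_time (j + 1)
  fun_prop

/-- Up to an error `δ`, the fractions of time spent in the various states are at least those in
the embedded chain with sojourns truncated at a level that the age rarely exceeds. -/
theorem IsStationarySemiMarkov.exists_occupationTime_lower [IsProbabilityMeasure μ]
    [IsMarkovKernel Q] (hJ : IsStationarySemiMarkov Q T X μ) {δ : ℝ} (hδ : 0 < δ)
    (hδ' : δ < 1 / 2) :
    ∃ ρ : Fin M → ℝ, (∀ r, 0 ≤ ρ r) ∧ ∑ r, ρ r = 1 ∧ ∀ᶠ t : ℝ in atTop, ∀ r,
      μ.real {ω | (occupationTime T X r t ω).toReal < (ρ r - 4 * δ) * t} ≤ 2 * δ := by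
  have hA0 : Measurable (jumpAge T 0) :=
    (measurable_jumpAge hJ.measurable_time).comp measurable_prodMk_left
  -- by Markov's inequality, an age above `K` with probability `δ ^ 2` occupies a fraction of time
  -- above `δ` with probability at most `δ`
  obtain ⟨K, hKA, hK⟩ := (((tendsto_measure_le_atTop (μ := μ) hA0).eventually
    (ge_mem_nhds (show 0 < δ ^ 2 by positivity))).and (eventually_gt_atTop 0)).exists
  obtain ⟨c, C, hc0, hc, hcC⟩ := hJ.exists_truncatedOccupation_rate hK
  have hM : (0 : ℝ) < M := by
    have hne : Nonempty Ω := nonempty_of_isProbabilityMeasure μ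
    exact_mod_cast Fin.pos (X 0 hne.some)
  set s := ∑ r, c r with hs
  have hC0 : 0 ≤ C := by
    have := hcC ⟨0, by exact_mod_cast hM⟩ 0
    have h2 : 0 ≤ ∫ ω, (truncatedOccupation T X K ⟨0, by exact_mod_cast hM⟩ 0 ω -
      (0 : ℕ) * c ⟨0, by exact_mod_cast hM⟩) ^ 2 ∂μ := integral_nonneg fun ω => sq_nonneg _
    simpa using h2.trans this
  have hcs : ∀ r, c r ≤ s := fun r =>
    Finset.single_le_sum (fun r _ => hc0 r) (Finset.mem_univ r)
  refine ⟨fun r => c r / s, fun r => div_nonneg (hc0 r) hc.le, by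
    rw [← Finset.sum_div]; exact div_self hc.ne', ?_⟩
  set a : ℝ := δ / (2 * M) with ha
  have ha0 : 0 < a := by positivity
  -- `N t` sojourns, truncated at `K`, take about `(1 - 2 * δ) * t` units of time, which leaves room
  -- for the fluctuations, the first jump time and the overage
  set N : ℝ → ℕ := fun t => ⌊(1 - 2 * δ) * t / s⌋₊ with hN
  -- the fluctuations of the truncated occupation times and the first jump time are negligible
  have lim1 : Tendsto (fun t : ℝ => μ.real {ω | δ / 2 * t ≤ T 1 ω}) atTop (𝓝 0) :=
    (tendsto_measure_le_atTop (hJ.measurable_time 1)).comp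
      (tendsto_id.const_mul_atTop (by positivity))
  have lim2 : Tendsto (fun t : ℝ => M * (C / a ^ 2 * (1 / s * t⁻¹ + t⁻¹ ^ 2))) atTop (𝓝 0) := by
    have h := tendsto_inv_atTop_zero (𝕜 := ℝ)
    have := (((h.const_mul (1 / s)).add (h.pow 2)).const_mul (C / a ^ 2)).const_mul (M : ℝ)
    simpa using this
  have ev := (lim1.add lim2).eventually (ge_mem_nhds (show (0 : ℝ) + 0 < δ by simpa using hδ))
  filter_upwards [ev, eventually_gt_atTop 0, eventually_ge_atTop (s / δ)] with t ht ht0 hts r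
  set n := N t with hn
  have hn1 : n * s ≤ (1 - 2 * δ) * t := by
    have := Nat.floor_le (show 0 ≤ (1 - 2 * δ) * t / s from
      div_nonneg (mul_nonneg (by linarith) ht0.le) hc.le)
    rwa [le_div_iff₀ hc] at this
  have hn2 : (1 - 2 * δ) * t / s < n + 1 := Nat.lt_floor_add_one _
  set D : Fin M → Set Ω := fun r =>
    {ω | a * t ≤ |truncatedOccupation T X K r n ω - n * c r|} with hD
  have hDr : ∀ r, μ.real (D r) ≤ C / a ^ 2 * (1 / s * t⁻¹ + t⁻¹ ^ 2) := by
    intro r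
    have hint : Integrable (fun ω => (truncatedOccupation T X K r n ω - n * c r) ^ 2) μ := by
      refine Integrable.of_bound (((measurable_truncatedOccupation hJ K r n).sub
        measurable_const).pow_const 2).aestronglyMeasurable ((n * K + n * c r) ^ 2)
        (ae_of_all _ fun ω => ?_)
      rw [Real.norm_eq_abs, abs_of_nonneg (sq_nonneg _)]
      have h1 := truncatedOccupation_nonneg (T := T) (X := X) K r n ω
      have h2 := truncatedOccupation_le (T := T) (X := X) hK.le r n ω
      have h3 := mul_nonneg (Nat.cast_nonneg n : (0 : ℝ) ≤ n) (hc0 r)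
      exact sq_le_sq' (by linarith) (by linarith)
    refine (measureReal_sq_le hint (mul_pos ha0 ht0) (hcC r n)).trans ?_
    have hns : (n : ℝ) ≤ 1 / s * t := by
      rw [div_mul_eq_mul_div, le_div_iff₀ hc]; nlinarith
    calc C * (n + 1) / (a * t) ^ 2 ≤ C * (1 / s * t + 1) / (a * t) ^ 2 := by gcongr
      _ = _ := by field_simp
  have hover : μ.real {ω | ENNReal.ofReal (δ * t) ≤ overageTime T K t ω} ≤ δ := by
    have h1 := mul_meas_ge_le_lintegral (μ := μ) (hJ.measurable_overageTime K t)
      (ENNReal.ofReal (δ * t))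
    rw [hJ.lintegral_overageTime] at h1
    have h2 := ENNReal.toReal_mono (by finiteness) h1
    rw [ENNReal.toReal_mul, ENNReal.toReal_mul, ENNReal.toReal_ofReal (by positivity),
      ENNReal.toReal_ofReal ht0.le] at h2
    change δ * t * μ.real _ ≤ t * μ.real _ at h2
    have h3 : t * μ.real {ω | K ≤ jumpAge T 0 ω} ≤ t * δ ^ 2 := by gcongr
    have h4 : (δ * t) * μ.real {ω | ENNReal.ofReal (δ * t) ≤ overageTime T K t ω} ≤
        (δ * t) * δ := by
      nlinarith
    exact le_of_mul_le_mul_left h4 (by positivity)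
  have hsub : ∀ᵐ ω ∂μ, ω ∈ {ω | (occupationTime T X r t ω).toReal < (c r / s - 4 * δ) * t} →
      ω ∈ ({ω | δ / 2 * t ≤ T 1 ω} ∪ (⋃ r, D r)) ∪
        {ω | ENNReal.ofReal (δ * t) ≤ overageTime T K t ω} := by
    filter_upwards [hJ.origin, hJ.strictMono, hJ.locally_finite] with ω h0 hmono hlim hω
    by_contra hcon'
    simp only [Set.mem_union, Set.mem_iUnion, Set.mem_ofPred_eq, not_or, not_exists, not_le,
      hD] at hcon'
    obtain ⟨⟨b1, b2⟩, b3⟩ := hcon'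
    have hZ : ∑ r, truncatedOccupation T X K r n ω ≤ n * s + δ / 2 * t := by
      have : ∀ r ∈ Finset.univ, truncatedOccupation T X K r n ω ≤ n * c r + a * t := fun r _ => by
        have := (abs_lt.1 (b2 r)).2; linarith
      refine (Finset.sum_le_sum this).trans ?_
      rw [Finset.sum_add_distrib, ← Finset.mul_sum, ← hs]
      simp only [Finset.sum_const, Finset.card_univ, Fintype.card_fin, nsmul_eq_mul, ha]
      apply le_of_eq
      field_simp
    -- the first `n` complete sojourns end before `t`, so the time spent there is counted
    have hTn : T (n + 1) ω ≤ t := by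
      by_contra! htT
      have h1 := ofReal_le_add_overageTime (X := X) hmono h0.1 hlim htT K
      have h2 : ENNReal.ofReal (T 1 ω) + ENNReal.ofReal (∑ r, truncatedOccupation T X K r n ω)
          + overageTime T K t ω < ENNReal.ofReal (δ / 2 * t) + ENNReal.ofReal (n * s + δ / 2 * t)
          + ENNReal.ofReal (δ * t) := by
        refine ENNReal.add_lt_add_of_le_of_lt (by finiteness) ?_ b3
        gcongr
      have hns : 0 ≤ n * s + δ / 2 * t := by positivity
      rw [← ENNReal.ofReal_add (p := δ / 2 * t) (by positivity) hns,
        ← ENNReal.ofReal_add (p := δ / 2 * t + (n * s + δ / 2 * t))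
          (add_nonneg (by positivity) hns) (by positivity)] at h2
      have h3 := (ENNReal.ofReal_lt_ofReal_iff_of_nonneg ht0.le).1 (h1.trans_lt h2)
      linarith
    have hL := ENNReal.toReal_mono ((occupationTime_le r t ω).trans_lt ENNReal.ofReal_lt_top).ne
      (ofReal_truncatedOccupation_le (X := X) hmono h0.2 hTn K r)
    rw [ENNReal.toReal_ofReal (truncatedOccupation_nonneg _ _ _ _)] at hL
    have h4 := (abs_lt.1 (b2 r)).1
    have hω' : (occupationTime T X r t ω).toReal < (c r / s - 4 * δ) * t := hω
    have h5 : (c r / s) * ((1 - 2 * δ) * t) ≤ (n + 1) * c r := by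
      rw [div_lt_iff₀ hc] at hn2
      rw [div_mul_eq_mul_div, div_le_iff₀ hc]
      nlinarith [hc0 r]
    have h6 : c r / s ≤ 1 := (div_le_one hc).2 (hcs r)
    have h7 : s ≤ δ * t := by rwa [div_le_iff₀ hδ, mul_comm] at hts
    have h8 : a ≤ δ / 2 := by
      have : (1 : ℝ) ≤ M := by exact_mod_cast (show 0 < M by exact_mod_cast hM)
      rw [ha, div_le_div_iff₀ (by positivity) (by positivity)]
      nlinarith
    have h9 : c r / s * (δ * t) ≤ 1 * (δ * t) := by gcongr
    have h10 : a * t ≤ δ / 2 * t := by gcongr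
    have h11 := hcs r
    nlinarith [mul_pos hδ ht0]
  have hfin : μ.real {ω | (occupationTime T X r t ω).toReal < (c r / s - 4 * δ) * t} ≤
      μ.real (({ω | δ / 2 * t ≤ T 1 ω} ∪ (⋃ r, D r)) ∪
        {ω | ENNReal.ofReal (δ * t) ≤ overageTime T K t ω}) :=
    ENNReal.toReal_mono (by finiteness) (measure_mono_ae hsub)
  have hUD : μ.real (⋃ r, D r) ≤ M * (C / a ^ 2 * (1 / s * t⁻¹ + t⁻¹ ^ 2)) := by
    refine (measureReal_iUnion_fintype_le D).trans ((Finset.sum_le_sum fun r _ => hDr r).trans ?_)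
    simp
  have u1 := measureReal_union_le (μ := μ) ({ω | δ / 2 * t ≤ T 1 ω} ∪ (⋃ r, D r))
    {ω | ENNReal.ofReal (δ * t) ≤ overageTime T K t ω}
  have u2 := measureReal_union_le (μ := μ) {ω | δ / 2 * t ≤ T 1 ω} (⋃ r, D r)
  linarith

theorem IsStationarySemiMarkov.sum_stationaryProb [IsProbabilityMeasure μ]
    (hJ : IsStationarySemiMarkov Q T X μ) : ∑ r, stationaryProb T X μ r = 1 := by
  have hm : Measurable fun ω => modulatingState T X 0 ω :=
    hJ.measurable_modulatingState_fst.comp measurable_prodMk_left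
  have h := sum_measure_preimage_singleton (μ := μ) (Finset.univ : Finset (Fin M))
    (f := fun ω => modulatingState T X 0 ω) fun r _ => hm (measurableSet_singleton r)
  simp only [Finset.coe_univ, Set.preimage_univ, measure_univ] at h
  exact h

theorem stationaryProb_ne_top [IsFiniteMeasure μ] (r : Fin M) : stationaryProb T X μ r ≠ ∞ :=
  measure_ne_top _ _

theorem IsStationarySemiMarkov.sum_toReal_stationaryProb [IsProbabilityMeasure μ]
    (hJ : IsStationarySemiMarkov Q T X μ) : ∑ r, (stationaryProb T X μ r).toReal = 1 := by
  rw [← ENNReal.toReal_sum fun r _ => stationaryProb_ne_top r, hJ.sum_stationaryProb]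
  simp

/-- Mean ergodic theorem for the environment: the fraction of time spent in a state converges in
mean square to the stationary probability. -/
theorem IsStationarySemiMarkov.integral_sq_occupationTime_le [IsProbabilityMeasure μ]
    [IsMarkovKernel Q] (hJ : IsStationarySemiMarkov Q T X μ) {ε : ℝ} (hε : 0 < ε) :
    ∀ᶠ t : ℝ in atTop, ∀ r, ∫ ω, ((occupationTime T X r t ω).toReal -
      (stationaryProb T X μ r).toReal * t) ^ 2 ∂μ ≤ ε * t ^ 2 := by
  set p : Fin M → ℝ := fun r => (stationaryProb T X μ r).toReal with hp
  have hp0 : ∀ r, 0 ≤ p r := fun r => ENNReal.toReal_nonneg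
  have hp1 : ∀ r, p r ≤ 1 := fun r => by
    rw [← hJ.sum_toReal_stationaryProb]
    exact Finset.single_le_sum (fun r _ => hp0 r) (Finset.mem_univ r)
  set δ : ℝ := min (1 / 4) (ε / (12 * M + 12)) with hδd
  have hδ : 0 < δ := by positivity
  have hδ2 : δ < 1 / 2 := (min_le_left _ _).trans_lt (by norm_num)
  have hδε : (12 * M + 12) * δ ≤ ε := by
    have := min_le_right (1 / 4) (ε / (12 * (M : ℝ) + 12))
    rwa [le_div_iff₀ (by positivity), mul_comm] at this
  obtain ⟨ρ, hρ0, hρ1, hev⟩ := hJ.exists_occupationTime_lower hδ hδ2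
  set L : ℝ → Fin M → Ω → ℝ := fun t r ω => (occupationTime T X r t ω).toReal with hL
  have hL0 : ∀ t r ω, 0 ≤ L t r ω := fun t r ω => ENNReal.toReal_nonneg
  have hLt : ∀ t, 0 ≤ t → ∀ r ω, L t r ω ≤ t := fun t ht r ω =>
    ENNReal.toReal_le_of_le_ofReal ht (occupationTime_le r t ω)
  have hLm : ∀ t r, Measurable (L t r) := fun t r =>
    (hJ.measurable_occupationTime r t).ennreal_toReal
  have hLi : ∀ t, 0 ≤ t → ∀ r, Integrable (L t r) μ := fun t ht r =>
    Integrable.of_bound (hLm t r).aestronglyMeasurable t (ae_of_all _ fun ω => by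
      rw [Real.norm_eq_abs, abs_of_nonneg (hL0 t r ω)]; exact hLt t ht r ω)
  have hEL : ∀ t, 0 ≤ t → ∀ r, ∫ ω, L t r ω ∂μ = p r * t := by
    intro t ht r
    rw [integral_toReal (hJ.measurable_occupationTime r t).aemeasurable
      (ae_of_all _ fun ω => (occupationTime_le r t ω).trans_lt ENNReal.ofReal_lt_top),
      hJ.lintegral_occupationTime, ENNReal.toReal_mul, ENNReal.toReal_ofReal ht, mul_comm]
  have hbad : ∀ t r (x : ℝ), MeasurableSet {ω | L t r ω < x} := fun t r x =>
    measurableSet_lt (hLm t r) measurable_const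
  -- the mean of `L t r` is `p r * t`, so the lower bound `ρ r` is nearly at most `p r`
  have hρp : ∀ r, ρ r - 6 * δ ≤ p r := by
    intro r
    obtain ⟨t, ht, ht0⟩ := (hev.and (eventually_gt_atTop 0)).exists
    have h1 : ∫ _, (ρ r - 4 * δ) * t ∂μ ≤ ∫ ω, (L t r ω +
        {ω | L t r ω < (ρ r - 4 * δ) * t}.indicator (fun _ => t) ω) ∂μ := by
      refine integral_mono (integrable_const _) ((hLi t ht0.le r).add
        ((integrable_const t).indicator (hbad t r _))) fun ω => ?_
      simp only
      by_cases hω : L t r ω < (ρ r - 4 * δ) * t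
      · rw [Set.indicator_of_mem (show ω ∈ {ω | L t r ω < (ρ r - 4 * δ) * t} from hω)]
        have hρr : ρ r ≤ 1 := by
          rw [← hρ1]; exact Finset.single_le_sum (fun r _ => hρ0 r) (Finset.mem_univ r)
        nlinarith [hL0 t r ω]
      · rw [Set.indicator_of_notMem (show ω ∉ {ω | L t r ω < (ρ r - 4 * δ) * t} from hω)]
        linarith
    rw [integral_add (hLi t ht0.le r) ((integrable_const t).indicator (hbad t r _)),
      hEL t ht0.le, integral_indicator (hbad t r _)] at h1
    simp only [integral_const, smul_eq_mul, measureReal_restrict_apply_univ, probReal_univ,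
      one_mul] at h1
    have h2 : μ.real {ω | L t r ω < (ρ r - 4 * δ) * t} * t ≤ 2 * δ * t := by
      gcongr
      exact ht r
    have h3 : (ρ r - 6 * δ) * t ≤ p r * t := by linarith
    exact le_of_mul_le_mul_right h3 ht0
  -- both `ρ` and `p` sum to one, so that the reverse inequality follows
  have hpρ : ∀ r, p r - 6 * M * δ ≤ ρ r := by
    intro r
    have h1 : ∑ x, (p x - ρ x + 6 * δ) = 6 * M * δ := by
      rw [Finset.sum_add_distrib, Finset.sum_sub_distrib, hρ1, hJ.sum_toReal_stationaryProb]
      simp only [Finset.sum_const, Finset.card_univ, Fintype.card_fin, nsmul_eq_mul]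
      ring
    have h2 := Finset.single_le_sum (f := fun x => p x - ρ x + 6 * δ)
      (fun x _ => by linarith [hρp x]) (Finset.mem_univ r)
    rw [h1] at h2
    linarith
  filter_upwards [hev, eventually_gt_atTop 0] with t ht ht0 r
  set S := {ω | L t r ω < (ρ r - 4 * δ) * t} with hS
  -- `x² ≤ t|x|` and `|x| = x + 2x⁻`, where the mean of `x` vanishes
  have hpt : ∀ ω, (L t r ω - p r * t) ^ 2 ≤
      t * (L t r ω - p r * t) + 2 * t * ((6 * M + 4) * δ * t) +
        S.indicator (fun _ => 2 * t * t) ω := by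
    intro ω
    have b1 := hLt t ht0.le r ω
    have b2 := hL0 t r ω
    have b3 : p r * t ≤ t := by nlinarith [hp1 r]
    have b4 : 0 ≤ p r * t := mul_nonneg (hp0 r) ht0.le
    have b5 : 0 ≤ (6 * M + 4) * δ * t := by positivity
    by_cases hω : ω ∈ S
    · rw [Set.indicator_of_mem hω]
      nlinarith
    · rw [Set.indicator_of_notMem hω]
      have h1 : (ρ r - 4 * δ) * t ≤ L t r ω := not_lt.1 hω
      have h2 : (p r - 6 * M * δ) * t ≤ ρ r * t := by gcongr; exact hpρ r
      have h3 : p r * t - (6 * M + 4) * δ * t ≤ L t r ω := by nlinarith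
      by_cases h4 : 0 ≤ L t r ω - p r * t
      · nlinarith
      · nlinarith
  have hi1 : Integrable (fun ω => t * (L t r ω - p r * t)) μ :=
    ((hLi t ht0.le r).sub (integrable_const _)).const_mul t
  have hi2 : Integrable (fun ω => t * (L t r ω - p r * t) + 2 * t * ((6 * M + 4) * δ * t)) μ :=
    hi1.add (integrable_const _)
  have hi3 : Integrable (S.indicator fun _ => 2 * t * t) μ :=
    (integrable_const _).indicator (hbad t r _)
  have hSr : μ.real S ≤ 2 * δ := ht r
  calc ∫ ω, (L t r ω - p r * t) ^ 2 ∂μ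
      ≤ ∫ ω, (t * (L t r ω - p r * t) + 2 * t * ((6 * M + 4) * δ * t) +
        S.indicator (fun _ => 2 * t * t) ω) ∂μ :=
        integral_mono_of_nonneg (ae_of_all _ fun ω => sq_nonneg _) (hi2.add hi3) (ae_of_all _ hpt)
    _ = 2 * t * ((6 * M + 4) * δ * t) + μ.real S * (2 * t * t) := by
        rw [integral_add hi2 hi3, integral_add hi1 (integrable_const _), integral_const_mul,
          integral_sub (hLi t ht0.le r) (integrable_const _), hEL t ht0.le,
          integral_indicator (hbad t r _)]
        simp only [integral_const, smul_eq_mul, measureReal_restrict_apply_univ, probReal_univ]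
        ring
    _ ≤ 2 * t * ((6 * M + 4) * δ * t) + 2 * δ * (2 * t * t) := by gcongr
    _ = ((12 * M + 12) * δ) * t ^ 2 := by ring
    _ ≤ ε * t ^ 2 := by gcongr

end Ergodicity


/-! ### First and second moments of a Poisson process -/

section Poisson

/-- The size-biasing identity of the Poisson law. -/
theorem lintegral_mul_poissonMeasure (r : ℝ≥0) (f : ℕ → ℝ≥0∞) :
    ∫⁻ n, n * f n ∂poissonMeasure r = r * ∫⁻ n, f (n + 1) ∂poissonMeasure r := by
  rw [lintegral_countable', lintegral_countable', tsum_eq_zero_add' ENNReal.summable,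
    ← ENNReal.tsum_mul_left]
  simp only [Nat.cast_zero, zero_mul, zero_add]
  refine tsum_congr fun n => ?_
  have key : ((n + 1 : ℕ) : ℝ≥0∞) * poissonMeasure r {n + 1} = r * poissonMeasure r {n} := by
    rw [poissonMeasure_singleton, poissonMeasure_singleton, ← ENNReal.ofReal_natCast,
      ← ENNReal.ofReal_coe_nnreal, ← ENNReal.ofReal_mul (by positivity),
      ← ENNReal.ofReal_mul (by positivity), Nat.factorial_succ]
    congr 1
    push_cast
    field_simp
    ring
  calc ((n + 1 : ℕ) : ℝ≥0∞) * f (n + 1) * poissonMeasure r {n + 1}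
      = f (n + 1) * (((n + 1 : ℕ) : ℝ≥0∞) * poissonMeasure r {n + 1}) := by ring
    _ = _ := by rw [key]; ring

theorem lintegral_natCast_poissonMeasure (r : ℝ≥0) :
    ∫⁻ n, (n : ℝ≥0∞) ∂poissonMeasure r = r := by
  simpa using lintegral_mul_poissonMeasure r fun _ => 1

theorem lintegral_natCast_sq_poissonMeasure (r : ℝ≥0) :
    ∫⁻ n, (n : ℝ≥0∞) * n ∂poissonMeasure r = r * (r + 1) := by
  rw [lintegral_mul_poissonMeasure r fun n => (n : ℝ≥0∞)]
  simp only [Nat.cast_add, Nat.cast_one]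
  rw [lintegral_add_right _ measurable_const, lintegral_natCast_poissonMeasure]
  simp

variable {Ω : Type*} [MeasurableSpace Ω] {μ : Measure Ω} {τ : ℕ → Ω → ℝ}

theorem IsUnitPoisson.ae_pos (hτ : IsUnitPoisson τ μ) : ∀ᵐ ω ∂μ, ∀ n, 0 < τ n ω := by
  filter_upwards [hτ.first_pos, hτ.strictMono] with ω h0 hm n
  exact h0.trans_le (hm.monotone (Nat.zero_le n))

theorem finite_setOf_le_of_tendsto {u : ℕ → ℝ} (hu : Tendsto u atTop atTop) (t : ℝ) :
    {n | u n ≤ t}.Finite := by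
  obtain ⟨N, hN⟩ := (hu.eventually_gt_atTop t).exists_forall_of_atTop
  refine (Set.finite_Iio N).subset fun n (hn : u n ≤ t) => ?_
  by_contra! hcon
  exact absurd (hN n (not_lt.1 hcon)) (not_lt.2 hn)

theorem IsUnitPoisson.tsum_indicator_Iic (hτ : IsUnitPoisson τ μ) :
    ∀ᵐ ω ∂μ, ∀ t : ℝ≥0, ∑' n, (Set.Iic (t : ℝ)).indicator 1 (τ n ω) =
      (countingProcess τ t ω : ℝ≥0∞) := by
  filter_upwards [hτ.locally_finite] with ω hω t
  have hfin := finite_setOf_le_of_tendsto hω t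
  have h1 : ∀ n, (Set.Iic (t : ℝ)).indicator (1 : ℝ → ℝ≥0∞) (τ n ω) =
      {n | τ n ω ≤ t}.indicator (fun _ => 1) n := fun n => rfl
  simp_rw [h1]
  rw [← tsum_subtype {n | τ n ω ≤ t} (fun _ => (1 : ℝ≥0∞)), ENNReal.tsum_set_one,
    ← hfin.cast_ncard_eq]
  rfl

theorem IsUnitPoisson.countingProcess_zero (hτ : IsUnitPoisson τ μ) :
    ∀ᵐ ω ∂μ, countingProcess τ 0 ω = 0 := by
  filter_upwards [hτ.ae_pos] with ω hω
  have : {n : ℕ | τ n ω ≤ ((0 : ℝ≥0) : ℝ)} = ∅ := by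
    ext n
    simpa using hω n
  rw [countingProcess, this, Set.ncard_empty]

theorem IsUnitPoisson.hasLaw_countingProcess (hτ : IsUnitPoisson τ μ) (t : ℝ≥0) :
    HasLaw (countingProcess τ t) (poissonMeasure t) μ := by
  have h := hτ.increment_law 0 t zero_le
  rw [tsub_zero] at h
  refine h.congr ?_
  filter_upwards [hτ.countingProcess_zero] with ω hω
  simp [hω]

/-- The second moments of the counting process of a unit-rate Poisson process. -/
theorem IsUnitPoisson.lintegral_countingProcess_mul (hτ : IsUnitPoisson τ μ) {s t : ℝ≥0}
    (hst : s ≤ t) :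
    ∫⁻ ω, (countingProcess τ s ω : ℝ≥0∞) * countingProcess τ t ω ∂μ = s * t + s := by
  have hs := hτ.hasLaw_countingProcess s
  have hd := hτ.increment_law s t hst
  have hmono : ∀ᵐ ω ∂μ, countingProcess τ s ω ≤ countingProcess τ t ω := by
    filter_upwards [hτ.locally_finite] with ω hω
    exact Set.ncard_le_ncard (fun n (hn : τ n ω ≤ s) => hn.trans (by exact_mod_cast hst))
      (finite_setOf_le_of_tendsto hω t)
  have hindep : (countingProcess τ s) ⟂ᵢ[μ] (countingProcess τ t - countingProcess τ s) := by
    refine (hτ.indep_increments.indepFun_sub_sub (zero_le : 0 ≤ s) hst).congr ?_ .rfl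
    filter_upwards [hτ.countingProcess_zero] with ω hω
    simp [hω]
  have hcast : Measurable fun n : ℕ => (n : ℝ≥0∞) := measurable_of_countable _
  have e : ∀ᵐ ω ∂μ, (countingProcess τ s ω : ℝ≥0∞) * countingProcess τ t ω =
      (countingProcess τ s ω : ℝ≥0∞) * countingProcess τ s ω +
      (countingProcess τ s ω : ℝ≥0∞) *
        ((countingProcess τ t ω - countingProcess τ s ω : ℕ) : ℝ≥0∞) := by
    filter_upwards [hmono] with ω hω
    rw [← mul_add, ← Nat.cast_add, Nat.add_sub_cancel' hω]
  have hm : AEMeasurable (fun ω => (countingProcess τ s ω : ℝ≥0∞)) μ :=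
    hcast.comp_aemeasurable hs.aemeasurable
  have hm2 : AEMeasurable (fun ω =>
      (countingProcess τ s ω : ℝ≥0∞) * countingProcess τ s ω) μ := hm.mul hm
  rw [lintegral_congr_ae e, lintegral_add_left' hm2,
    lintegral_mul_eq_lintegral_mul_lintegral_of_indepFun'' hm
      (g := fun ω => ((countingProcess τ t ω - countingProcess τ s ω : ℕ) : ℝ≥0∞))
      (hcast.comp_aemeasurable hd.aemeasurable) (hindep.comp hcast hcast),
    hs.lintegral_comp (f := fun n => (n : ℝ≥0∞) * n) (measurable_of_countable _).aemeasurable,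
    hs.lintegral_comp (f := fun n => (n : ℝ≥0∞)) hcast.aemeasurable,
    hd.lintegral_comp (f := fun n => (n : ℝ≥0∞)) hcast.aemeasurable,
    lintegral_natCast_sq_poissonMeasure, lintegral_natCast_poissonMeasure,
    lintegral_natCast_poissonMeasure]
  rw [← ENNReal.coe_one, ← ENNReal.coe_add, ← ENNReal.coe_mul, ← ENNReal.coe_mul, ← ENNReal.coe_mul,
    ← ENNReal.coe_add, ← ENNReal.coe_add, ENNReal.coe_inj]
  rw [← NNReal.coe_inj]
  push_cast [NNReal.coe_sub hst]
  ring

/-- The intensity measure of a unit-rate Poisson process is Lebesgue measure on `(0, ∞)`. -/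
theorem IsUnitPoisson.sum_map (hτ : IsUnitPoisson τ μ) :
    Measure.sum (fun n => μ.map (τ n)) = volume.restrict (Set.Ioi 0) := by
  have key : ∀ t : ℝ, Measure.sum (fun n => μ.map (τ n)) (Set.Iic t) = ENNReal.ofReal t := by
    intro t
    rw [Measure.sum_apply _ measurableSet_Iic]
    have h1 : ∀ n, μ.map (τ n) (Set.Iic t) =
        ∫⁻ ω, (Set.Iic t).indicator 1 (τ n ω) ∂μ := fun n => by
      rw [Measure.map_apply (hτ.measurable n) measurableSet_Iic, ← lintegral_indicator_one
        ((hτ.measurable n) measurableSet_Iic)]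
      rfl
    simp_rw [h1]
    rw [← lintegral_tsum (f := fun n ω => (Set.Iic t).indicator 1 (τ n ω)) fun n =>
      ((measurable_one.indicator measurableSet_Iic).comp (hτ.measurable n)).aemeasurable]
    by_cases ht : 0 ≤ t
    · lift t to ℝ≥0 using ht
      rw [lintegral_congr_ae (hτ.tsum_indicator_Iic.mono fun ω hω => hω t),
        (hτ.hasLaw_countingProcess t).lintegral_comp (f := fun n => (n : ℝ≥0∞))
        (measurable_of_countable _).aemeasurable, lintegral_natCast_poissonMeasure]
      simp
    · rw [lintegral_congr_ae (g := 0), ENNReal.ofReal_of_nonpos (not_le.1 ht).le]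
      · simp
      · filter_upwards [hτ.ae_pos] with ω hω
        simp only [Pi.zero_apply, ENNReal.tsum_eq_zero]
        intro n
        rw [Set.indicator_of_notMem]
        rw [Set.mem_Iic]
        linarith [hω n, not_le.1 ht]
  refine Measure.ext_of_generateFrom_of_iUnion (Set.range Set.Iic) (fun n : ℕ => Set.Iic (n : ℝ))
    (by rw [← borel_eq_generateFrom_Iic]; exact BorelSpace.measurable_eq) isPiSystem_Iic ?_
    (fun n => ⟨n, rfl⟩)
    (fun n => by rw [key]; exact ENNReal.ofReal_ne_top) ?_
  · exact Set.iUnion_eq_univ_iff.2 fun x => exists_nat_ge x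
  · rintro _ ⟨t, rfl⟩
    rw [key, Measure.restrict_apply measurableSet_Iic, Set.inter_comm, Set.Ioi_inter_Iic,
      Real.volume_Ioc, sub_zero]

/-- Campbell's formula. -/
theorem IsUnitPoisson.lintegral_tsum_comp (hτ : IsUnitPoisson τ μ) {f : ℝ → ℝ≥0∞}
    (hf : Measurable f) : ∫⁻ ω, ∑' n, f (τ n ω) ∂μ = ∫⁻ u in Set.Ioi 0, f u := by
  rw [← hτ.sum_map, lintegral_sum_measure, lintegral_tsum (f := fun n ω => f (τ n ω)) fun n =>
    (hf.comp (hτ.measurable n)).aemeasurable]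
  exact tsum_congr fun n => (lintegral_map hf (hτ.measurable n)).symm

/-- The second moment measure of a unit-rate Poisson process. -/
theorem IsUnitPoisson.sum_map_prodMk (hτ : IsUnitPoisson τ μ) :
    Measure.sum (fun n : ℕ × ℕ => μ.map fun ω => (τ n.1 ω, τ n.2 ω)) =
      (volume.restrict (Set.Ioi (0 : ℝ))).prod (volume.restrict (Set.Ioi (0 : ℝ))) +
      (volume.restrict (Set.Ioi (0 : ℝ))).map fun u => (u, u) := by
  have hm : ∀ n : ℕ × ℕ, Measurable fun ω => (τ n.1 ω, τ n.2 ω) := fun n =>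
    (hτ.measurable _).prodMk (hτ.measurable _)
  have hIic : ∀ t : ℝ, volume.restrict (Set.Ioi 0) (Set.Iic t) = ENNReal.ofReal t := fun t => by
    rw [Measure.restrict_apply measurableSet_Iic, Set.inter_comm, Set.Ioi_inter_Iic,
      Real.volume_Ioc, sub_zero]
  have hR : ∀ s t : ℝ, ((volume.restrict (Set.Ioi (0 : ℝ))).prod (volume.restrict (Set.Ioi (0 : ℝ)))
      + (volume.restrict (Set.Ioi (0 : ℝ))).map fun u => (u, u)) (Set.Iic s ×ˢ Set.Iic t)
      = ENNReal.ofReal s * ENNReal.ofReal t + ENNReal.ofReal (min s t) := by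
    intro s t
    rw [Measure.add_apply, Measure.prod_prod, Measure.map_apply (by fun_prop)
      (measurableSet_Iic.prod measurableSet_Iic), hIic, hIic, ← hIic (min s t)]
    congr 2
    ext u
    simp
  have hle : ∀ s t : ℝ≥0, s ≤ t → ∫⁻ ω, (∑' n, (Set.Iic (s : ℝ)).indicator (1 : ℝ → ℝ≥0∞) (τ n ω)) *
      (∑' n, (Set.Iic (t : ℝ)).indicator (1 : ℝ → ℝ≥0∞) (τ n ω)) ∂μ = s * t + s := by
    intro s t hst
    rw [← hτ.lintegral_countingProcess_mul hst]
    exact lintegral_congr_ae (hτ.tsum_indicator_Iic.mono fun ω hω => by simp only [hω])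
  have hneg : ∀ s : ℝ, s < 0 → ∀ᵐ ω ∂μ, ∑' n, (Set.Iic s).indicator (1 : ℝ → ℝ≥0∞) (τ n ω) = 0 := by
    intro s hs
    filter_upwards [hτ.ae_pos] with ω hω
    rw [ENNReal.tsum_eq_zero]
    intro n
    rw [Set.indicator_of_notMem]
    rw [Set.mem_Iic]
    linarith [hω n]
  have hL : ∀ s t : ℝ, Measure.sum (fun n : ℕ × ℕ => μ.map fun ω => (τ n.1 ω, τ n.2 ω))
      (Set.Iic s ×ˢ Set.Iic t)
      = ENNReal.ofReal s * ENNReal.ofReal t + ENNReal.ofReal (min s t) := by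
    intro s t
    have hst : MeasurableSet (Set.Iic s ×ˢ Set.Iic t) := measurableSet_Iic.prod measurableSet_Iic
    rw [Measure.sum_apply _ hst]
    have h1 : ∀ n : ℕ × ℕ, μ.map (fun ω => (τ n.1 ω, τ n.2 ω)) (Set.Iic s ×ˢ Set.Iic t) =
        ∫⁻ ω, (Set.Iic s).indicator 1 (τ n.1 ω) * (Set.Iic t).indicator 1 (τ n.2 ω) ∂μ := fun n => by
      rw [Measure.map_apply (hm n) hst, ← lintegral_indicator_one ((hm n) hst)]
      refine lintegral_congr fun ω => ?_
      classical
      by_cases h1 : τ n.1 ω ∈ Set.Iic s <;> by_cases h2 : τ n.2 ω ∈ Set.Iic t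
      all_goals
        rw [Set.indicator_apply, Set.indicator_apply, Set.indicator_apply, Set.mem_preimage,
          Set.mem_prod]
        simp [h1, h2]
    simp_rw [h1]
    rw [← lintegral_tsum (f := fun (n : ℕ × ℕ) ω => (Set.Iic s).indicator 1 (τ n.1 ω) *
      (Set.Iic t).indicator 1 (τ n.2 ω)) fun n => (((measurable_one.indicator measurableSet_Iic).comp
      (hτ.measurable _)).mul ((measurable_one.indicator measurableSet_Iic).comp
      (hτ.measurable _))).aemeasurable]
    have h2 : ∀ ω, ∑' n : ℕ × ℕ, (Set.Iic s).indicator (1 : ℝ → ℝ≥0∞) (τ n.1 ω) *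
        (Set.Iic t).indicator (1 : ℝ → ℝ≥0∞) (τ n.2 ω) =
        (∑' n, (Set.Iic s).indicator (1 : ℝ → ℝ≥0∞) (τ n ω)) *
          ∑' n, (Set.Iic t).indicator (1 : ℝ → ℝ≥0∞) (τ n ω) := by
      intro ω
      rw [ENNReal.tsum_prod (f := fun n m => (Set.Iic s).indicator (1 : ℝ → ℝ≥0∞) (τ n ω) *
        (Set.Iic t).indicator (1 : ℝ → ℝ≥0∞) (τ m ω))]
      simp_rw [ENNReal.tsum_mul_left, ENNReal.tsum_mul_right]
    simp_rw [h2]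
    by_cases hs : 0 ≤ s
    · by_cases ht : 0 ≤ t
      · lift s to ℝ≥0 using hs
        lift t to ℝ≥0 using ht
        rw [← NNReal.coe_min]
        simp only [ENNReal.ofReal_coe_nnreal]
        rcases le_total s t with h | h
        · rw [hle s t h, min_eq_left h]
        · simp_rw [mul_comm (∑' n, (Set.Iic (s : ℝ)).indicator (1 : ℝ → ℝ≥0∞) (τ n _))]
          rw [hle t s h, min_eq_right h, mul_comm (t : ℝ≥0∞)]
      · rw [lintegral_congr_ae (g := 0) ((hneg t (not_le.1 ht)).mono fun ω hω => by simp [hω]),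
          ENNReal.ofReal_of_nonpos (not_le.1 ht).le,
          ENNReal.ofReal_of_nonpos ((min_le_right s t).trans (not_le.1 ht).le)]
        simp
    · rw [lintegral_congr_ae (g := 0) ((hneg s (not_le.1 hs)).mono fun ω hω => by simp [hω]),
        ENNReal.ofReal_of_nonpos (not_le.1 hs).le,
        ENNReal.ofReal_of_nonpos ((min_le_left s t).trans (not_le.1 hs).le)]
      simp
  -- both sides agree on the π-system of quadrants, which generates the σ-algebra
  have hgen : MeasurableSpace.generateFrom (Set.range (Set.Iic : ℝ → Set ℝ)) =
      Real.measurableSpace := by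
    rw [← borel_eq_generateFrom_Iic]; exact BorelSpace.measurable_eq.symm
  have hspan : IsCountablySpanning (Set.range (Set.Iic : ℝ → Set ℝ)) :=
    ⟨fun n : ℕ => Set.Iic (n : ℝ), fun n => ⟨n, rfl⟩,
      Set.iUnion_eq_univ_iff.2 fun x => exists_nat_ge x⟩
  refine Measure.ext_of_generateFrom_of_iUnion _ (fun n : ℕ => Set.Iic (n : ℝ) ×ˢ Set.Iic (n : ℝ))
    (generateFrom_eq_prod hgen hgen hspan hspan).symm (isPiSystem_Iic.prod isPiSystem_Iic) ?_
    (fun n => ⟨_, ⟨n, rfl⟩, _, ⟨n, rfl⟩, rfl⟩) (fun n => ?_) ?_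
  · refine Set.iUnion_eq_univ_iff.2 fun x => ?_
    obtain ⟨n, hn⟩ := exists_nat_ge (max x.1 x.2)
    exact ⟨n, (le_max_left _ _).trans hn, (le_max_right _ _).trans hn⟩
  · rw [hL]
    finiteness
  · rintro _ ⟨_, ⟨s, rfl⟩, _, ⟨t, rfl⟩, rfl⟩
    rw [hL, hR]

theorem IsUnitPoisson.lintegral_tsum_tsum_comp (hτ : IsUnitPoisson τ μ) {f : ℝ × ℝ → ℝ≥0∞}
    (hf : Measurable f) :
    ∫⁻ ω, ∑' n, ∑' m, f (τ n ω, τ m ω) ∂μ =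
      (∫⁻ u in Set.Ioi 0, ∫⁻ v in Set.Ioi 0, f (u, v)) + ∫⁻ u in Set.Ioi 0, f (u, u) := by
  have hm : ∀ n : ℕ × ℕ, Measurable fun ω => (τ n.1 ω, τ n.2 ω) := fun n =>
    (hτ.measurable _).prodMk (hτ.measurable _)
  have h1 : ∀ ω, ∑' n, ∑' m, f (τ n ω, τ m ω) = ∑' n : ℕ × ℕ, f (τ n.1 ω, τ n.2 ω) := fun ω =>
    (ENNReal.tsum_prod (f := fun n m => f (τ n ω, τ m ω))).symm
  simp_rw [h1]
  rw [lintegral_tsum (f := fun (n : ℕ × ℕ) ω => f (τ n.1 ω, τ n.2 ω)) fun n =>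
    (hf.comp (hm n)).aemeasurable]
  rw [tsum_congr fun n => (lintegral_map hf (hm n)).symm, ← lintegral_sum_measure,
    hτ.sum_map_prodMk, lintegral_add_measure, lintegral_prod _ hf.aemeasurable,
    lintegral_map hf (by fun_prop)]

variable {E : Type*} [MeasurableSpace E] {Y : Ω → E}

theorem ProbabilityTheory.IndepFun.lintegral_comp_prodMk {F : Type*} [MeasurableSpace F]
    {Z : Ω → F} [IsProbabilityMeasure μ] (hind : IndepFun Y Z μ) (hY : Measurable Y)
    (hZ : Measurable Z) {f : E × F → ℝ≥0∞} (hf : Measurable f) :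
    ∫⁻ ω, f (Y ω, Z ω) ∂μ = ∫⁻ ω, ∫⁻ ω', f (Y ω, Z ω') ∂μ ∂μ := by
  have h1 := (indepFun_iff_map_prod_eq_prod_map_map hY.aemeasurable hZ.aemeasurable).1 hind
  rw [← lintegral_map (μ := μ) hf (hY.prodMk hZ), h1, lintegral_prod _ hf.aemeasurable,
    lintegral_map hf.lintegral_prod_right' hY]
  exact lintegral_congr fun ω =>
    lintegral_map (f := fun z => f (Y ω, z)) (hf.comp measurable_prodMk_left) hZ

/-- Campbell's formula with an independent mark. -/
theorem IsUnitPoisson.lintegral_tsum_comp_of_indepFun [IsProbabilityMeasure μ]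
    (hτ : IsUnitPoisson τ μ) (hY : Measurable Y) (hind : IndepFun Y (fun ω n => τ n ω) μ)
    {f : ℝ → E → ℝ≥0∞} (hf : Measurable (Function.uncurry f)) :
    ∫⁻ ω, ∑' n, f (τ n ω) (Y ω) ∂μ = ∫⁻ u in Set.Ioi 0, ∫⁻ ω, f u (Y ω) ∂μ := by
  have hF : Measurable fun p : E × (ℕ → ℝ) => ∑' n, f (p.2 n) p.1 :=
    Measurable.tsum fun n => hf.comp (f := fun p : E × (ℕ → ℝ) => (p.2 n, p.1))
      (((measurable_pi_apply n).comp measurable_snd).prodMk measurable_fst)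
  have hf' : Measurable (Function.uncurry fun (u : ℝ) (ω : Ω) => f u (Y ω)) :=
    hf.comp (measurable_fst.prodMk (hY.comp measurable_snd))
  rw [lintegral_lintegral_swap hf'.aemeasurable]
  refine (hind.lintegral_comp_prodMk hY (measurable_pi_lambda _ hτ.measurable) hF).trans
    (lintegral_congr fun ω => ?_)
  exact hτ.lintegral_tsum_comp (hf.comp (measurable_id.prodMk measurable_const))

theorem IsUnitPoisson.lintegral_tsum_tsum_comp_of_indepFun [IsProbabilityMeasure μ]
    (hτ : IsUnitPoisson τ μ) (hY : Measurable Y) (hind : IndepFun Y (fun ω n => τ n ω) μ)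
    {f : ℝ × ℝ → E → ℝ≥0∞} (hf : Measurable (Function.uncurry f)) :
    ∫⁻ ω, ∑' n, ∑' m, f (τ n ω, τ m ω) (Y ω) ∂μ =
      ∫⁻ ω, ((∫⁻ u in Set.Ioi 0, ∫⁻ v in Set.Ioi 0, f (u, v) (Y ω)) +
        ∫⁻ u in Set.Ioi 0, f (u, u) (Y ω)) ∂μ := by
  have hF : Measurable fun p : E × (ℕ → ℝ) => ∑' n, ∑' m, f (p.2 n, p.2 m) p.1 :=
    Measurable.tsum fun n => Measurable.tsum fun m =>
      hf.comp (f := fun p : E × (ℕ → ℝ) => ((p.2 n, p.2 m), p.1))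
      ((((measurable_pi_apply n).comp measurable_snd).prodMk
        ((measurable_pi_apply m).comp measurable_snd)).prodMk measurable_fst)
  refine (hind.lintegral_comp_prodMk hY (measurable_pi_lambda _ hτ.measurable) hF).trans
    (lintegral_congr fun ω => ?_)
  exact hτ.lintegral_tsum_tsum_comp (f := fun p => f p (Y ω))
    (hf.comp (measurable_id.prodMk measurable_const))

end Poisson


/-! ### The number of requests that meet a given state -/

section StateCount

variable {Ω : Type*} {M : ℕ} {T : ℕ → Ω → ℝ} {X : ℕ → Ω → Fin M} {τ : ℕ → Ω → ℝ}

/-- The number of requests in the time interval `(s, t]` that meet the state `r`. -/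
noncomputable def stateCount (τ T : ℕ → Ω → ℝ) (X : ℕ → Ω → Fin M) (r : Fin M) (s t : ℝ)
    (ω : Ω) : ℝ≥0∞ :=
  ∑' n, (Set.Ioc s t ∩ {u | modulatingState T X u ω = r}).indicator 1 (τ n ω)

/-- For a square-integrable variable, the mean square distance to the mean `m` in terms of the
second moment `v`. -/
theorem integral_sq_toReal_sub_eq [MeasurableSpace Ω] {μ : Measure Ω} [IsProbabilityMeasure μ]
    {f : Ω → ℝ≥0∞} (hf : Measurable f) {m v : ℝ} (hm0 : 0 ≤ m) (hv0 : 0 ≤ v)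
    (hm : ∫⁻ ω, f ω ∂μ = ENNReal.ofReal m) (hv : ∫⁻ ω, f ω * f ω ∂μ = ENNReal.ofReal v) :
    Integrable (fun ω => ((f ω).toReal - m) ^ 2) μ ∧
      ∫ ω, ((f ω).toReal - m) ^ 2 ∂μ = v - m ^ 2 := by
  have hfin : ∀ᵐ ω ∂μ, f ω < ∞ := ae_lt_top hf (by rw [hm]; finiteness)
  have hfin2 : ∀ᵐ ω ∂μ, f ω * f ω < ∞ := ae_lt_top (hf.mul hf) (by rw [hv]; finiteness)
  have i1 : Integrable (fun ω => (f ω).toReal) μ :=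
    integrable_toReal_of_lintegral_ne_top hf.aemeasurable (by rw [hm]; finiteness)
  have i2 : Integrable (fun ω => (f ω * f ω).toReal) μ :=
    integrable_toReal_of_lintegral_ne_top (hf.mul hf).aemeasurable (by rw [hv]; finiteness)
  have e1 : ∫ ω, (f ω).toReal ∂μ = m := by
    rw [integral_toReal hf.aemeasurable hfin, hm, ENNReal.toReal_ofReal hm0]
  have e2 : ∫ ω, (f ω * f ω).toReal ∂μ = v := by
    rw [integral_toReal (f := fun ω => f ω * f ω) (hf.mul hf).aemeasurable hfin2, hv,
      ENNReal.toReal_ofReal hv0]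
  have e : ∀ ω, ((f ω).toReal - m) ^ 2 = (f ω * f ω).toReal - 2 * m * (f ω).toReal + m ^ 2 :=
    fun ω => by rw [ENNReal.toReal_mul]; ring
  have i3 : Integrable (fun ω => (f ω * f ω).toReal - 2 * m * (f ω).toReal) μ :=
    i2.sub (i1.const_mul _)
  simp_rw [e]
  refine ⟨i3.add (integrable_const _), ?_⟩
  rw [integral_add i3 (integrable_const _), integral_sub i2 (i1.const_mul _), integral_const_mul,
    e1, e2]
  simp
  ring

variable [MeasurableSpace Ω] {μ : Measure Ω} {Q : Kernel (Fin M) (Fin M × ℝ)}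

/-- The state is a measurable function of the time and of the path of the environment. -/
theorem measurable_indicator_pathState (r : Fin M) (s t : ℝ) :
    Measurable (Function.uncurry fun (u : ℝ) (e : ℕ → Fin M × ℝ) =>
      (Set.Ioc s t ∩ {u | modulatingState (fun n e => (e n).2) (fun n e => (e n).1) u e = r}).indicator
        (1 : ℝ → ℝ≥0∞) u) := by
  have h := measurable_modulatingState (Ω := ℕ → Fin M × ℝ) (T := fun n e => (e n).2)
    (X := fun n e => (e n).1) (fun n => (measurable_pi_apply n).snd)
    (fun n => (measurable_pi_apply n).fst)
  have hS : MeasurableSet {p : ℝ × (ℕ → Fin M × ℝ) | p.1 ∈ Set.Ioc s t ∧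
      modulatingState (fun n e => (e n).2) (fun n e => (e n).1) p.1 p.2 = r} :=
    (measurable_fst measurableSet_Ioc).inter (h (measurableSet_singleton r))
  exact measurable_one.indicator hS

theorem IsStationarySemiMarkov.measurable_environment (hJ : IsStationarySemiMarkov Q T X μ) :
    Measurable fun ω => fun n => (X n ω, T n ω) :=
  measurable_pi_lambda _ fun n => (hJ.measurable_state n).prodMk (hJ.measurable_time n)

theorem IsStationarySemiMarkov.measurable_stateCount (hJ : IsStationarySemiMarkov Q T X μ)
    (hτ : ∀ n, Measurable (τ n)) (r : Fin M) (s t : ℝ) :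
    Measurable (stateCount τ T X r s t) :=
  Measurable.tsum fun n => (measurable_indicator_pathState r s t).comp
    (f := fun ω => (τ n ω, fun n => (X n ω, T n ω))) ((hτ n).prodMk hJ.measurable_environment)

theorem IsStationarySemiMarkov.measurableSet_state_fst (hJ : IsStationarySemiMarkov Q T X μ)
    (r : Fin M) (ω : Ω) : MeasurableSet {u | modulatingState T X u ω = r} :=
  (hJ.measurable_modulatingState_fst.comp measurable_prodMk_right) (measurableSet_singleton r)

theorem lintegral_Ioi_indicator_Ioc {s t : ℝ} (hs : 0 ≤ s) {A : Set ℝ} (hA : MeasurableSet A) :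
    ∫⁻ u in Set.Ioi 0, (Set.Ioc s t ∩ A).indicator 1 u = volume (Set.Ioc s t ∩ A) := by
  rw [lintegral_indicator_one (measurableSet_Ioc.inter hA),
    Measure.restrict_apply (measurableSet_Ioc.inter hA), Set.inter_eq_left.2]
  exact fun u hu => hs.trans_lt hu.1.1

/-- By stationarity, requests meet the state `r` at the rate `π r`. -/
theorem lintegral_stateCount [IsProbabilityMeasure μ] (hJ : IsStationarySemiMarkov Q T X μ)
    (hτ : IsUnitPoisson τ μ)
    (hJτ : IndepFun (fun ω => fun n => (X n ω, T n ω)) (fun ω => fun n => τ n ω) μ)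
    (r : Fin M) {s t : ℝ} (hs : 0 ≤ s) :
    ∫⁻ ω, stateCount τ T X r s t ω ∂μ = ENNReal.ofReal (t - s) * stationaryProb T X μ r := by
  refine (hτ.lintegral_tsum_comp_of_indepFun hJ.measurable_environment hJτ
    (measurable_indicator_pathState r s t)).trans ?_
  have : ∀ u : ℝ, ∫⁻ ω, (Set.Ioc s t ∩ {u | modulatingState T X u ω = r}).indicator
      (1 : ℝ → ℝ≥0∞) u ∂μ = (Set.Ioc s t).indicator (fun _ => stationaryProb T X μ r) u := by
    intro u
    by_cases hu : u ∈ Set.Ioc s t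
    · have hm : MeasurableSet {ω | modulatingState T X u ω = r} :=
        (hJ.measurable_modulatingState_fst.comp measurable_prodMk_left) (measurableSet_singleton r)
      rw [Set.indicator_of_mem hu, ← hJ.measure_state r (hs.trans hu.1.le),
        ← lintegral_indicator_one hm]
      refine lintegral_congr fun ω => ?_
      by_cases hr : modulatingState T X u ω = r
      · rw [Set.indicator_of_mem (show u ∈ Set.Ioc s t ∩ {u | modulatingState T X u ω = r} from
          ⟨hu, hr⟩), Set.indicator_of_mem (show ω ∈ {ω | modulatingState T X u ω = r} from hr)]
        rfl
      · rw [Set.indicator_of_notMem fun h => hr h.2,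
          Set.indicator_of_notMem (show ω ∉ {ω | modulatingState T X u ω = r} from hr)]
    · simp [Set.indicator, Set.mem_inter_iff, hu]
  refine (lintegral_congr this).trans ?_
  have hsub : Set.Ioc s t ⊆ Set.Ioi 0 := fun u hu => hs.trans_lt hu.1
  rw [lintegral_indicator measurableSet_Ioc, setLIntegral_const,
    Measure.restrict_apply measurableSet_Ioc, Set.inter_eq_left.2 hsub, Real.volume_Ioc, mul_comm]

/-- The second moment of the time spent in a state does not depend on the position of the
time interval. -/
theorem IsStationarySemiMarkov.lintegral_volume_Ioc_mul_self [IsProbabilityMeasure μ]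
    (hJ : IsStationarySemiMarkov Q T X μ) (r : Fin M) {s : ℝ} (hs : 0 ≤ s) (t : ℝ) :
    ∫⁻ ω, volume (Set.Ioc s (s + t) ∩ {u | modulatingState T X u ω = r}) *
        volume (Set.Ioc s (s + t) ∩ {u | modulatingState T X u ω = r}) ∂μ =
      ∫⁻ ω, occupationTime T X r t ω * occupationTime T X r t ω ∂μ := by
  set G : ℝ → ℝ → ℝ≥0∞ := fun u v =>
    μ {ω | modulatingState T X u ω = r ∧ modulatingState T X v ω = r} with hG
  have hS : MeasurableSet {p : (ℝ × ℝ) × Ω | modulatingState T X p.1.1 p.2 = r ∧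
      modulatingState T X p.1.2 p.2 = r} :=
    ((hJ.measurable_modulatingState_fst.comp ((measurable_fst.comp measurable_fst).prodMk
      measurable_snd)) (measurableSet_singleton r)).inter
    ((hJ.measurable_modulatingState_fst.comp ((measurable_snd.comp measurable_fst).prodMk
      measurable_snd)) (measurableSet_singleton r))
  have hGm : Measurable (Function.uncurry G) := measurable_measure_prodMk_left hS
  -- the second moment is the integral of the two-point probabilities
  have key : ∀ a b : ℝ, ∫⁻ ω, volume (Set.Ioc a b ∩ {u | modulatingState T X u ω = r}) *
      volume (Set.Ioc a b ∩ {u | modulatingState T X u ω = r}) ∂μ =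
      ∫⁻ u in Set.Ioc a b, ∫⁻ v in Set.Ioc a b, G u v := by
    intro a b
    have h1 : ∀ ω, volume (Set.Ioc a b ∩ {u | modulatingState T X u ω = r}) *
        volume (Set.Ioc a b ∩ {u | modulatingState T X u ω = r}) =
        ((volume.restrict (Set.Ioc a b)).prod (volume.restrict (Set.Ioc a b)))
          ((fun p => (p, ω)) ⁻¹' {p : (ℝ × ℝ) × Ω | modulatingState T X p.1.1 p.2 = r ∧
            modulatingState T X p.1.2 p.2 = r}) := by
      intro ω
      have hm := hJ.measurableSet_state_fst r ω
      rw [Set.inter_comm, ← Measure.restrict_apply hm, ← Measure.prod_prod]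
      rfl
    simp_rw [h1]
    rw [← Measure.prod_apply_symm hS, Measure.prod_apply hS]
    exact lintegral_prod (Function.uncurry G) hGm.aemeasurable
  have hmp := measurePreserving_add_right (volume : Measure ℝ) s
  have hpre : (fun x : ℝ => x + s) ⁻¹' Set.Ioc s (s + t) = Set.Ioc 0 t := by
    rw [Set.preimage_add_const_Ioc]; simp
  refine (key s (s + t)).trans (Eq.trans ?_ (key 0 t).symm)
  rw [← hmp.setLIntegral_comp_preimage measurableSet_Ioc
    (f := fun u => ∫⁻ v in Set.Ioc s (s + t), G u v) hGm.lintegral_prod_right', hpre]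
  refine setLIntegral_congr_fun measurableSet_Ioc fun u hu => ?_
  rw [← hmp.setLIntegral_comp_preimage measurableSet_Ioc (f := fun v => G (u + s) v)
    (hGm.comp measurable_prodMk_left), hpre]
  exact setLIntegral_congr_fun measurableSet_Ioc fun v hv =>
    hJ.measure_pair r hs hu.1.le hv.1.le

/-- The mean square deviation of the number of requests that meet the state `r` is that of the
time spent in `r`, increased by the variance of a Poisson variable. -/
theorem integral_sq_stateCount [IsProbabilityMeasure μ] (hJ : IsStationarySemiMarkov Q T X μ)
    (hτ : IsUnitPoisson τ μ)
    (hJτ : IndepFun (fun ω => fun n => (X n ω, T n ω)) (fun ω => fun n => τ n ω) μ)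
    (r : Fin M) {s t : ℝ} (hs : 0 ≤ s) (ht : 0 ≤ t) :
    Integrable (fun ω => ((stateCount τ T X r s (s + t) ω).toReal -
      (stationaryProb T X μ r).toReal * t) ^ 2) μ ∧
    ∫ ω, ((stateCount τ T X r s (s + t) ω).toReal - (stationaryProb T X μ r).toReal * t) ^ 2 ∂μ =
      (stationaryProb T X μ r).toReal * t + ∫ ω, ((occupationTime T X r t ω).toReal -
        (stationaryProb T X μ r).toReal * t) ^ 2 ∂μ := by
  set p := (stationaryProb T X μ r).toReal with hp
  have hp0 : 0 ≤ p := ENNReal.toReal_nonneg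
  have hpp : stationaryProb T X μ r = ENNReal.ofReal p :=
    (ENNReal.ofReal_toReal (stationaryProb_ne_top r)).symm
  have hpt : 0 ≤ p * t := mul_nonneg hp0 ht
  set v := (∫⁻ ω, occupationTime T X r t ω * occupationTime T X r t ω ∂μ).toReal with hv
  have hv0 : 0 ≤ v := ENNReal.toReal_nonneg
  have hL2 : ∫⁻ ω, occupationTime T X r t ω * occupationTime T X r t ω ∂μ = ENNReal.ofReal v := by
    refine (ENNReal.ofReal_toReal (ne_top_of_le_ne_top
      (b := ENNReal.ofReal t * ENNReal.ofReal t) (by finiteness) ?_)).symm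
    refine (lintegral_mono fun ω => mul_le_mul' (occupationTime_le r t ω)
      (occupationTime_le r t ω)).trans ?_
    simp
  have hL1 : ∫⁻ ω, occupationTime T X r t ω ∂μ = ENNReal.ofReal (p * t) := by
    rw [hJ.lintegral_occupationTime, hpp, mul_comm, ENNReal.ofReal_mul hp0]
  have hY1 : ∫⁻ ω, stateCount τ T X r s (s + t) ω ∂μ = ENNReal.ofReal (p * t) := by
    rw [lintegral_stateCount hJ hτ hJτ r hs, add_sub_cancel_left, hpp, mul_comm,
      ENNReal.ofReal_mul hp0]
  -- the time spent in `r` during `(s, s + t]` has the mean of the occupation time of `(0, t]`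
  have hA1 : ∫⁻ ω, volume (Set.Ioc s (s + t) ∩ {u | modulatingState T X u ω = r}) ∂μ =
      ENNReal.ofReal (p * t) := by
    rw [← hY1]
    refine Eq.trans ?_ (hτ.lintegral_tsum_comp_of_indepFun hJ.measurable_environment hJτ
      (measurable_indicator_pathState r s (s + t))).symm
    have hm : Measurable (Function.uncurry fun (u : ℝ) (ω : Ω) =>
        (Set.Ioc s (s + t) ∩ {u | modulatingState T X u ω = r}).indicator (1 : ℝ → ℝ≥0∞) u) :=
      (measurable_indicator_pathState r s (s + t)).comp
        (f := fun p : ℝ × Ω => (p.1, fun n => (X n p.2, T n p.2)))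
        (measurable_fst.prodMk (hJ.measurable_environment.comp measurable_snd))
    refine Eq.trans ?_ (lintegral_lintegral_swap hm.aemeasurable).symm
    exact lintegral_congr fun ω =>
      (lintegral_Ioi_indicator_Ioc hs (hJ.measurableSet_state_fst r ω)).symm
  have hY2 : ∫⁻ ω, stateCount τ T X r s (s + t) ω * stateCount τ T X r s (s + t) ω ∂μ =
      ENNReal.ofReal (v + p * t) := by
    have hf := measurable_indicator_pathState (M := M) r s (s + t)
    have hf2 : Measurable (Function.uncurry fun (q : ℝ × ℝ) (e : ℕ → Fin M × ℝ) =>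
        (Set.Ioc s (s + t) ∩ {u | modulatingState (fun n e => (e n).2) (fun n e => (e n).1) u e
          = r}).indicator (1 : ℝ → ℝ≥0∞) q.1 *
        (Set.Ioc s (s + t) ∩ {u | modulatingState (fun n e => (e n).2) (fun n e => (e n).1) u e
          = r}).indicator (1 : ℝ → ℝ≥0∞) q.2) :=
      (hf.comp (f := fun x : (ℝ × ℝ) × (ℕ → Fin M × ℝ) => (x.1.1, x.2)) (by fun_prop)).mul
        (hf.comp (f := fun x : (ℝ × ℝ) × (ℕ → Fin M × ℝ) => (x.1.2, x.2)) (by fun_prop))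
    have h1 := hτ.lintegral_tsum_tsum_comp_of_indepFun hJ.measurable_environment hJτ hf2
    have h2 : ∀ ω, stateCount τ T X r s (s + t) ω * stateCount τ T X r s (s + t) ω =
        ∑' n, ∑' m, (Set.Ioc s (s + t) ∩ {u | modulatingState T X u ω = r}).indicator
          (1 : ℝ → ℝ≥0∞) (τ n ω) *
          (Set.Ioc s (s + t) ∩ {u | modulatingState T X u ω = r}).indicator
          (1 : ℝ → ℝ≥0∞) (τ m ω) := by
      intro ω
      simp_rw [ENNReal.tsum_mul_left, ENNReal.tsum_mul_right]
      rfl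
    simp_rw [h2]
    refine h1.trans ?_
    -- the pairs of distinct requests contribute the squared time in `r`, the diagonal the time
    have h3 : ∀ ω, (∫⁻ u in Set.Ioi (0 : ℝ), ∫⁻ v in Set.Ioi (0 : ℝ),
        (Set.Ioc s (s + t) ∩ {u | modulatingState T X u ω = r}).indicator (1 : ℝ → ℝ≥0∞) u *
        (Set.Ioc s (s + t) ∩ {u | modulatingState T X u ω = r}).indicator (1 : ℝ → ℝ≥0∞) v) +
        (∫⁻ u in Set.Ioi (0 : ℝ),
        (Set.Ioc s (s + t) ∩ {u | modulatingState T X u ω = r}).indicator (1 : ℝ → ℝ≥0∞) u *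
        (Set.Ioc s (s + t) ∩ {u | modulatingState T X u ω = r}).indicator (1 : ℝ → ℝ≥0∞) u) =
        volume (Set.Ioc s (s + t) ∩ {u | modulatingState T X u ω = r}) *
        volume (Set.Ioc s (s + t) ∩ {u | modulatingState T X u ω = r}) +
        volume (Set.Ioc s (s + t) ∩ {u | modulatingState T X u ω = r}) := by
      intro ω
      have hm := hJ.measurableSet_state_fst r ω
      have hi : Measurable ((Set.Ioc s (s + t) ∩ {u | modulatingState T X u ω = r}).indicator
        (1 : ℝ → ℝ≥0∞)) := measurable_one.indicator (measurableSet_Ioc.inter hm)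
      have hsq : ∀ u, (Set.Ioc s (s + t) ∩ {u | modulatingState T X u ω = r}).indicator
          (1 : ℝ → ℝ≥0∞) u * (Set.Ioc s (s + t) ∩ {u | modulatingState T X u ω = r}).indicator
          (1 : ℝ → ℝ≥0∞) u = (Set.Ioc s (s + t) ∩ {u | modulatingState T X u ω = r}).indicator
          (1 : ℝ → ℝ≥0∞) u := fun u => by
        by_cases hu : u ∈ Set.Ioc s (s + t) ∩ {u | modulatingState T X u ω = r}
        · simp [Set.indicator_of_mem hu]
        · simp [Set.indicator_of_notMem hu]
      simp_rw [hsq, lintegral_const_mul _ hi]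
      rw [lintegral_mul_const _ hi, lintegral_Ioi_indicator_Ioc hs hm]
    refine (lintegral_congr h3).trans ?_
    rw [lintegral_add_right, hA1, hJ.lintegral_volume_Ioc_mul_self r hs, hL2,
      ENNReal.ofReal_add hv0 hpt]
    have hS : MeasurableSet {q : Ω × ℝ | q.2 ∈ Set.Ioc s (s + t) ∧
        q.1 ∈ {ω | modulatingState T X q.2 ω = r}} :=
      (measurable_snd measurableSet_Ioc).inter (hJ.measurableSet_state r)
    exact measurable_measure_prodMk_left hS
  have eL := integral_sq_toReal_sub_eq (hJ.measurable_occupationTime r t) hpt hv0 hL1 hL2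
  have eY := integral_sq_toReal_sub_eq (hJ.measurable_stateCount hτ.measurable r s (s + t)) hpt
    (add_nonneg hv0 hpt) hY1 hY2
  refine ⟨eY.1, ?_⟩
  rw [eY.2, eL.2]
  ring

/-- In every sufficiently long block of time, it is likely that each state meets nearly as many
requests as expected, uniformly over the position of the block. -/
theorem exists_measure_stateCount_lt_le [IsProbabilityMeasure μ] [IsMarkovKernel Q]
    (hJ : IsStationarySemiMarkov Q T X μ) (hτ : IsUnitPoisson τ μ)
    (hJτ : IndepFun (fun ω => fun n => (X n ω, T n ω)) (fun ω => fun n => τ n ω) μ)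
    (hπ : ∀ r, 0 < stationaryProb T X μ r) {ε : ℝ} (hε : 0 < ε) :
    ∃ B : ℝ, 0 < B ∧ ∀ s, 0 ≤ s → ∀ r,
      μ.real {ω | (stateCount τ T X r s (s + B) ω).toReal <
        (1 - ε) * (stationaryProb T X μ r).toReal * B} ≤ ε := by
  have hM : Nonempty (Fin M) := (nonempty_of_isProbabilityMeasure μ).map (X 0)
  set p : Fin M → ℝ := fun r => (stationaryProb T X μ r).toReal with hp
  have hp0 : ∀ r, 0 < p r := fun r => ENNReal.toReal_pos (hπ r).ne' (stationaryProb_ne_top r)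
  obtain ⟨r₀, hr₀⟩ := Finite.exists_min p
  set b := p r₀ with hb
  have hb0 : 0 < b := hp0 r₀
  -- Chebyshev's inequality with the deviation `ε * p r * B`: the time spent in `r` and the Poisson
  -- variance each contribute at most `ε / 2`
  obtain ⟨B, hB, hB0, hB1⟩ := ((hJ.integral_sq_occupationTime_le
    (show 0 < ε ^ 3 * b ^ 2 / 2 by positivity)).and ((eventually_gt_atTop 0).and
    (eventually_ge_atTop (2 / (ε ^ 3 * b))))).exists
  refine ⟨B, hB0, fun s hs r => ?_⟩
  obtain ⟨hi, he⟩ := integral_sq_stateCount hJ hτ hJτ r hs hB0.le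
  have hpr := hr₀ r
  have hbp : b ^ 2 ≤ p r ^ 2 := by gcongr
  have h1 : ∫ ω, ((stateCount τ T X r s (s + B) ω).toReal - p r * B) ^ 2 ∂μ ≤
      p r * B + ε ^ 3 * b ^ 2 / 2 * B ^ 2 := by
    rw [he]
    exact add_le_add le_rfl (hB r)
  have h2 := measureReal_sq_le hi (a := ε * p r * B)
    (mul_pos (mul_pos hε (hp0 r)) hB0) h1
  refine (measureReal_mono fun ω (hω : (stateCount τ T X r s (s + B) ω).toReal <
    (1 - ε) * p r * B) => ?_).trans (h2.trans ?_)
  · change ε * p r * B ≤ |(stateCount τ T X r s (s + B) ω).toReal - p r * B|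
    rw [abs_sub_comm]
    refine le_trans ?_ (le_abs_self _)
    linarith
  · have hpos := hp0 r
    rw [div_le_iff₀ (by positivity)]
    rw [div_le_iff₀ (by positivity)] at hB1
    have h3 : 1 ≤ ε ^ 3 * p r * B / 2 := by
      have : B * (ε ^ 3 * b) ≤ B * (ε ^ 3 * p r) := by gcongr
      linarith
    have h4 : p r * B * 1 ≤ p r * B * (ε ^ 3 * p r * B / 2) := by gcongr
    have h5 : ε ^ 3 * b ^ 2 / 2 * B ^ 2 ≤ ε ^ 3 * p r ^ 2 / 2 * B ^ 2 := by gcongr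
    nlinarith

end StateCount


/-! ### Faults of a caching policy -/

namespace CachePolicy

variable {x : ℕ} (π : CachePolicy x)

theorem history_congr {r r' : ℕ → ℕ} {n : ℕ} (h : ∀ k < n, r k = r' k) :
    π.history r n = π.history r' n := by
  induction n with
  | zero => rfl
  | succ n ih =>
    have ih' := ih fun k hk => h k (by omega)
    have h1 : (fun k : Fin (n + 1) => r k) = fun k : Fin (n + 1) => r' k :=
      funext fun k => h k k.2
    simp only [history, ih', h n n.lt_succ_self, h1]

theorem content_congr {r r' : ℕ → ℕ} {n : ℕ} (h : ∀ k < n, r k = r' k) :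
    π.content r n = π.content r' n := by
  rw [content, content, π.history_congr h]

theorem content_succ (r : ℕ → ℕ) (n : ℕ) :
    π.content r (n + 1) = if r n ∈ π.content r n then π.content r n
      else π.update n (fun k => r k) (π.history r n) := by
  simp only [content, history, Fin.snoc_last]
  rfl

theorem card_content_le (r : ℕ → ℕ) (n : ℕ) : (π.content r n).card ≤ x := by
  induction n with
  | zero => exact π.init_card
  | succ n ih =>
    rw [content_succ]
    split_ifs
    · exact ih
    · exact π.update_card n _ _ ih

theorem content_succ_subset (r : ℕ → ℕ) (n : ℕ) :
    π.content r (n + 1) ⊆ insert (r n) (π.content r n) := by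
  rw [content_succ]
  split_ifs
  · exact Finset.subset_insert _ _
  · exact π.update_subset n _ _

theorem content_subset (r : ℕ → ℕ) {a n : ℕ} (han : a ≤ n) :
    π.content r n ⊆ π.content r a ∪ (Finset.Ico a n).image r := by
  induction n, han using Nat.le_induction with
  | base => exact Finset.subset_union_left
  | succ n han ih =>
    intro i hi
    rcases Finset.mem_insert.1 (π.content_succ_subset r n hi) with rfl | h
    · exact Finset.mem_union_right _ (Finset.mem_image_of_mem _ (by simp [han]))
    · rcases Finset.mem_union.1 (ih h) with h | h
      · exact Finset.mem_union_left _ h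
      · exact Finset.mem_union_right _ (Finset.image_mono _ (Finset.Ico_subset_Ico_right n.le_succ) h)

theorem content_static (r : ℕ → ℕ) (n : ℕ) : (static x).content r n = Finset.range x := by
  induction n with
  | zero => rfl
  | succ n ih =>
    rw [content_succ, ih]
    split_ifs
    · rfl
    · exact ih

/-- Each document that is requested in a block and absent at the start of the block causes at
least one fault. -/
theorem card_image_sdiff_content_le (r : ℕ → ℕ) (a b : ℕ) :
    ((Finset.Ico a b).image r \ π.content r a).card ≤
      ((Finset.Ico a b).filter fun n => r n ∉ π.content r n).card := by
  classical
  refine (Finset.card_le_card ?_).trans (Finset.card_image_le (f := r))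
  intro i hi
  obtain ⟨hi, hia⟩ := Finset.mem_sdiff.1 hi
  obtain ⟨l, hl, rfl⟩ := Finset.mem_image.1 hi
  -- the first request of the document in the block is a fault
  have hex : ∃ k, k ∈ Finset.Ico a b ∧ r k = r l := ⟨l, hl, rfl⟩
  obtain ⟨hk, hkl⟩ := Nat.find_spec hex
  refine Finset.mem_image.2 ⟨Nat.find hex, Finset.mem_filter.2 ⟨hk, fun hcon => ?_⟩, hkl⟩
  rcases Finset.mem_union.1 (π.content_subset r (Finset.mem_Ico.1 hk).1 hcon) with h | h
  · exact hia (hkl ▸ h)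
  · obtain ⟨m, hm, hml⟩ := Finset.mem_image.1 h
    have hm' := Finset.mem_Ico.1 hm
    exact Nat.find_min hex hm'.2
      ⟨Finset.mem_Ico.2 ⟨hm'.1, hm'.2.trans (Finset.mem_Ico.1 hk).2⟩, hml.trans hkl⟩

end CachePolicy

/-- Among the sets of at most `x` indices, the removal of the first `x` indices leaves the
smallest part of the sum of a decreasing sequence. -/
theorem tsum_add_le_tsum_notMem {f : ℕ → ℝ≥0∞} (hf : Antitone f) {x : ℕ} {C : Finset ℕ}
    (hC : C.card ≤ x) : ∑' k, f (x + k) ≤ ∑' i, if i ∈ C then 0 else f i := by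
  classical
  refine ENNReal.tsum_le_of_sum_range_le fun n => ?_
  set A := Finset.range (x + n) \ C with hA
  set B := Finset.Ico x (x + n) with hB
  have hcard : (B \ A).card ≤ (A \ B).card := by
    have h1 : B.card ≤ A.card := by
      have := Finset.le_card_sdiff C (Finset.range (x + n))
      rw [Finset.card_range, ← hA] at this
      rw [hB, Nat.card_Ico]
      omega
    have h2 := Finset.card_sdiff_add_card_inter B A
    have h3 := Finset.card_sdiff_add_card_inter A B
    rw [Finset.inter_comm] at h3
    omega
  have h1 : ∑ i ∈ B \ A, f i ≤ ∑ i ∈ A \ B, f i := by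
    calc ∑ i ∈ B \ A, f i ≤ (B \ A).card • f x :=
          Finset.sum_le_card_nsmul _ _ _ fun i hi =>
            hf (Finset.mem_Ico.1 (Finset.mem_sdiff.1 hi).1).1
      _ ≤ (A \ B).card • f x := by gcongr
      _ ≤ ∑ i ∈ A \ B, f i := Finset.card_nsmul_le_sum _ _ _ fun i hi => by
          obtain ⟨h1, h2⟩ := Finset.mem_sdiff.1 hi
          have h3 := Finset.mem_range.1 (Finset.mem_sdiff.1 h1).1
          refine hf ?_
          by_contra! hcon
          exact h2 (Finset.mem_Ico.2 ⟨hcon.le, h3⟩)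
  calc ∑ k ∈ Finset.range n, f (x + k) = ∑ i ∈ B, f i := by
        rw [hB, Finset.sum_Ico_eq_sum_range, Nat.add_sub_cancel_left]
    _ = ∑ i ∈ B ∩ A, f i + ∑ i ∈ B \ A, f i := (Finset.sum_inter_add_sum_sdiff _ _ _).symm
    _ ≤ ∑ i ∈ A ∩ B, f i + ∑ i ∈ A \ B, f i := by rw [Finset.inter_comm]; gcongr
    _ = ∑ i ∈ A, f i := Finset.sum_inter_add_sum_sdiff _ _ _
    _ = ∑ i ∈ A, if i ∈ C then 0 else f i :=
        Finset.sum_congr rfl fun i hi => (if_neg (Finset.mem_sdiff.1 hi).2).symm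
    _ ≤ _ := ENNReal.sum_le_tsum _

/-- A finite request sequence, continued by zeros. -/
def extendByZero {b : ℕ} (y : Fin b → ℕ) (k : ℕ) : ℕ := if h : k < b then y ⟨k, h⟩ else 0

/-- Lower bound for the mean number of faults in a block of independent requests, if the
document `i` is requested in the block with a probability of at least `f i`. -/
theorem tsum_add_le_lintegral_faults {x b : ℕ} (a : ℕ) (π : CachePolicy x) (p : Fin b → PMF ℕ)
    {f : ℕ → ℝ≥0∞} (hf : Antitone f)
    (h : ∀ i, f i + Measure.pi (fun l => (p l).toMeasure) {y | ∀ l : Fin b, a ≤ l → y l ≠ i} ≤ 1) :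
    ∑' k, f (x + k) ≤ ∫⁻ y, (((Finset.Ico a b).filter fun n =>
      extendByZero y n ∉ π.content (extendByZero y) n).card : ℝ≥0∞)
        ∂Measure.pi (fun l => (p l).toMeasure) := by
  classical
  set P : Measure (Fin b → ℕ) := Measure.pi fun l => (p l).toMeasure with hP
  have hdisc : ∀ S : Set (Fin b → ℕ), MeasurableSet S := fun S => S.to_countable.measurableSet
  -- absence from the initial content is independent of the requests in the block
  have hindep : ∀ i, P ({y | i ∉ π.content (extendByZero y) a} ∩ {y | ∀ l : Fin b, a ≤ l → y l ≠ i})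
      = P {y | i ∉ π.content (extendByZero y) a} * P {y | ∀ l : Fin b, a ≤ l → y l ≠ i} := by
    intro i
    set S : Finset (Fin b) := Finset.univ.filter fun l : Fin b => (l : ℕ) < a with hS
    set S' : Finset (Fin b) := Finset.univ.filter fun l : Fin b => a ≤ (l : ℕ) with hS'
    have hdis : Disjoint S S' := by
      rw [Finset.disjoint_filter]
      intro l _ h1 h2
      omega
    have hI : iIndepFun (fun (l : Fin b) (y : Fin b → ℕ) => y l) P :=
      iIndepFun_pi (X := fun _ => id) fun l => measurable_id.aemeasurable
    have hII := iIndepFun.indepFun_finset (f := fun (l : Fin b) (y : Fin b → ℕ) => y l) S S' hdis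
      hI fun l => measurable_pi_apply l
    have hm1 : ∀ U : Set (S → ℕ), MeasurableSet U := fun U => U.to_countable.measurableSet
    have hm2 : ∀ U : Set (S' → ℕ), MeasurableSet U := fun U => U.to_countable.measurableSet
    -- the content at the time `a` depends only on the coordinates in `S`
    have := hII.measure_inter_preimage_eq_mul
      {z : S → ℕ | i ∉ π.content (fun k => if hk : ∃ l : S, ((l : Fin b) : ℕ) = k then
        z hk.choose else 0) a} {z : S' → ℕ | ∀ l, z l ≠ i} (hm1 _) (hm2 _)
    have e1 : (fun (y : Fin b → ℕ) (l : S) => y l) ⁻¹' {z : S → ℕ | i ∉ π.content (fun k =>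
        if hk : ∃ l : S, ((l : Fin b) : ℕ) = k then z hk.choose else 0) a} =
        {y | i ∉ π.content (extendByZero y) a} := by
      ext y
      change i ∉ _ ↔ i ∉ _
      rw [π.content_congr (r' := extendByZero y)]
      intro k hk
      by_cases hkb : k < b
      · have hex : ∃ l : S, ((l : Fin b) : ℕ) = k :=
          ⟨⟨⟨k, hkb⟩, Finset.mem_filter.2 ⟨Finset.mem_univ _, hk⟩⟩, rfl⟩
        simp only [hex, dif_pos, extendByZero, hkb]
        congr 1
        exact Fin.ext hex.choose_spec
      · have hex : ¬ ∃ l : S, ((l : Fin b) : ℕ) = k := by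
          rintro ⟨l, rfl⟩
          exact hkb (l : Fin b).2
        simp only [hex, dif_neg, extendByZero, hkb, not_false_iff]
    have e2 : (fun (y : Fin b → ℕ) (l : S') => y l) ⁻¹' {z : S' → ℕ | ∀ l, z l ≠ i} =
        {y | ∀ l : Fin b, a ≤ l → y l ≠ i} := by
      ext y
      constructor
      · intro hy l hl
        exact hy ⟨l, Finset.mem_filter.2 ⟨Finset.mem_univ _, hl⟩⟩
      · intro hy l
        exact hy l (Finset.mem_filter.1 l.2).2
    rwa [e1, e2] at this
  have hprod : ∀ i, P {y | i ∉ π.content (extendByZero y) a} * f i ≤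
      P ({y | i ∉ π.content (extendByZero y) a} ∩ {y | ∀ l : Fin b, a ≤ l → y l ≠ i}ᶜ) := by
    intro i
    have h1 : P {y | i ∉ π.content (extendByZero y) a} * f i +
        P {y | i ∉ π.content (extendByZero y) a} * P {y | ∀ l : Fin b, a ≤ l → y l ≠ i} ≤
        P ({y | i ∉ π.content (extendByZero y) a} ∩ {y | ∀ l : Fin b, a ≤ l → y l ≠ i}ᶜ) +
        P {y | i ∉ π.content (extendByZero y) a} * P {y | ∀ l : Fin b, a ≤ l → y l ≠ i} := by
      rw [← hindep i, ← Set.sdiff_eq, add_comm (P (_ \ _)),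
        measure_inter_add_sdiff _ (hdisc _), hindep i, ← mul_add]
      exact mul_le_of_le_one_right' (h i)
    exact (ENNReal.add_le_add_iff_right (by finiteness)).1 h1
  calc ∑' k, f (x + k) = ∫⁻ _, ∑' k, f (x + k) ∂P := by simp
    _ ≤ ∫⁻ y, ∑' i, (if i ∈ π.content (extendByZero y) a then 0 else f i) ∂P :=
        lintegral_mono fun y => tsum_add_le_tsum_notMem hf (π.card_content_le _ a)
    _ = ∑' i, ∫⁻ y, {y | i ∉ π.content (extendByZero y) a}.indicator (fun _ => f i) y ∂P := by
        rw [lintegral_tsum fun i => (measurable_of_countable _).aemeasurable]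
        refine tsum_congr fun i => lintegral_congr fun y => ?_
        by_cases hi : i ∈ π.content (extendByZero y) a
        · rw [if_pos hi, Set.indicator_of_notMem
            (show y ∉ {y | i ∉ π.content (extendByZero y) a} from fun hn => hn hi)]
        · rw [if_neg hi, Set.indicator_of_mem (show y ∈ {y | i ∉ π.content (extendByZero y) a}
            from hi)]
    _ = ∑' i, P {y | i ∉ π.content (extendByZero y) a} * f i := by
        refine tsum_congr fun i => ?_
        rw [lintegral_indicator (hdisc _), setLIntegral_const, mul_comm]
    _ ≤ ∑' i, P ({y | i ∉ π.content (extendByZero y) a} ∩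
          {y | ∀ l : Fin b, a ≤ l → y l ≠ i}ᶜ) := ENNReal.tsum_le_tsum hprod
    _ = ∫⁻ y, ∑' i, ({y | i ∉ π.content (extendByZero y) a} ∩
          {y | ∀ l : Fin b, a ≤ l → y l ≠ i}ᶜ).indicator 1 y ∂P := by
        rw [lintegral_tsum fun i => (measurable_of_countable _).aemeasurable]
        exact tsum_congr fun i => (lintegral_indicator_one (hdisc _)).symm
    _ ≤ _ := lintegral_mono fun y => by
        refine le_trans ?_ (Nat.cast_le.2 (π.card_image_sdiff_content_le (extendByZero y) a b))
        set I := (Finset.Ico a b).image (extendByZero y) \ π.content (extendByZero y) a with hI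
        rw [tsum_eq_sum (s := I)]
        · have h1 : ∀ i ∈ I, ({y | i ∉ π.content (extendByZero y) a} ∩
              {y | ∀ l : Fin b, a ≤ l → y l ≠ i}ᶜ).indicator (1 : (Fin b → ℕ) → ℝ≥0∞) y ≤ 1 :=
            fun i _ => Set.indicator_le_self' (fun _ _ => zero_le) y
          refine (Finset.sum_le_sum h1).trans ?_
          simp
        · intro i hi
          refine Set.indicator_of_notMem (fun hy => hi ?_) _
          obtain ⟨h1, h2⟩ := hy
          refine Finset.mem_sdiff.2 ⟨?_, h1⟩
          have h3 : ¬ ∀ l : Fin b, a ≤ l → y l ≠ i := h2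
          push Not at h3
          obtain ⟨l, hl, hli⟩ := h3
          exact Finset.mem_image.2 ⟨l, Finset.mem_Ico.2 ⟨hl, l.2⟩, by
            simp only [extendByZero, l.2, dif_pos]; exact hli⟩

/-- If the mean number of requests of the document `i` after the time `a` is at least `z`, then
this document is not requested with a probability of at most `exp (-z)`. -/
theorem measure_pi_forall_ne_le {b : ℕ} (a : ℕ) (p : Fin b → PMF ℕ) (i : ℕ) {z : ℝ}
    (hz : z ≤ ∑ l ∈ Finset.univ.filter fun l : Fin b => a ≤ l, (p l i).toReal) :
    Measure.pi (fun l => (p l).toMeasure) {y | ∀ l : Fin b, a ≤ l → y l ≠ i} ≤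
      ENNReal.ofReal (Real.exp (-z)) := by
  classical
  have e : {y : Fin b → ℕ | ∀ l : Fin b, a ≤ l → y l ≠ i} =
      Set.univ.pi fun l : Fin b => if a ≤ l then ({i}ᶜ : Set ℕ) else Set.univ := by
    ext y
    simp only [Set.mem_ofPred_eq, Set.mem_pi, Set.mem_univ, true_implies]
    refine forall_congr' fun l => ?_
    split_ifs with hl <;> simp [hl]
  rw [e, Measure.pi_pi]
  have h1 : ∀ l : Fin b, (p l).toMeasure (if a ≤ l then ({i}ᶜ : Set ℕ) else Set.univ) ≤
      ENNReal.ofReal (Real.exp (-(if a ≤ (l : ℕ) then (p l i).toReal else 0))) := by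
    intro l
    split_ifs with hl
    · rw [prob_compl_eq_one_sub (measurableSet_singleton i),
        PMF.toMeasure_apply_singleton _ _ (measurableSet_singleton i),
        ← ENNReal.ofReal_toReal (PMF.apply_ne_top (p l) i), ← ENNReal.ofReal_one,
        ← ENNReal.ofReal_sub _ ENNReal.toReal_nonneg, ENNReal.toReal_ofReal ENNReal.toReal_nonneg]
      exact ENNReal.ofReal_le_ofReal (Real.one_sub_le_exp_neg _)
    · simp
  refine (Finset.prod_le_prod' fun l _ => h1 l).trans ?_
  rw [← ENNReal.ofReal_prod_of_nonneg fun l _ => (Real.exp_pos _).le, ← Real.exp_sum,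
    Finset.sum_neg_distrib, ← Finset.sum_filter]
  exact ENNReal.ofReal_le_ofReal (Real.exp_le_exp.2 (neg_le_neg hz))


/-! ### The conditional law of the requests -/

section Requests

variable {Ω : Type*} [MeasurableSpace Ω] {μ : Measure Ω} {M : ℕ} {Q : Kernel (Fin M) (Fin M × ℝ)}
  {T : ℕ → Ω → ℝ} {X : ℕ → Ω → Fin M} {τ : ℕ → Ω → ℝ} {q : Fin M → PMF ℕ} {R : ℕ → Ω → ℕ}

theorem IsStationarySemiMarkov.environmentSigma_le (hJ : IsStationarySemiMarkov Q T X μ)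
    (hτ : ∀ n, Measurable (τ n)) : environmentSigma T X τ ≤ ‹MeasurableSpace Ω› :=
  Measurable.comap_le (hJ.measurable_environment.prodMk (measurable_pi_lambda _ hτ))

theorem measurable_environmentSigma_arrival {Ω : Type*} {T : ℕ → Ω → ℝ} {X : ℕ → Ω → Fin M}
    {τ : ℕ → Ω → ℝ} (n : ℕ) : Measurable[environmentSigma T X τ] (τ n) :=
  ((measurable_pi_apply n).comp measurable_snd).comp
    (comap_measurable fun ω => ((fun n => (X n ω, T n ω), fun n => τ n ω) :
      (ℕ → Fin M × ℝ) × (ℕ → ℝ)))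

theorem measurable_environmentSigma_state {Ω : Type*} {T : ℕ → Ω → ℝ} {X : ℕ → Ω → Fin M}
    {τ : ℕ → Ω → ℝ} (n : ℕ) :
    Measurable[environmentSigma T X τ] fun ω => modulatingState T X (τ n ω) ω := by
  have h := measurable_modulatingState (Ω := ℕ → Fin M × ℝ) (T := fun n e => (e n).2)
    (X := fun n e => (e n).1) (fun n => (measurable_pi_apply n).snd)
    (fun n => (measurable_pi_apply n).fst)
  exact (h.comp (((measurable_pi_apply n).comp measurable_snd).prodMk measurable_fst)).comp
    (comap_measurable fun ω => ((fun n => (X n ω, T n ω), fun n => τ n ω) :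
      (ℕ → Fin M × ℝ) × (ℕ → ℝ)))

/-- On an event of the environment and the arrival times on which the first `b` requests meet the
states `s`, these requests are independent with the laws `q (s l)`. -/
theorem IsModulatedRequests.map_restrict_eq [IsProbabilityMeasure μ]
    (hR : IsModulatedRequests q T X τ R μ)
    (hle : environmentSigma T X τ ≤ ‹MeasurableSpace Ω›) {A : Set Ω}
    (hA : MeasurableSet[environmentSigma T X τ] A) {b : ℕ} {s : Fin b → Fin M}
    (hs : ∀ ω ∈ A, ∀ l : Fin b, modulatingState T X (τ l ω) ω = s l) :
    (μ.restrict A).map (fun ω (l : Fin b) => R l ω) =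
      μ A • Measure.pi fun l => (q (s l)).toMeasure := by
  have hRm : Measurable fun ω (l : Fin b) => R l ω := measurable_pi_lambda _ fun l => hR.measurable l
  refine Measure.ext_of_singleton fun y => ?_
  have hset : (fun ω (l : Fin b) => R l ω) ⁻¹' {y} = {ω | ∀ l < b, R l ω = extendByZero y l} := by
    ext ω
    constructor
    · intro h l hl
      have := congrFun (show (fun l : Fin b => R l ω) = y from h) ⟨l, hl⟩
      simpa [extendByZero, hl] using this
    · intro h
      change (fun l : Fin b => R l ω) = y
      funext l
      have := h l l.2
      simpa [extendByZero] using this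
  have hm : MeasurableSet {ω | ∀ l < b, R l ω = extendByZero y l} := by
    rw [← hset]; exact hRm (measurableSet_singleton y)
  rw [Measure.map_apply hRm (measurableSet_singleton y), hset, Measure.restrict_apply hm,
    Measure.smul_apply, smul_eq_mul, ← Set.univ_pi_singleton, Measure.pi_pi]
  simp_rw [PMF.toMeasure_apply_singleton _ _ (measurableSet_singleton _)]
  have h1 : ∫ ω in A, (μ⟦{ω | ∀ l < b, R l ω = extendByZero y l} | environmentSigma T X τ⟧) ω ∂μ =
      ∫ ω in A, ∏ l : Fin b, (q (s l) (y l)).toReal ∂μ := by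
    rw [setIntegral_congr_ae (hle _ hA)
      ((hR.conditional_law b (extendByZero y)).mono fun ω hω _ => hω)]
    refine setIntegral_congr_fun (hle _ hA) fun ω hω => ?_
    rw [Finset.prod_range]
    refine Finset.prod_congr rfl fun l _ => ?_
    rw [hs ω hω l]
    simp [extendByZero]
  rw [setIntegral_condExp hle ((integrable_const 1).indicator hm) hA,
    setIntegral_indicator hm] at h1
  simp only [integral_const, smul_eq_mul, mul_one, measureReal_restrict_apply_univ] at h1
  have hfin : ∏ l : Fin b, q (s l) (y l) ≠ ∞ :=
    ENNReal.prod_ne_top fun l _ => PMF.apply_ne_top _ _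
  rw [← ENNReal.toReal_eq_toReal_iff' (by finiteness) (by finiteness), ENNReal.toReal_mul,
    ENNReal.toReal_prod, Set.inter_comm]
  exact h1

/-- The law of a single request on an event of the environment and the arrival times on which the
request meets the state `r`. -/
theorem IsModulatedRequests.measure_inter_eq [IsProbabilityMeasure μ]
    (hR : IsModulatedRequests q T X τ R μ)
    (hle : environmentSigma T X τ ≤ ‹MeasurableSpace Ω›) {A : Set Ω}
    (hA : MeasurableSet[environmentSigma T X τ] A) {n : ℕ} {r : Fin M}
    (hr : ∀ ω ∈ A, modulatingState T X (τ n ω) ω = r) (i : ℕ) :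
    μ (A ∩ {ω | R n ω = i}) = μ A * q r i := by
  set J : Ω → Fin (n + 1) → Fin M := fun ω l => modulatingState T X (τ l ω) ω with hJ
  have hJm : ∀ s, MeasurableSet[environmentSigma T X τ] (A ∩ J ⁻¹' {s}) := by
    intro s
    have : Measurable[environmentSigma T X τ] J := by
      let := environmentSigma T X τ
      exact measurable_pi_lambda _ fun l => measurable_environmentSigma_state (l : ℕ)
    exact hA.inter (this (measurableSet_singleton s))
  have hdis : Pairwise (Function.onFun Disjoint fun s => A ∩ J ⁻¹' {s}) := by
    intro s s' hss
    rw [Function.onFun, Set.disjoint_left]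
    rintro ω ⟨-, h1⟩ ⟨-, h2⟩
    exact hss ((show J ω = s from h1).symm.trans h2)
  have hcov : A = ⋃ s, A ∩ J ⁻¹' {s} := by ext ω; simp
  have hRn : MeasurableSet {ω | R n ω = i} := hR.measurable n (measurableSet_singleton i)
  have key : ∀ s, μ ((A ∩ J ⁻¹' {s}) ∩ {ω | R n ω = i}) = μ (A ∩ J ⁻¹' {s}) * q r i := by
    intro s
    by_cases hsr : s (Fin.last n) = r
    · have h := hR.map_restrict_eq hle (hJm s) (s := s) fun ω hω l =>
        congrFun (show J ω = s from hω.2) l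
      have h2 := congrArg (fun ν => ν ((fun y : Fin (n + 1) → ℕ => y (Fin.last n)) ⁻¹' {i})) h
      have hmy : Measurable fun y : Fin (n + 1) → ℕ => y (Fin.last n) := measurable_pi_apply _
      have hRm : Measurable fun ω (l : Fin (n + 1)) => R l ω :=
        measurable_pi_lambda _ fun l => hR.measurable l
      have h3 := (measurePreserving_eval (fun l : Fin (n + 1) => (q (s l)).toMeasure)
        (Fin.last n)).measure_preimage (s := {i}) (measurableSet_singleton i).nullMeasurableSet
      rw [Measure.map_apply hRm (hmy (measurableSet_singleton i)),
        Measure.restrict_apply (hRm (hmy (measurableSet_singleton i))), Measure.smul_apply,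
        smul_eq_mul] at h2
      change _ = _ * (Measure.pi fun l => (q (s l)).toMeasure) (Function.eval (Fin.last n) ⁻¹' {i})
        at h2
      rw [h3, PMF.toMeasure_apply_singleton _ _ (measurableSet_singleton i), hsr] at h2
      rw [← h2, Set.inter_comm]
      rfl
    · have : A ∩ J ⁻¹' {s} = ∅ := by
        ext ω
        refine iff_of_false (fun hω => hsr ?_) (Set.notMem_empty ω)
        rw [← hr ω hω.1, ← show J ω = s from hω.2]
        simp [hJ]
      rw [this]; simp
  have e1 : A ∩ {ω | R n ω = i} = ⋃ s, (A ∩ J ⁻¹' {s}) ∩ {ω | R n ω = i} := by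
    rw [← Set.iUnion_inter, ← hcov]
  rw [e1, measure_iUnion (fun s s' hss => ((hdis hss).mono Set.inter_subset_left
    Set.inter_subset_left)) (fun s => (hle _ (hJm s)).inter hRn)]
  simp_rw [key]
  rw [ENNReal.tsum_mul_right, ← measure_iUnion hdis fun s => hle _ (hJm s), ← hcov]

/-! ### The static policy -/

/-- The mean number of faults of the static policy. -/
theorem lintegral_faultCount_static [IsProbabilityMeasure μ] (hJ : IsStationarySemiMarkov Q T X μ)
    (hτ : IsUnitPoisson τ μ)
    (hJτ : IndepFun (fun ω => fun n => (X n ω, T n ω)) (fun ω => fun n => τ n ω) μ)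
    (hR : IsModulatedRequests q T X τ R μ) (x : ℕ) (t : ℝ) :
    ∫⁻ ω, faultCount τ R (CachePolicy.static x) t ω ∂μ =
      ENNReal.ofReal t * ∑' k, popularity q T X μ (x + k) := by
  have hle := hJ.environmentSigma_le hτ.measurable
  set A : ℕ → Fin M → Set Ω := fun n r =>
    {ω | τ n ω ∈ Set.Ioc 0 t ∩ {u | modulatingState T X u ω = r}} with hA
  have hAm : ∀ n r, MeasurableSet[environmentSigma T X τ] (A n r) := fun n r =>
    (measurable_environmentSigma_arrival n measurableSet_Ioc).inter
      (measurable_environmentSigma_state n (measurableSet_singleton r))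
  have hRm : ∀ n i, MeasurableSet {ω | R n ω = i} := fun n i =>
    hR.measurable n (measurableSet_singleton i)
  have e1 : ∀ᵐ ω ∂μ, faultCount τ R (CachePolicy.static x) t ω =
      ∑' n, ∑ r, ∑' k, (A n r ∩ {ω | R n ω = x + k}).indicator 1 ω := by
    filter_upwards [hτ.ae_pos] with ω hω
    refine tsum_congr fun n => ?_
    simp only [CachePolicy.content_static, Finset.mem_range, not_lt]
    set r₀ := modulatingState T X (τ n ω) ω with hr₀
    by_cases hn : τ n ω ∈ Set.Icc 0 t ∧ x ≤ R n ω
    · rw [Set.indicator_of_mem (show n ∈ {n | τ n ω ∈ Set.Icc 0 t ∧ x ≤ R n ω} from hn),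
        Finset.sum_eq_single r₀, tsum_eq_single (R n ω - x), Set.indicator_of_mem]
      · rfl
      · exact ⟨⟨⟨hω n, hn.1.2⟩, rfl⟩, show R n ω = x + (R n ω - x) by omega⟩
      · intro k hk
        refine Set.indicator_of_notMem (fun h => hk ?_) _
        have : R n ω = x + k := h.2
        omega
      · intro r _ hr
        exact ENNReal.tsum_eq_zero.2 fun k => Set.indicator_of_notMem
          (fun h => hr (show modulatingState T X (τ n ω) ω = r from h.1.2).symm) _
      · simp
    · rw [Set.indicator_of_notMem (show n ∉ {n | τ n ω ∈ Set.Icc 0 t ∧ x ≤ R n ω} from hn)]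
      refine (Finset.sum_eq_zero fun r _ => ENNReal.tsum_eq_zero.2 fun k =>
        Set.indicator_of_notMem (fun h => hn ?_) _).symm
      have h2 : R n ω = x + k := h.2
      exact ⟨⟨h.1.1.1.le, h.1.1.2⟩, by omega⟩
  rw [lintegral_congr_ae e1]
  have hmeas : ∀ n r k, Measurable ((A n r ∩ {ω | R n ω = x + k}).indicator (1 : Ω → ℝ≥0∞)) :=
    fun n r k => measurable_one.indicator ((hle _ (hAm n r)).inter (hRm n _))
  rw [lintegral_tsum fun n => (Finset.measurable_sum _ fun r _ =>
    Measurable.tsum fun k => hmeas n r k).aemeasurable]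
  have e2 : ∀ n, ∫⁻ ω, ∑ r, ∑' k, (A n r ∩ {ω | R n ω = x + k}).indicator (1 : Ω → ℝ≥0∞) ω ∂μ =
      ∑ r, μ (A n r) * ∑' k, q r (x + k) := by
    intro n
    rw [lintegral_finsetSum _ fun r _ => Measurable.tsum fun k => hmeas n r k]
    refine Finset.sum_congr rfl fun r _ => ?_
    rw [lintegral_tsum fun k => (hmeas n r k).aemeasurable, ← ENNReal.tsum_mul_left]
    refine tsum_congr fun k => ?_
    rw [lintegral_indicator_one ((hle _ (hAm n r)).inter (hRm n _)),
      hR.measure_inter_eq hle (hAm n r) fun ω hω => hω.2]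
  simp_rw [e2]
  rw [Summable.tsum_finsetSum fun r _ => ENNReal.summable]
  have e3 : ∀ r, ∑' n, μ (A n r) * ∑' k, q r (x + k) =
      ENNReal.ofReal t * stationaryProb T X μ r * ∑' k, q r (x + k) := by
    intro r
    rw [ENNReal.tsum_mul_right]
    congr 1
    have h := lintegral_stateCount hJ hτ hJτ r (le_refl 0) (t := t)
    rw [sub_zero] at h
    rw [← h]
    have h2 : ∀ n, μ (A n r) = ∫⁻ ω, (A n r).indicator 1 ω ∂μ := fun n =>
      (lintegral_indicator_one (hle _ (hAm n r))).symm
    simp_rw [h2]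
    rw [← lintegral_tsum fun n => (measurable_one.indicator (hle _ (hAm n r))).aemeasurable]
    rfl
  simp_rw [e3, popularity]
  rw [Summable.tsum_finsetSum fun r _ => ENNReal.summable, Finset.mul_sum]
  exact Finset.sum_congr rfl fun r _ => by rw [ENNReal.tsum_mul_left, mul_assoc]

theorem faultProb_static [IsProbabilityMeasure μ] (hJ : IsStationarySemiMarkov Q T X μ)
    (hτ : IsUnitPoisson τ μ)
    (hJτ : IndepFun (fun ω => fun n => (X n ω, T n ω)) (fun ω => fun n => τ n ω) μ)
    (hR : IsModulatedRequests q T X τ R μ) (x : ℕ) :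
    faultProb τ R μ (CachePolicy.static x) = ∑' k, popularity q T X μ (x + k) := by
  have h : (fun t : ℝ => (∫⁻ ω, faultCount τ R (CachePolicy.static x) t ω ∂μ) / ENNReal.ofReal t)
      =ᶠ[atTop] fun _ => ∑' k, popularity q T X μ (x + k) := by
    filter_upwards [eventually_gt_atTop 0] with t ht
    rw [lintegral_faultCount_static hJ hτ hJτ hR, mul_comm,
      ENNReal.mul_div_cancel_right (ENNReal.ofReal_pos.2 ht).ne' ENNReal.ofReal_ne_top]
  rw [faultProb, limsup_congr h, limsup_const]

end Requests


/-! ### Faults in a block of time -/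

section Blocks

variable {Ω : Type*} {M : ℕ} {T : ℕ → Ω → ℝ} {X : ℕ → Ω → Fin M} {τ : ℕ → Ω → ℝ}
  {q : Fin M → PMF ℕ} {R : ℕ → Ω → ℕ}

/-- The event that the requests in the time interval `(u, v]` are those with numbers in `[a, b)`,
and that the requests with numbers less than `b` meet the states `s`. -/
def blockEvent (τ T : ℕ → Ω → ℝ) (X : ℕ → Ω → Fin M) (u v : ℝ) (a : ℕ) {b : ℕ}
    (s : Fin b → Fin M) : Set Ω :=
  {ω | (∀ n, τ n ω ∈ Set.Ioc u v ↔ a ≤ n ∧ n < b) ∧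
    ∀ l : Fin b, modulatingState T X (τ l ω) ω = s l}

/-- The number of faults in the time interval `(u, v]`. -/
noncomputable def blockFaults (τ : ℕ → Ω → ℝ) (R : ℕ → Ω → ℕ) {x : ℕ} (π : CachePolicy x) (u v : ℝ)
    (ω : Ω) : ℝ≥0∞ :=
  ∑' n, {n | τ n ω ∈ Set.Ioc u v ∧ R n ω ∉ π.content (fun k => R k ω) n}.indicator (fun _ => 1) n

theorem measurableSet_blockEvent (u v : ℝ) (a : ℕ) {b : ℕ} (s : Fin b → Fin M) :
    MeasurableSet[environmentSigma T X τ] (blockEvent τ T X u v a s) := by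
  have h1 : MeasurableSet[environmentSigma T X τ]
      {ω | ∀ n, τ n ω ∈ Set.Ioc u v ↔ a ≤ n ∧ n < b} := by
    have : {ω | ∀ n, τ n ω ∈ Set.Ioc u v ↔ a ≤ n ∧ n < b} =
        ⋂ n, {ω | τ n ω ∈ Set.Ioc u v ↔ a ≤ n ∧ n < b} := by ext ω; simp
    rw [this]
    refine MeasurableSet.iInter fun n => ?_
    by_cases hn : a ≤ n ∧ n < b
    · simp only [hn, and_self, iff_true]
      exact measurable_environmentSigma_arrival n measurableSet_Ioc
    · simp only [hn, iff_false]
      exact (measurable_environmentSigma_arrival n measurableSet_Ioc).compl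
  have h2 : MeasurableSet[environmentSigma T X τ]
      {ω | ∀ l : Fin b, modulatingState T X (τ l ω) ω = s l} := by
    have : {ω | ∀ l : Fin b, modulatingState T X (τ l ω) ω = s l} =
        ⋂ l : Fin b, {ω | modulatingState T X (τ l ω) ω = s l} := by ext ω; simp
    rw [this]
    exact MeasurableSet.iInter fun l =>
      measurable_environmentSigma_state (l : ℕ) (measurableSet_singleton (s l))
  exact h1.inter h2

theorem exists_forall_mem_Ioc_iff {t : ℕ → ℝ} (hmono : StrictMono t)
    (hlim : Tendsto t atTop atTop) (u v : ℝ) :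
    ∃ a b : ℕ, ∀ n, t n ∈ Set.Ioc u v ↔ a ≤ n ∧ n < b := by
  classical
  have key : ∀ w : ℝ, ∃ a : ℕ, ∀ n, w < t n ↔ a ≤ n := by
    intro w
    have hex : ∃ n, w < t n := (hlim.eventually_gt_atTop w).exists
    refine ⟨Nat.find hex, fun n => ⟨fun h => Nat.find_min' hex h, fun h => ?_⟩⟩
    exact (Nat.find_spec hex).trans_le (hmono.monotone h)
  obtain ⟨a, ha⟩ := key u
  obtain ⟨b, hb⟩ := key v
  exact ⟨a, b, fun n => by rw [Set.mem_Ioc, ha, ← not_lt (a := v), hb, not_le]⟩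

theorem stateCount_of_mem_blockEvent {u v : ℝ} {a b : ℕ} {s : Fin b → Fin M} {ω : Ω}
    (hω : ω ∈ blockEvent τ T X u v a s) (r : Fin M) :
    stateCount τ T X r u v ω =
      ((Finset.univ.filter fun l : Fin b => a ≤ l ∧ s l = r).card : ℝ≥0∞) := by
  classical
  have h0 : ∀ n ∉ Finset.range b,
      (Set.Ioc u v ∩ {u | modulatingState T X u ω = r}).indicator (1 : ℝ → ℝ≥0∞) (τ n ω) = 0 := by
    intro n hn
    refine Set.indicator_of_notMem (fun h => hn ?_) _
    exact Finset.mem_range.2 ((hω.1 n).1 h.1).2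
  rw [stateCount, tsum_eq_sum h0, Finset.sum_range, Finset.card_filter, Nat.cast_sum]
  refine Finset.sum_congr rfl fun l _ => ?_
  have h1 := hω.1 l
  have h2 := hω.2 l
  by_cases hl : a ≤ (l : ℕ) ∧ s l = r
  · rw [if_pos hl, Set.indicator_of_mem]
    · simp
    · exact ⟨h1.2 ⟨hl.1, l.2⟩, h2.trans hl.2⟩
  · rw [if_neg hl, Set.indicator_of_notMem]
    · simp
    · exact fun h => hl ⟨(h1.1 h.1).1, h2.symm.trans h.2⟩

theorem blockFaults_of_mem_blockEvent {u v : ℝ} {a b : ℕ} {s : Fin b → Fin M} {ω : Ω}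
    (hω : ω ∈ blockEvent τ T X u v a s) {x : ℕ} (π : CachePolicy x) :
    blockFaults τ R π u v ω = (((Finset.Ico a b).filter fun n =>
      extendByZero (fun l : Fin b => R l ω) n ∉
        π.content (extendByZero fun l : Fin b => R l ω) n).card : ℝ≥0∞) := by
  classical
  rw [blockFaults, tsum_eq_sum (s := (Finset.Ico a b).filter fun n =>
      extendByZero (fun l : Fin b => R l ω) n ∉
        π.content (extendByZero fun l : Fin b => R l ω) n), Finset.card_eq_sum_ones, Nat.cast_sum]
  all_goals
    have hext : ∀ n < b, extendByZero (fun l : Fin b => R l ω) n = R n ω := fun n hn => by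
      simp [extendByZero, hn]
    have hcont : ∀ n < b, π.content (extendByZero fun l : Fin b => R l ω) n =
        π.content (fun k => R k ω) n := fun n hn =>
      π.content_congr fun k hk => hext k (hk.trans hn)
  · refine Finset.sum_congr rfl fun n hn => ?_
    obtain ⟨h1, h2⟩ := Finset.mem_filter.1 hn
    have h3 := Finset.mem_Ico.1 h1
    rw [hext n h3.2, hcont n h3.2] at h2
    rw [Set.indicator_of_mem]
    · simp
    · exact ⟨(hω.1 n).2 h3, h2⟩
  · intro n hn
    refine Set.indicator_of_notMem (fun h => hn ?_) _
    have h3 := (hω.1 n).1 h.1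
    refine Finset.mem_filter.2 ⟨Finset.mem_Ico.2 h3, ?_⟩
    rw [hext n h3.2, hcont n h3.2]
    exact h.2

theorem sum_blockFaults_le_faultCount {B : ℝ} (hB : 0 < B) (K : ℕ) {x : ℕ} (π : CachePolicy x)
    (ω : Ω) : ∑ k ∈ Finset.range K, blockFaults τ R π (k * B) (k * B + B) ω ≤
      faultCount τ R π (K * B) ω := by
  classical
  simp only [blockFaults, faultCount]
  rw [← Summable.tsum_finsetSum fun k _ => ENNReal.summable]
  refine ENNReal.tsum_le_tsum fun n => ?_
  by_cases hex : ∃ k ∈ Finset.range K,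
      n ∈ {n | τ n ω ∈ Set.Ioc (k * B) (k * B + B) ∧ R n ω ∉ π.content (fun k => R k ω) n}
  · obtain ⟨k, hk, hn⟩ := hex
    have hkK : (k : ℝ) + 1 ≤ K := by exact_mod_cast Finset.mem_range.1 hk
    rw [Finset.sum_eq_single k, Set.indicator_of_mem hn, Set.indicator_of_mem]
    · refine ⟨⟨le_trans (by positivity) hn.1.1.le, hn.1.2.trans ?_⟩, hn.2⟩
      nlinarith
    · intro j _ hjk
      refine Set.indicator_of_notMem (fun hj => hjk ?_) _
      have a1 := hn.1.1.trans_le hj.1.2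
      have a2 := hj.1.1.trans_le hn.1.2
      have b1 : (k : ℝ) < j + 1 := by
        by_contra! hcon
        nlinarith
      have b2 : (j : ℝ) < k + 1 := by
        by_contra! hcon
        nlinarith
      have c1 : k < j + 1 := by exact_mod_cast b1
      have c2 : j < k + 1 := by exact_mod_cast b2
      omega
    · exact fun h => absurd hk h
  · push Not at hex
    rw [Finset.sum_eq_zero fun k hk => Set.indicator_of_notMem (hex k hk) _]
    exact zero_le

variable [MeasurableSpace Ω] {μ : Measure Ω} {Q : Kernel (Fin M) (Fin M × ℝ)}

theorem popularity_ne_top [IsProbabilityMeasure μ] (i : ℕ) : popularity q T X μ i ≠ ∞ :=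
  ENNReal.sum_ne_top.2 fun r _ =>
    ENNReal.mul_ne_top (stationaryProb_ne_top r) (PMF.apply_ne_top _ _)

theorem toReal_popularity [IsProbabilityMeasure μ] (i : ℕ) :
    (popularity q T X μ i).toReal = ∑ r, (stationaryProb T X μ r).toReal * (q r i).toReal := by
  rw [popularity, ENNReal.toReal_sum fun r _ =>
    ENNReal.mul_ne_top (stationaryProb_ne_top r) (PMF.apply_ne_top _ _)]
  simp_rw [ENNReal.toReal_mul]

/-- The probability that a Poisson variable of mean `c * popularity i` is positive. In a block in
which each state `r` meets at least `c * π r` requests, it bounds the probability that the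
document `i` is requested from below. -/
noncomputable def requestProbLower (q : Fin M → PMF ℕ) (T : ℕ → Ω → ℝ) (X : ℕ → Ω → Fin M)
    (μ : Measure Ω) (c : ℝ) (i : ℕ) : ℝ≥0∞ :=
  ENNReal.ofReal (1 - Real.exp (-(c * (popularity q T X μ i).toReal)))

theorem antitone_requestProbLower [IsProbabilityMeasure μ] (hanti : Antitone (popularity q T X μ))
    {c : ℝ} (hc : 0 ≤ c) : Antitone (requestProbLower q T X μ c) := by
  intro i j hij
  refine ENNReal.ofReal_le_ofReal (sub_le_sub_left (Real.exp_le_exp.2 (neg_le_neg ?_)) _)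
  exact mul_le_mul_of_nonneg_left (ENNReal.toReal_mono (popularity_ne_top i) (hanti hij)) hc

/-- On the event that the requests of a block meet the states `s`, in sufficient numbers, the mean
number of faults in this block is bounded from below. -/
theorem mul_tsum_requestProbLower_le_setLIntegral [IsProbabilityMeasure μ]
    (hR : IsModulatedRequests q T X τ R μ)
    (hle : environmentSigma T X τ ≤ ‹MeasurableSpace Ω›)
    (hanti : Antitone (popularity q T X μ)) {c : ℝ} (hc : 0 ≤ c) {u v : ℝ} {a b : ℕ}
    {s : Fin b → Fin M}
    (hs : ∀ r, c * (stationaryProb T X μ r).toReal ≤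
      (Finset.univ.filter fun l : Fin b => a ≤ l ∧ s l = r).card) {x : ℕ} (π : CachePolicy x) :
    μ (blockEvent τ T X u v a s) * ∑' k, requestProbLower q T X μ c (x + k) ≤
      ∫⁻ ω in blockEvent τ T X u v a s, blockFaults τ R π u v ω ∂μ := by
  classical
  have hA := measurableSet_blockEvent (T := T) (X := X) (τ := τ) u v a s
  have hRm : Measurable fun ω (l : Fin b) => R l ω := measurable_pi_lambda _ fun l => hR.measurable l
  have hlaw := hR.map_restrict_eq hle hA (s := s) fun ω hω => hω.2
  set F : (Fin b → ℕ) → ℝ≥0∞ := fun y => (((Finset.Ico a b).filter fun n =>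
      extendByZero y n ∉ π.content (extendByZero y) n).card : ℝ≥0∞) with hF
  rw [setLIntegral_congr_fun (g := fun ω => F fun l : Fin b => R l ω) (hle _ hA)
    (fun ω hω => blockFaults_of_mem_blockEvent hω π),
    ← lintegral_map (f := F) (measurable_of_countable _) hRm, hlaw, lintegral_smul_measure,
    smul_eq_mul]
  gcongr
  refine tsum_add_le_lintegral_faults a π (fun l => q (s l)) (antitone_requestProbLower hanti hc)
    fun i => ?_
  set z := c * (popularity q T X μ i).toReal with hz
  have hz0 : 0 ≤ z := mul_nonneg hc ENNReal.toReal_nonneg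
  have hsum : z ≤ ∑ l ∈ Finset.univ.filter fun l : Fin b => a ≤ l, (q (s l) i).toReal := by
    have h1 : ∑ l ∈ Finset.univ.filter fun l : Fin b => a ≤ l, (q (s l) i).toReal =
        ∑ r, ((Finset.univ.filter fun l : Fin b => a ≤ l ∧ s l = r).card : ℝ) * (q r i).toReal := by
      rw [← Finset.sum_fiberwise_of_maps_to (t := Finset.univ) (g := s)
        fun l _ => Finset.mem_univ _]
      refine Finset.sum_congr rfl fun r _ => ?_
      rw [Finset.filter_filter, ← nsmul_eq_mul, ← Finset.sum_const]
      exact Finset.sum_congr rfl fun l hl => by rw [(Finset.mem_filter.1 hl).2.2]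
    rw [h1, hz, toReal_popularity, Finset.mul_sum]
    refine Finset.sum_le_sum fun r _ => ?_
    rw [← mul_assoc]
    exact mul_le_mul_of_nonneg_right (hs r) ENNReal.toReal_nonneg
  refine (add_le_add le_rfl (measure_pi_forall_ne_le a (fun l => q (s l)) i hsum)).trans ?_
  have hexp : Real.exp (-z) ≤ 1 := Real.exp_le_one_iff.2 (neg_nonpos.2 hz0)
  rw [requestProbLower, ← ENNReal.ofReal_add (sub_nonneg.2 hexp) (Real.exp_pos _).le]
  simp [hz]

/-- If each state probably meets sufficiently many requests in a block, then the mean number of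
faults in this block is bounded from below, whatever the policy. -/
theorem tsum_requestProbLower_le_lintegral [IsProbabilityMeasure μ]
    (hJ : IsStationarySemiMarkov Q T X μ) (hπ : ∀ r, 0 < stationaryProb T X μ r)
    (hτ : IsUnitPoisson τ μ) (hR : IsModulatedRequests q T X τ R μ)
    (hanti : Antitone (popularity q T X μ)) {c : ℝ} (hc : 0 < c) {u v ε : ℝ}
    (hcount : ∀ r, μ.real {ω | (stateCount τ T X r u v ω).toReal <
      c * (stationaryProb T X μ r).toReal} ≤ ε) {x : ℕ} (π : CachePolicy x) :
    ENNReal.ofReal (1 - M * ε) * ∑' k, requestProbLower q T X μ c (x + k) ≤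
      ∫⁻ ω, blockFaults τ R π u v ω ∂μ := by
  classical
  have hle := hJ.environmentSigma_le hτ.measurable
  have hM : Nonempty (Fin M) := (nonempty_of_isProbabilityMeasure μ).map (X 0)
  let Good : (ℕ × Σ b : ℕ, (Fin b → Fin M)) → Prop := fun j =>
    ∀ r, c * (stationaryProb T X μ r).toReal ≤
      ((Finset.univ.filter fun l : Fin j.2.1 => j.1 ≤ l ∧ j.2.2 l = r).card : ℝ)
  let A : {j // Good j} → Set Ω := fun j => blockEvent τ T X u v j.1.1 j.1.2.2
  have hAm : ∀ j, MeasurableSet (A j) := fun j => hle _ (measurableSet_blockEvent u v _ _)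
  -- a good block is not empty, so that its first and last numbers are determined
  have hne : ∀ j : {j // Good j}, j.1.1 < j.1.2.1 := by
    rintro ⟨⟨a, b, s⟩, hj⟩
    obtain ⟨r⟩ := hM
    have h1 := hj r
    have h2 : 0 < c * (stationaryProb T X μ r).toReal :=
      mul_pos hc (ENNReal.toReal_pos (hπ r).ne' (stationaryProb_ne_top r))
    have h3 : 0 < (Finset.univ.filter fun l : Fin b => a ≤ l ∧ s l = r).card := by
      exact_mod_cast h2.trans_le h1
    obtain ⟨l, hl⟩ := Finset.card_pos.1 h3
    exact (Finset.mem_filter.1 hl).2.1.trans_lt l.2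
  have hdis : Pairwise (Function.onFun Disjoint A) := by
    intro j j' hjj
    rw [Function.onFun, Set.disjoint_left]
    intro ω h h'
    have hn := hne j
    have hn' := hne j'
    obtain ⟨⟨a, b, s⟩, hj⟩ := j
    obtain ⟨⟨a', b', s'⟩, hj'⟩ := j'
    have hiff : ∀ n, (a ≤ n ∧ n < b) ↔ (a' ≤ n ∧ n < b') := fun n =>
      (h.1 n).symm.trans (h'.1 n)
    simp only at hn hn'
    have ha : a = a' := by
      have h1 := (hiff a).1 ⟨le_rfl, hn⟩
      have h2 := (hiff a').2 ⟨le_rfl, hn'⟩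
      omega
    have hb : b = b' := by
      have h1 := (hiff (b - 1)).1 ⟨by omega, by omega⟩
      have h2 := (hiff (b' - 1)).2 ⟨by omega, by omega⟩
      omega
    subst ha hb
    have hs : s = s' := funext fun l => (h.2 l).symm.trans (h'.2 l)
    subst hs
    exact hjj rfl
  have hcov : ∀ᵐ ω ∂μ, ω ∉ ⋃ r, {ω | (stateCount τ T X r u v ω).toReal <
      c * (stationaryProb T X μ r).toReal} → ω ∈ ⋃ j, A j := by
    filter_upwards [hτ.strictMono, hτ.locally_finite] with ω hmono hlim hω
    obtain ⟨a, b, hab⟩ := exists_forall_mem_Ioc_iff hmono hlim u v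
    let s : Fin b → Fin M := fun l => modulatingState T X (τ l ω) ω
    have hmem : ω ∈ blockEvent τ T X u v a s := ⟨hab, fun l => rfl⟩
    refine Set.mem_iUnion.2 ⟨⟨⟨a, b, s⟩, fun r => ?_⟩, hmem⟩
    have h1 : ¬ (stateCount τ T X r u v ω).toReal < c * (stationaryProb T X μ r).toReal :=
      fun h => hω (Set.mem_iUnion.2 ⟨r, h⟩)
    rw [not_lt, stateCount_of_mem_blockEvent hmem r, ENNReal.toReal_natCast] at h1
    exact h1
  have hprob : ENNReal.ofReal (1 - M * ε) ≤ μ (⋃ j, A j) := by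
    set U := ⋃ r, {ω | (stateCount τ T X r u v ω).toReal <
      c * (stationaryProb T X μ r).toReal} with hU
    have hUm : MeasurableSet U := MeasurableSet.iUnion fun r =>
      measurableSet_lt (hJ.measurable_stateCount hτ.measurable r u v).ennreal_toReal
        measurable_const
    have h1 : μ.real U ≤ M * ε := by
      refine (measureReal_iUnion_fintype_le _).trans ((Finset.sum_le_sum fun r _ => hcount r).trans ?_)
      simp
    have h2 : μ.real Uᶜ = 1 - μ.real U := probReal_compl_eq_one_sub hUm
    calc ENNReal.ofReal (1 - M * ε) ≤ ENNReal.ofReal (μ.real Uᶜ) :=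
          ENNReal.ofReal_le_ofReal (by linarith)
      _ = μ Uᶜ := by rw [measureReal_def, ENNReal.ofReal_toReal (by finiteness)]
      _ ≤ μ (⋃ j, A j) := measure_mono_ae hcov
  calc ENNReal.ofReal (1 - M * ε) * ∑' k, requestProbLower q T X μ c (x + k)
      ≤ μ (⋃ j, A j) * ∑' k, requestProbLower q T X μ c (x + k) := by gcongr
    _ = ∑' j, μ (A j) * ∑' k, requestProbLower q T X μ c (x + k) := by
        rw [measure_iUnion hdis hAm, ENNReal.tsum_mul_right]
    _ ≤ ∑' j, ∫⁻ ω in A j, blockFaults τ R π u v ω ∂μ := ENNReal.tsum_le_tsum fun j =>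
        mul_tsum_requestProbLower_le_setLIntegral hR hle hanti hc.le j.2 π
    _ = ∫⁻ ω in ⋃ j, A j, blockFaults τ R π u v ω ∂μ := (lintegral_iUnion hAm hdis _).symm
    _ ≤ _ := setLIntegral_le_lintegral _ _

/-! ### Asymptotic optimality -/

theorem sum_lintegral_le_lintegral_sum (s : Finset ℕ) (f : ℕ → Ω → ℝ≥0∞) :
    ∑ k ∈ s, ∫⁻ ω, f k ω ∂μ ≤ ∫⁻ ω, ∑ k ∈ s, f k ω ∂μ := by
  classical
  induction s using Finset.induction_on with
  | empty => simp
  | insert k s hk ih =>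
    simp only [Finset.sum_insert hk]
    exact (add_le_add le_rfl ih).trans (le_lintegral_add _ _)

/-- A lower bound for the mean number of faults in all blocks of length `B` bounds the long-run
fault probability. -/
theorem div_le_faultProb {B : ℝ} (hB : 0 < B) {x : ℕ} (π : CachePolicy x) {d : ℝ≥0∞}
    (h : ∀ k : ℕ, d ≤ ∫⁻ ω, blockFaults τ R π (k * B) (k * B + B) ω ∂μ) :
    d / ENNReal.ofReal B ≤ faultProb τ R μ π := by
  refine le_limsup_of_frequently_le ?_
  rw [frequently_atTop]
  intro t
  obtain ⟨K, hK⟩ := exists_nat_ge (max 1 (t / B))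
  have hK1 : (1 : ℝ) ≤ K := (le_max_left _ _).trans hK
  have hK0 : (K : ℝ≥0∞) ≠ 0 := by
    have : K ≠ 0 := by
      rintro rfl
      norm_num at hK1
    exact_mod_cast this
  refine ⟨K * B, (div_le_iff₀ hB).1 ((le_max_right _ _).trans hK), ?_⟩
  have h1 : K * d ≤ ∫⁻ ω, faultCount τ R π (K * B) ω ∂μ := by
    calc (K : ℝ≥0∞) * d = ∑ k ∈ Finset.range K, d := by simp
      _ ≤ ∑ k ∈ Finset.range K, ∫⁻ ω, blockFaults τ R π (k * B) (k * B + B) ω ∂μ :=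
          Finset.sum_le_sum fun k _ => h k
      _ ≤ _ := (sum_lintegral_le_lintegral_sum _ _).trans
          (lintegral_mono fun ω => sum_blockFaults_le_faultCount hB K π ω)
  calc d / ENNReal.ofReal B = (K * d) / (K * ENNReal.ofReal B) :=
        (ENNReal.mul_div_mul_left _ _ hK0 (by finiteness)).symm
    _ = (K * d) / ENNReal.ofReal (K * B) := by
        rw [ENNReal.ofReal_mul (by positivity), ENNReal.ofReal_natCast]
    _ ≤ _ := by gcongr

theorem tsum_popularity [IsProbabilityMeasure μ] (hJ : IsStationarySemiMarkov Q T X μ) :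
    ∑' i, popularity q T X μ i = 1 := by
  simp only [popularity]
  rw [Summable.tsum_finsetSum fun r _ => ENNReal.summable]
  simp_rw [ENNReal.tsum_mul_left, PMF.tsum_coe, mul_one]
  exact hJ.sum_stationaryProb

/-- For rarely requested documents, the probability of a request in a block is nearly the mean
number of requests. -/
theorem ofReal_mul_le_requestProbLower [IsProbabilityMeasure μ] {c ε : ℝ} (hc : 0 ≤ c)
    (hε1 : ε ≤ 1) {i : ℕ} (hi : c * (popularity q T X μ i).toReal ≤ ε) :
    ENNReal.ofReal ((1 - ε) * c) * popularity q T X μ i ≤ requestProbLower q T X μ c i := by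
  set z := c * (popularity q T X μ i).toReal with hz
  have hz0 : 0 ≤ z := mul_nonneg hc ENNReal.toReal_nonneg
  have h1 : Real.exp (-z) * (1 + z) ≤ 1 := by
    calc Real.exp (-z) * (1 + z) ≤ Real.exp (-z) * Real.exp z := by
          gcongr
          linarith [Real.add_one_le_exp z]
      _ = 1 := by rw [← Real.exp_add]; simp
  have h2 : (1 - ε) * z ≤ 1 - Real.exp (-z) := by
    have h3 := (Real.exp_pos (-z)).le
    have h4 : Real.exp (-z) ≤ 1 - z + z * z := by
      by_contra! hcon
      nlinarith [mul_nonneg hz0 (mul_nonneg hz0 hz0)]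
    nlinarith
  rw [← ENNReal.ofReal_toReal (popularity_ne_top (q := q) (T := T) (X := X) (μ := μ) i),
    ← ENNReal.ofReal_mul (mul_nonneg (by linarith) hc), mul_assoc]
  exact ENNReal.ofReal_le_ofReal h2

/-- For every sufficiently large cache, the fault probability of every policy is nearly at least
the one of the static policy. -/
theorem eventually_mul_le_faultProb [IsProbabilityMeasure μ] [IsMarkovKernel Q]
    (hJ : IsStationarySemiMarkov Q T X μ) (hπ : ∀ r, 0 < stationaryProb T X μ r)
    (hτ : IsUnitPoisson τ μ)
    (hJτ : IndepFun (fun ω => fun n => (X n ω, T n ω)) (fun ω => fun n => τ n ω) μ)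
    (hR : IsModulatedRequests q T X τ R μ) (hanti : Antitone (popularity q T X μ))
    {ε : ℝ} (hε : 0 < ε) (hε1 : ε < 1) :
    ∀ᶠ x : ℕ in atTop, ∀ π : CachePolicy x,
      ENNReal.ofReal ((1 - M * ε) * (1 - ε) ^ 2) * ∑' k, popularity q T X μ (x + k) ≤
        faultProb τ R μ π := by
  obtain ⟨B, hB, hcount⟩ := exists_measure_stateCount_lt_le hJ hτ hJτ hπ hε
  set c := (1 - ε) * B with hc
  have hc0 : 0 < c := mul_pos (by linarith) hB
  have hlim : Tendsto (fun i => c * (popularity q T X μ i).toReal) atTop (𝓝 0) := by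
    have h1 := ENNReal.tendsto_atTop_zero_of_tsum_ne_top (f := popularity q T X μ)
      (by rw [tsum_popularity hJ]; exact ENNReal.one_ne_top)
    have h2 := ((ENNReal.tendsto_toReal ENNReal.zero_ne_top).comp h1).const_mul c
    simpa using h2
  obtain ⟨i₀, hi₀⟩ := (hlim.eventually (ge_mem_nhds hε)).exists_forall_of_atTop
  filter_upwards [eventually_ge_atTop i₀] with x hx π
  have hblock : ∀ k : ℕ, ENNReal.ofReal (1 - M * ε) * ∑' k, requestProbLower q T X μ c (x + k) ≤
      ∫⁻ ω, blockFaults τ R π (k * B) (k * B + B) ω ∂μ := fun k =>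
    tsum_requestProbLower_le_lintegral hJ hπ hτ hR hanti hc0
      (fun r => by
        have := hcount (k * B) (by positivity) r
        rwa [mul_right_comm] at this) π
  refine le_trans ?_ (div_le_faultProb hB π hblock)
  rw [ENNReal.le_div_iff_mul_le (Or.inl (ENNReal.ofReal_pos.2 hB).ne')
    (Or.inl ENNReal.ofReal_ne_top)]
  calc ENNReal.ofReal ((1 - M * ε) * (1 - ε) ^ 2) * (∑' k, popularity q T X μ (x + k)) *
        ENNReal.ofReal B
      = ENNReal.ofReal (1 - M * ε) * ∑' k, ENNReal.ofReal ((1 - ε) * c) *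
          popularity q T X μ (x + k) := by
        rw [ENNReal.tsum_mul_left, ENNReal.ofReal_mul' (by positivity), hc, ← mul_assoc (1 - ε),
          ← pow_two, ENNReal.ofReal_mul (p := (1 - ε) ^ 2) (by positivity)]
        ring
    _ ≤ _ := by
        gcongr with k
        exact ofReal_mul_le_requestProbLower hc0.le hε1.le (hi₀ _ (hx.trans (Nat.le_add_right _ _)))

end Blocks

theorem mainTheorem1 {Ω : Type*} [MeasurableSpace Ω] (μ : Measure Ω) [IsProbabilityMeasure μ]
    {M : ℕ} (Q : Kernel (Fin M) (Fin M × ℝ)) [IsMarkovKernel Q]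
    (T : ℕ → Ω → ℝ) (X : ℕ → Ω → Fin M) (τ : ℕ → Ω → ℝ)
    (q : Fin M → PMF ℕ) (R : ℕ → Ω → ℕ)
    (hJ : IsStationarySemiMarkov Q T X μ)
    (hπ : ∀ r, 0 < stationaryProb T X μ r)
    (hτ : IsUnitPoisson τ μ)
    (hJτ : IndepFun (fun ω => fun n => (X n ω, T n ω)) (fun ω => fun n => τ n ω) μ)
    (hR : IsModulatedRequests q T X τ R μ)
    (hpos : ∀ i, 0 < popularity q T X μ i)
    (hanti : Antitone (popularity q T X μ)) :
    (∀ x : ℕ, faultProb τ R μ (CachePolicy.static x) = ∑' k : ℕ, popularity q T X μ (x + k)) ∧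
    Tendsto (fun x : ℕ => (⨅ π : CachePolicy x, faultProb τ R μ π) /
      faultProb τ R μ (CachePolicy.static x)) atTop (𝓝 1) := by
  have hstatic := fun x => faultProb_static hJ hτ hJτ hR x
  refine ⟨hstatic, ?_⟩
  have hne0 : ∀ x : ℕ, ∑' k, popularity q T X μ (x + k) ≠ 0 := fun x =>
    ((hpos (x + 0)).trans_le (ENNReal.le_tsum 0)).ne'
  have hnetop : ∀ x : ℕ, ∑' k, popularity q T X μ (x + k) ≠ ∞ := fun x => by
    refine ne_top_of_le_ne_top ENNReal.one_ne_top ?_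
    rw [← tsum_popularity (q := q) hJ]
    exact ENNReal.tsum_comp_le_tsum_of_injective (add_right_injective x) _
  refine tendsto_order.2 ⟨fun a ha => ?_, fun a ha => ?_⟩
  · have hlim : Tendsto (fun ε : ℝ => ENNReal.ofReal ((1 - M * ε) * (1 - ε) ^ 2)) (𝓝[>] 0)
        (𝓝 1) := by
      have h1 : Continuous fun ε : ℝ => ENNReal.ofReal ((1 - M * ε) * (1 - ε) ^ 2) :=
        ENNReal.continuous_ofReal.comp (by fun_prop)
      have h2 := (h1.tendsto 0).mono_left (nhdsWithin_le_nhds (s := Set.Ioi 0))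
      simpa using h2
    obtain ⟨ε, hεa, hε⟩ := ((hlim.eventually (lt_mem_nhds ha)).and
      (Ioo_mem_nhdsGT zero_lt_one)).exists
    filter_upwards [eventually_mul_le_faultProb hJ hπ hτ hJτ hR hanti hε.1 hε.2] with x hx
    refine hεa.trans_le ?_
    rw [hstatic, ENNReal.le_div_iff_mul_le (Or.inl (hne0 x)) (Or.inl (hnetop x))]
    exact le_iInf hx
  · refine Eventually.of_forall fun x => lt_of_le_of_lt ?_ ha
    exact (ENNReal.div_le_div_right (iInf_le _ (CachePolicy.static x)) _).trans
      ENNReal.div_self_le_one
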